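/- Let $p$ be a prime. All pro-$p$ groups carry their profinite topology, and homomorphisms and functors are continuous. Let $\mathrm{pGrpd}$ be the collection of pro-$p$ groupoids with finitely many isomorphism classes of objects whose automorphism groups are finitely presented pro-$p$ groups. Let $\mathrm{Cospan}(\mathrm{pGrpd})$ have the objects of $\mathrm{pGrpd}$ as objects and, as morphisms $\mathfrak G_1\to\mathfrak G_2$, cospans $\mathfrak G_1\to\mathfrak G_{12}\leftarrow\mathfrak G_2$ modulo equivalences of $\mathfrak G_{12}$ compatible with the legs up to natural isomorphism; composition is by homotopy pushout $\mathfrak G_{12}\coprod_{\mathfrak G_2}\mathfrak G_{23}$ in $\mathrm{pGrpd}$. The tensor product is the coproduct $\coprod$, the unit is $\emptyset$, and the structure isomorphisms are the evident ones. Let $\mathrm{Proj}(\mathbb C)$ be the symmetric monoidal category of finite-dimensional complex vector spaces. For a set $S$ let $\mathcal O(S)$ be the space of functions $S\to\mathbb C$. Let $\Gamma$ be a finite $p$-group and write $P_\Gamma(\mathfrak G)=\mathrm{Fun}(\mathfrak G,B\Gamma)$, $Z(\mathfrak G)=\mathcal O(\pi_0P_\Gamma(\mathfrak G))$. For a cospan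 $C=(\mathfrak G_1\to\mathfrak G_{12}\leftarrow\mathfrak G_2)$ let $r_i:P_\Gamma(\mathfrak G_{12})\to P_\Gamma(\mathfrak G_i)$ be the restrictions and let $Z(C)=r_{2*}\circ r_1^*:Z(\mathfrak G_1)\to Z(\mathfrak G_2)$, that is, $$Z(C)(F)(P)=\sum_{Q\in\pi_0P_\Gamma(\mathfrak G_{12}),\ r_2(Q)=P}\frac{|\mathrm{Aut}(P)|}{|\mathrm{Aut}(Q)|}F(r_1(Q)).$$ Then: (1) $\mathrm{Cospan}(\mathrm{pGrpd})$ is a symmetric monoidal category (in particular the homotopy pushouts exist), the sets $\pi_0P_\Gamma(\mathfrak G)$ and the groups $\mathrm{Aut}(P)$ are finite, and $Z$ is a symmetric monoidal functor $\mathrm{Cospan}(\mathrm{pGrpd})\to\mathrm{Proj}(\mathbb C)$ with structure maps $F\otimes F'\mapsto\big(P\mapsto F(P|_{\mathfrak G})F'(P|_{\mathfrak H})\big)$ and $1\mapsto 1$. (2) $Z$ defines a pro-$p$ TQFT. For a functor $f:\mathfrak G\to\mathfrak H$ let $f_\#=Z(\mathfrak G\xrightarrow{f}\mathfrak H\xleftarrow{\mathrm{id}}\mathfrak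 H)$. Then $f_\#$ is bijective if $f$ is an equivalence; $(g\circ f)_\#=g_\#\circ f_\#$; if $e,f,g$ are equivalences from the apex, the source and the target of a cospan $C$ to those of $C'$, compatible with the legs up to isomorphism, then $g_\#\circ Z(C)=Z(C')\circ f_\#$; and if $E$ is obtained by gluing cospans $C$ and $D$ along an equivalence $f$ from the target of $C$ to the source of $D$, then $Z(E)=Z(D)\circ f_\#\circ Z(C)$. (3) Let $(N_i)_{i\in I}$, $(U_j)_{j\in J}$ be finite families of finitely presented pro-$p$ groups. Then $\pi_0P_\Gamma(\coprod_iBN_i)=\prod_i\mathrm{Hom}(N_i,\Gamma)/\!\sim$, where $\sim$ is conjugation by $\Gamma$. If $G$ is a finitely presented pro-$p$ group with homomorphisms $\phi_i:N_i\to G$, $\tau_j:U_j\to G$, then $\mathrm{Hom}(G,\Gamma)/\!\sim$ is finite and the cospan $\coprod_iBN_i\to BG\leftarrow\coprod_jBU_j$ acts by $$Z(F)\big(([\sigma_j])_j\big)=\sum_{[\rho]\in\mathrm{Hom}(G,\Gamma)/\sim,\ \rho\circ\tau_j\sim\sigma_j\,\forall j}\frac{\prod_j|C_\Gamma(\sigma_j)|}{|C_\Gamma(\rho)|}\,F\big(([\rho\circ\phi_i])_i\big),$$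 where $C_\Gamma(\rho)$ is the centralizer of the image of $\rho$. (4) Evaluation at $1\in\mathbb Z_p$ is a bijection $\mathrm{Hom}(\mathbb Z_p,\Gamma)\to\Gamma$ and induces a linear isomorphism $Z(B\mathbb Z_p)=\mathcal O(\Gamma/\!\sim)\cong Z(\mathbb C\Gamma)$, $F\mapsto\sum_gF(g)g$, onto the centre of the group algebra. Write $(G;\{g_1,\dots\},\{h_1,\dots\})$ for the cospan $\coprod_i B\mathbb Z_p\to BG\leftarrow\coprod_j B\mathbb Z_p$ given by $1\mapsto g_i$, $1\mapsto h_j$; let $\langle\dots\rangle$ be the free pro-$p$ group, $[x,y]=x^{-1}y^{-1}xy$, and, for an irreducible complex representation $\rho$ of $\Gamma$, $b_\rho=\sum_g\chi_\rho(g)g$. Under the above isomorphism the values on the generators are: - $C_{1,0}=(1;\{1\},\emptyset)$: the counit $\sum_g\lambda_gg\mapsto\lambda_e/|\Gamma|$; - $C_{0,1}=(1;\emptyset,\{1\})$: the unit $\lambda\mapsto\lambda e$; - $P_{2,1}=(\langle a,b\rangle;\{a,b\},\{ab\})$: the product of $Z(\mathbb C\Gamma)$, i.e. the convolution $m(F,F')(g)=\sum_{hk=g}F(h)F'(k)$;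 - $P_{1,2}=(\langle a,b\rangle;\{ab\},\{a,b\})$: $\sum_k\lambda_kk\mapsto\sum_{\rho\in\mathrm{Irr}(\Gamma)}\sum_{g,h,k}\chi_\rho(g)\chi_\rho(h^{-1})\lambda_{kh}\,g\otimes k$, and $b_\rho\mapsto\frac{|\Gamma|}{\dim\rho}b_\rho\otimes b_\rho$; - $T_{1,1}=(\langle s,x,y\rangle;\{s\},\{s[x,y]\})$: $b_\rho\mapsto\big(\frac{|\Gamma|}{\dim\rho}\big)^2b_\rho$; - $T^r_{1,1}=(\langle s,x,y\rangle;\{s\},\{sx^{p^r}[x,y]\})$ for integers $r\ge0$: $b_\rho\mapsto\frac{|\Gamma|}{\dim\rho}\sum_g\Big(\sum_h\chi_\rho\big((gh^{-1})^{1-p^r}\big)\chi_\rho(h)\Big)g$; - for $\alpha\in\mathbb Z_p^\times$ and $f_\alpha:\mathbb Z_p\to\mathbb Z_p$, $1\mapsto\alpha$: the cospan $B\mathbb Z_p\xrightarrow{f_\alpha}B\mathbb Z_p\xleftarrow{\mathrm{id}}B\mathbb Z_p$ acts by $F\mapsto\big(g\mapsto F(g^{\alpha})\big)$, and the cospan $B\mathbb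 Z_p\xrightarrow{\mathrm{id}}B\mathbb Z_p\xleftarrow{f_\alpha}B\mathbb Z_p$ acts by the twist $F\mapsto\big(g\mapsto F(g^{\alpha^{-1}})\big)$. -/

import Mathlib

open CategoryTheory MonoidalCategory

noncomputable section

namespace ProPDW

/-! ### Pro-`p` groups, free pro-`p` groups, finite presentations -/

/-- `G` is a pro-`p` group: a compact, Hausdorff, totally disconnected topological group all of
whose quotients by open normal subgroups are `p`-groups. -/
structure IsProP (p : ℕ) (G : Type) [Group G] [TopologicalSpace G] : Prop where
  isTopologicalGroup : IsTopologicalGroup G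
  compactSpace : CompactSpace G
  t2Space : T2Space G
  totallyDisconnectedSpace : TotallyDisconnectedSpace G
  isPGroup_quotient : ∀ (U : Subgroup G) [U.Normal], IsOpen (U : Set G) → IsPGroup p (G ⧸ U)

/-- The normal subgroups of `p`-power index of the (discrete) free group on `X`. -/
def PIndex (p : ℕ) (X : Type) : Type :=
  {N : Subgroup (FreeGroup X) // N.Normal ∧ ∃ k : ℕ, N.index = p ^ k}

instance (p : ℕ) (X : Type) (N : PIndex p X) : N.1.Normal := N.2.1

/-- The finite `p`-group quotient of the free group attached to `N`, as a discrete group. -/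
def PQuot {p : ℕ} {X : Type} (N : PIndex p X) : Type := FreeGroup X ⧸ N.1

instance {p : ℕ} {X : Type} (N : PIndex p X) : Group (PQuot N) :=
  inferInstanceAs (Group (FreeGroup X ⧸ N.1))

instance {p : ℕ} {X : Type} (N : PIndex p X) : TopologicalSpace (PQuot N) := ⊥

instance {p : ℕ} {X : Type} (N : PIndex p X) : DiscreteTopology (PQuot N) := ⟨rfl⟩

/-- The canonical map from the free group to the product of its finite `p`-group quotients. -/
def toPQuots (p : ℕ) (X : Type) : FreeGroup X →* ∀ N : PIndex p X, PQuot N :=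
  MonoidHom.pi fun N => QuotientGroup.mk' N.1

/-- The free pro-`p` group on `X`, for `X` finite: the pro-`p` completion of the free group on `X`,
that is, the closure of its image in the product of its finite `p`-group quotients. -/
def FreeProP (p : ℕ) (X : Type) : Type := (toPQuots p X).range.topologicalClosure

instance (p : ℕ) (X : Type) : Group (FreeProP p X) :=
  inferInstanceAs (Group (toPQuots p X).range.topologicalClosure)

instance (p : ℕ) (X : Type) : TopologicalSpace (FreeProP p X) :=
  inferInstanceAs (TopologicalSpace (toPQuots p X).range.topologicalClosure)

instance (p : ℕ) (X : Type) : IsTopologicalGroup (FreeProP p X) :=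
  inferInstanceAs (IsTopologicalGroup (toPQuots p X).range.topologicalClosure)

/-- The canonical map from the free group to the free pro-`p` group. -/
def FreeProP.ofFree (p : ℕ) (X : Type) : FreeGroup X →* FreeProP p X :=
  (toPQuots p X).codRestrict _ fun w => subset_closure ⟨w, rfl⟩

/-- The free generators of the free pro-`p` group. -/
def FreeProP.gen (p : ℕ) {X : Type} (x : X) : FreeProP p X := FreeProP.ofFree p X (FreeGroup.of x)

lemma FreeProP.denseRange_ofFree (p : ℕ) (X : Type) : DenseRange (FreeProP.ofFree p X) := by
  intro x
  refine closure_subtype.mpr (closure_mono ?_ x.2)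
  rintro _ ⟨w, rfl⟩
  exact ⟨FreeProP.ofFree p X w, ⟨w, rfl⟩, rfl⟩

/-- `G` is a finitely presented pro-`p` group: a pro-`p` group which is the quotient of a free
pro-`p` group of finite rank by the closed normal subgroup generated by finitely many elements. -/
def IsFinPres (p : ℕ) (G : Type) [Group G] [TopologicalSpace G] : Prop :=
  IsProP p G ∧ ∃ (n : ℕ) (π : FreeProP p (Fin n) →ₜ* G) (R : Finset (FreeProP p (Fin n))),
    Function.Surjective π ∧
      π.toMonoidHom.ker = (Subgroup.normalClosure (R : Set (FreeProP p (Fin n)))).topologicalClosure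

lemma IsProP.congr {p : ℕ} {G H : Type} [Group G] [TopologicalSpace G] [Group H]
    [TopologicalSpace H] (hG : IsProP p G) (e : G ≃ₜ* H) : IsProP p H := by
  have := hG.isTopologicalGroup
  have := hG.compactSpace
  have := hG.t2Space
  have := hG.totallyDisconnectedSpace
  have hinv : Continuous (fun x : H => x⁻¹) := by
    have : (fun x : H => x⁻¹) = fun x => e ((e.symm x)⁻¹) := by ext x; simp
    rw [this]
    exact e.continuous.comp (continuous_inv.comp e.symm.continuous)
  have hmul : Continuous (fun x : H × H => x.1 * x.2) := by
    have : (fun x : H × H => x.1 * x.2) = fun x => e (e.symm x.1 * e.symm x.2) := by ext x; simp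
    rw [this]
    exact e.continuous.comp ((e.symm.continuous.comp continuous_fst).mul
      (e.symm.continuous.comp continuous_snd))
  refine ⟨{ continuous_mul := hmul, continuous_inv := hinv }, e.toHomeomorph.compactSpace,
    e.toHomeomorph.t2Space, e.toHomeomorph.totallyDisconnectedSpace, ?_⟩
  intro U hU hUo
  have hV := hG.isPGroup_quotient (U.comap e.toMulEquiv.toMonoidHom) (hUo.preimage e.continuous)
  intro x
  obtain ⟨y, rfl⟩ := QuotientGroup.mk_surjective x
  obtain ⟨k, hk⟩ := hV (QuotientGroup.mk (e.symm y))
  refine ⟨k, ?_⟩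
  rw [← QuotientGroup.mk_pow, QuotientGroup.eq_one_iff] at hk ⊢
  have h : e (e.symm y ^ p ^ k) ∈ U := hk
  rwa [map_pow, ContinuousMulEquiv.apply_symm_apply] at h

lemma IsFinPres.congr {p : ℕ} {G H : Type} [Group G] [TopologicalSpace G] [Group H]
    [TopologicalSpace H] (hG : IsFinPres p G) (e : G ≃ₜ* H) : IsFinPres p H := by
  obtain ⟨h1, n, π, R, hs, hk⟩ := hG
  refine ⟨h1.congr e, n, (ContinuousMonoidHom.mk e.toMulEquiv.toMonoidHom e.continuous).comp π, R,
    e.surjective.comp hs, ?_⟩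
  rw [← hk]
  ext x
  change e (π x) = 1 ↔ π x = 1
  simp

lemma PIndex.pow_mem {p : ℕ} {X : Type} (N : PIndex p X) :
    ∃ k : ℕ, ∀ g : PQuot N, g ^ p ^ k = 1 := by
  obtain ⟨k, hk⟩ := N.2.2
  refine ⟨k, fun g => ?_⟩
  rw [← hk]
  exact pow_card_eq_one' (G := FreeGroup X ⧸ N.1) (x := g)

lemma FreeProP.isProP (p : ℕ) [Fact p.Prime] (X : Type) : IsProP p (FreeProP p X) := by
  have hfin : ∀ N : PIndex p X, Finite (PQuot N) := fun N => by
    obtain ⟨k, hk⟩ := N.2.2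
    have : N.1.index ≠ 0 := by rw [hk]; exact pow_ne_zero _ (Fact.out : p.Prime).ne_zero
    have : N.1.FiniteIndex := ⟨this⟩
    exact Subgroup.finite_quotient_of_finiteIndex (H := N.1)
  have hcl : IsClosed ((toPQuots p X).range.topologicalClosure : Set (∀ N : PIndex p X, PQuot N)) :=
    Subgroup.isClosed_topologicalClosure _
  refine ⟨inferInstance, isCompact_iff_compactSpace.mp hcl.isCompact,
    inferInstanceAs (T2Space (toPQuots p X).range.topologicalClosure),
    inferInstanceAs (TotallyDisconnectedSpace (toPQuots p X).range.topologicalClosure), ?_⟩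
  intro U hU hUo x
  obtain ⟨y, rfl⟩ := QuotientGroup.mk_surjective x
  obtain ⟨V, hV, hVU⟩ := isOpen_induced_iff.mp hUo
  have h1 : (1 : ∀ N : PIndex p X, PQuot N) ∈ V := by
    have : (1 : FreeProP p X) ∈ (U : Set (FreeProP p X)) := U.one_mem
    rw [← hVU] at this
    exact this
  obtain ⟨I, u, hu, huV⟩ := isOpen_pi_iff.mp hV 1 h1
  choose k hk using fun N : PIndex p X => N.pow_mem
  refine ⟨∑ N ∈ I, k N, ?_⟩
  rw [← QuotientGroup.mk_pow, QuotientGroup.eq_one_iff]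
  change _ ∈ (U : Set (FreeProP p X))
  rw [← hVU]
  apply huV
  intro N hN
  have : (y ^ p ^ ∑ N ∈ I, k N).1 N = 1 := by
    change (y.1 N) ^ p ^ ∑ N ∈ I, k N = 1
    obtain ⟨m, hm⟩ := Nat.pow_dvd_pow p (Finset.single_le_sum (fun _ _ => Nat.zero_le _) hN :
      k N ≤ ∑ N ∈ I, k N)
    rw [hm, pow_mul, hk, one_pow]
  change (y ^ p ^ ∑ N ∈ I, k N).1 N ∈ u N
  rw [this]
  exact (hu N hN).2

lemma FreeProP.isFinPres (p : ℕ) [Fact p.Prime] (n : ℕ) : IsFinPres p (FreeProP p (Fin n)) := by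
  have := (FreeProP.isProP p (Fin n)).t2Space
  refine ⟨FreeProP.isProP p _, n, ContinuousMonoidHom.id _, ∅, Function.surjective_id, ?_⟩
  ext x
  have : ((⊥ : Subgroup (FreeProP p (Fin n))).topologicalClosure : Set (FreeProP p (Fin n)))
      = {1} := by
    rw [Subgroup.topologicalClosure_coe, Subgroup.coe_bot, closure_singleton]
  simp only [Finset.coe_empty, Subgroup.normalClosure_empty]
  rw [← SetLike.mem_coe, ← SetLike.mem_coe, this]
  rfl

/-- The trivial group is finitely presented. -/
lemma isFinPres_unit (p : ℕ) [Fact p.Prime] : IsFinPres p Unit := by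
  have hc := (FreeProP.isFinPres p 0)
  have hs : Subsingleton (FreeProP p (Fin 0)) := by
    have := (FreeProP.isProP p (Fin 0)).t2Space
    refine ⟨fun a b => ?_⟩
    have h : (fun x : FreeProP p (Fin 0) => x) = fun _ => 1 := by
      refine (FreeProP.denseRange_ofFree p (Fin 0)).equalizer continuous_id continuous_const ?_
      ext w
      have : w = 1 := Subsingleton.elim _ _
      simp [this]
    rw [show a = 1 from congrFun h a, show b = 1 from congrFun h b]
  exact hc.congr
    { toFun := fun _ => (), invFun := fun _ => 1, left_inv := fun _ => Subsingleton.elim _ _,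
      right_inv := fun _ => rfl, map_mul' := fun _ _ => rfl,
      continuous_toFun := continuous_const, continuous_invFun := continuous_const }

/-- The group `ℤ_p`, written multiplicatively. -/
abbrev Zp (p : ℕ) [Fact p.Prime] : Type := Multiplicative ℤ_[p]

/-- `x ^ l` for `l ∈ ℤ_p`: the limit of `x ^ n` as the integers `n` tend to `l`. -/
def padicPow {p : ℕ} [Fact p.Prime] {G : Type} [Group G] [TopologicalSpace G] (x : G)
    (l : ℤ_[p]) : G :=
  haveI : Nonempty G := ⟨1⟩
  Filter.limUnder Filter.atTop fun n : ℕ => x ^ l.appr n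

/-- The continuous homomorphism `l ↦ g ^ (l mod p ^ k)` to a group `A`, where `g ^ p ^ k = 1`. -/
def powHom {p : ℕ} [Fact p.Prime] {A : Type} [Group A] (k : ℕ) (g : A) (hg : g ^ p ^ k = 1) :
    Zp p →* A where
  toFun l := g ^ (PadicInt.toZModPow k l.toAdd).val
  map_one' := by
    change g ^ (PadicInt.toZModPow (p := p) k 0).val = 1
    simp
  map_mul' a b := by
    change g ^ (PadicInt.toZModPow k (a.toAdd + b.toAdd)).val = _
    rw [map_add, ZMod.val_add, ← pow_add]
    conv_rhs => rw [← Nat.mod_add_div ((PadicInt.toZModPow k a.toAdd).val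
      + (PadicInt.toZModPow k b.toAdd).val) (p ^ k), pow_add, pow_mul, hg, one_pow, mul_one]

lemma powHom_natCast {p : ℕ} [Fact p.Prime] {A : Type} [Group A] (k : ℕ) (g : A)
    (hg : g ^ p ^ k = 1) (n : ℕ) : powHom k g hg (Multiplicative.ofAdd (n : ℤ_[p])) = g ^ n := by
  change g ^ (PadicInt.toZModPow (p := p) k (n : ℤ_[p])).val = g ^ n
  rw [map_natCast, ZMod.val_natCast]
  conv_rhs => rw [← Nat.mod_add_div n (p ^ k), pow_add, pow_mul, hg, one_pow, mul_one]

lemma continuous_powHom {p : ℕ} [Fact p.Prime] {A : Type} [Group A] [TopologicalSpace A] (k : ℕ)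
    (g : A) (hg : g ^ p ^ k = 1) : Continuous (powHom k g hg) := by
  refine IsLocallyConstant.continuous ?_
  have h : IsLocallyConstant fun l : ℤ_[p] => PadicInt.toZModPow k l := by
    rw [IsLocallyConstant.iff_exists_open]
    intro x
    refine ⟨Metric.ball x ((p : ℝ) ^ (-(k : ℤ) + 1)), Metric.isOpen_ball,
      Metric.mem_ball_self (zpow_pos (by exact_mod_cast (Fact.out : p.Prime).pos) _), ?_⟩
    intro y hy
    rw [← sub_eq_zero, ← map_sub, ← RingHom.mem_ker, PadicInt.ker_toZModPow,
      ← PadicInt.norm_le_pow_iff_mem_span_pow, PadicInt.norm_le_pow_iff_norm_lt_pow_add_one]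
    rwa [Metric.mem_ball, dist_eq_norm] at hy
  exact h.comp fun z => g ^ z.val

/-- The coordinates of the homomorphism `ℤ_p → F`, `l ↦ g ^ l`. -/
def FreeProP.zpPi {p : ℕ} [Fact p.Prime] {X : Type} (g : FreeProP p X) :
    Zp p →* ∀ N : PIndex p X, PQuot N :=
  MonoidHom.pi fun N =>
    powHom (A := PQuot N) N.pow_mem.choose (g.1 N) (N.pow_mem.choose_spec (g.1 N))

lemma FreeProP.continuous_zpPi {p : ℕ} [Fact p.Prime] {X : Type} (g : FreeProP p X) :
    Continuous (FreeProP.zpPi g) :=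
  continuous_pi fun N => continuous_powHom (A := PQuot N) _ (g.1 N) (N.pow_mem.choose_spec (g.1 N))

lemma FreeProP.zpPi_natCast {p : ℕ} [Fact p.Prime] {X : Type} (g : FreeProP p X) (n : ℕ) :
    FreeProP.zpPi g (Multiplicative.ofAdd (n : ℤ_[p])) = (g ^ n).1 := by
  funext N
  exact powHom_natCast (A := PQuot N) _ (g.1 N) (N.pow_mem.choose_spec (g.1 N)) n

/-- The continuous homomorphism `ℤ_p → F` to a free pro-`p` group which sends `1` to `g`. -/
def FreeProP.zpHom {p : ℕ} [Fact p.Prime] {X : Type} (g : FreeProP p X) :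
    Zp p →ₜ* FreeProP p X where
  toMonoidHom := (FreeProP.zpPi g).codRestrict (toPQuots p X).range.topologicalClosure (by
    intro l
    have hcl := (Subgroup.isClosed_topologicalClosure (toPQuots p X).range).preimage
      (FreeProP.continuous_zpPi g)
    refine (PadicInt.denseRange_natCast (p := p)).induction_on
      (p := fun l : ℤ_[p] => FreeProP.zpPi g (Multiplicative.ofAdd l) ∈
        (toPQuots p X).range.topologicalClosure) l.toAdd hcl ?_
    intro n
    rw [FreeProP.zpPi_natCast]
    exact (g ^ n).2)
  continuous_toFun := Continuous.subtype_mk (FreeProP.continuous_zpPi g) _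

lemma FreeProP.zpHom_natCast {p : ℕ} [Fact p.Prime] {X : Type} (g : FreeProP p X) (n : ℕ) :
    FreeProP.zpHom g (Multiplicative.ofAdd (n : ℤ_[p])) = g ^ n :=
  Subtype.ext (FreeProP.zpPi_natCast g n)

lemma isFinPres_zp (p : ℕ) [Fact p.Prime] : IsFinPres p (Zp p) := by
  have hT2 := (FreeProP.isProP p (Fin 1)).t2Space
  let f := FreeProP.zpHom (FreeProP.gen p (0 : Fin 1))
  have hgen : ∀ n : ℕ, f (Multiplicative.ofAdd (n : ℤ_[p])) = FreeProP.gen p (0 : Fin 1) ^ n :=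
    FreeProP.zpHom_natCast _
  have hgenz : ∀ n : ℤ, f (Multiplicative.ofAdd (n : ℤ_[p])) = FreeProP.gen p (0 : Fin 1) ^ n := by
    intro n
    have h1 : f (Multiplicative.ofAdd (1 : ℤ_[p])) = FreeProP.gen p (0 : Fin 1) := by
      have := hgen 1
      simpa using this
    rw [← h1, ← map_zpow]
    congr 1
    rw [← ofAdd_zsmul, zsmul_eq_mul, mul_one]
  have hsurj : Function.Surjective f := by
    have hcl : IsClosed (Set.range f) := (isCompact_range f.continuous_toFun).isClosed
    have : DenseRange f := by
      refine (FreeProP.denseRange_ofFree p (Fin 1)).mono ?_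
      rintro _ ⟨w, rfl⟩
      induction w using FreeGroup.induction_on with
      | C1 => exact ⟨1, by rw [map_one, map_one]⟩
      | of i =>
        refine ⟨Multiplicative.ofAdd ((1 : ℕ) : ℤ_[p]), ?_⟩
        rw [hgen, pow_one, Subsingleton.elim i 0]
        rfl
      | inv_of i h =>
        obtain ⟨a, ha⟩ := h
        exact ⟨a⁻¹, by rw [map_inv, ha, map_inv]⟩
      | mul a b ha hb =>
        obtain ⟨x, hx⟩ := ha
        obtain ⟨y, hy⟩ := hb
        exact ⟨x * y, by rw [map_mul, hx, hy, map_mul]⟩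
    exact Set.range_eq_univ.mp (by rw [← hcl.closure_eq]; exact this.closure_eq)
  have hinj : Function.Injective f := by
    refine (injective_iff_map_eq_one f).mpr fun l hl => ?_
    change l.toAdd = 0
    refine PadicInt.ext_of_toZModPow.mp fun k => ?_
    rw [map_zero]
    let q : FreeGroup (Fin 1) →* Multiplicative (ZMod (p ^ k)) :=
      FreeGroup.lift fun _ => Multiplicative.ofAdd 1
    have hq : Function.Surjective q := by
      intro z
      refine ⟨FreeGroup.of 0 ^ (z.toAdd).val, ?_⟩
      rw [map_pow]
      simp only [q, FreeGroup.lift_apply_of]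
      rw [← ofAdd_nsmul, nsmul_eq_mul, mul_one, ZMod.natCast_zmod_val]
      rfl
    let N : PIndex p (Fin 1) := ⟨q.ker, inferInstance, k, by
      rw [Subgroup.index_ker, MonoidHom.range_eq_top.mpr hq]
      simp⟩
    let qN : PQuot N →* Multiplicative (ZMod (p ^ k)) := QuotientGroup.kerLift q
    have h2 : (fun l : ℤ_[p] => qN ((f (Multiplicative.ofAdd l)).1 N)) =
        fun l : ℤ_[p] => powHom (p := p) k (Multiplicative.ofAdd (1 : ZMod (p ^ k)))
          (by rw [← ofAdd_nsmul]; simp) (Multiplicative.ofAdd l) := by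
      let _ : TopologicalSpace (Multiplicative (ZMod (p ^ k))) := ⊥
      have : DiscreteTopology (Multiplicative (ZMod (p ^ k))) := ⟨rfl⟩
      refine (PadicInt.denseRange_natCast (p := p)).equalizer ?_ ?_ ?_
      · exact continuous_of_discreteTopology.comp ((continuous_apply N).comp
          (continuous_subtype_val.comp (f.continuous_toFun)))
      · exact continuous_powHom _ _ _
      · ext n
        simp only [Function.comp]
        rw [powHom_natCast, hgen]
        change qN ((FreeProP.gen p (0 : Fin 1)).1 N ^ n) = _
        rw [map_pow]
        congr 1
        change QuotientGroup.kerLift q (QuotientGroup.mk (FreeGroup.of 0)) = _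
        rw [QuotientGroup.kerLift_mk]
        simp [q]
    have h3 := congrFun h2 l.toAdd
    have h4 : (f (Multiplicative.ofAdd l.toAdd)).1 N = 1 := by
      change (f l).1 N = 1
      rw [hl]
      rfl
    simp only [h4, map_one] at h3
    have h5 := congrArg Multiplicative.toAdd h3
    change (0 : ZMod (p ^ k)) = Multiplicative.toAdd
      ((Multiplicative.ofAdd (1 : ZMod (p ^ k))) ^ (PadicInt.toZModPow k l.toAdd).val) at h5
    rw [← ofAdd_nsmul, nsmul_eq_mul, mul_one, ZMod.natCast_zmod_val] at h5
    exact h5.symm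
  let e : Zp p ≃ FreeProP p (Fin 1) := Equiv.ofBijective f ⟨hinj, hsurj⟩
  let e' : Zp p ≃ₜ FreeProP p (Fin 1) :=
    Continuous.homeoOfEquivCompactToT2 (f := e) f.continuous_toFun
  exact (FreeProP.isFinPres p 1).congr
    (ContinuousMulEquiv.symm
      { e' with map_mul' := fun a b => map_mul f a b })

end ProPDW
end
open CategoryTheory MonoidalCategory

noncomputable section

namespace ProPDW

/-! ### Topological groupoids and pro-`p` groupoids -/

/-- A small groupoid whose morphism sets carry topologies for which composition and inversion are
continuous. -/
structure TopGrpd where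
  Obj : Type
  [grpd : Groupoid.{0} Obj]
  [top : ∀ x y : Obj, TopologicalSpace (x ⟶ y)]
  continuous_comp : ∀ x y z : Obj, Continuous fun q : (x ⟶ y) × (y ⟶ z) => q.1 ≫ q.2
  continuous_inv : ∀ x y : Obj, Continuous fun f : x ⟶ y => Groupoid.inv f

attribute [instance] TopGrpd.grpd TopGrpd.top

instance (𝔊 : TopGrpd) (x : 𝔊.Obj) : TopologicalSpace (End x) := 𝔊.top x x

lemma continuous_of_false {A C : Type} (tA : TopologicalSpace A) (tC : TopologicalSpace C)
    (h : A → False) (f : A → C) : Continuous f :=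
  continuous_iff_continuousAt.mpr fun q => (h q).elim

lemma isFinPres_end_congr {p : ℕ} {𝔊 ℌ : TopGrpd} {x : 𝔊.Obj} {y : ℌ.Obj}
    (e : (x ⟶ x) ≃ₜ (y ⟶ y)) (he : ∀ a b, e (a ≫ b) = e a ≫ e b) (h : IsFinPres p (End x)) :
    IsFinPres p (End y) :=
  h.congr { e with map_mul' := fun a b => he b a }

/-- The set of isomorphism classes of objects of a category. -/
abbrev Pi0 (C : Type) [Category.{0} C] : Type := Quotient (isIsomorphicSetoid C)

/-- A pro-`p` groupoid with finitely many isomorphism classes of objects and with finitely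
presented pro-`p` automorphism groups. -/
structure PGrpd (p : ℕ) extends TopGrpd where
  finite_pi0 : Finite (Pi0 Obj)
  isFinPres_end : ∀ x : Obj, @IsFinPres p (End x) _ (top x x)

/-- A continuous functor between topological groupoids. -/
structure ContFunctor (𝔊 ℌ : TopGrpd) where
  toFunctor : 𝔊.Obj ⥤ ℌ.Obj
  continuous_map : ∀ x y : 𝔊.Obj, Continuous fun f : x ⟶ y => toFunctor.map f

namespace ContFunctor

variable {𝔊 ℌ 𝔎 𝔏 : TopGrpd}

/-- `Fun(𝔊, ℌ)`: continuous functors and natural transformations (which are all invertible). -/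
instance : Category.{0} (ContFunctor 𝔊 ℌ) where
  Hom F G := F.toFunctor ⟶ G.toFunctor
  id F := 𝟙 F.toFunctor
  comp a b := NatTrans.vcomp a b

/-- A natural isomorphism, as an isomorphism in `Fun(𝔊, ℌ)`. -/
def mkIso {F G : ContFunctor 𝔊 ℌ} (e : F.toFunctor ≅ G.toFunctor) : F ≅ G :=
  ⟨e.hom, e.inv, e.hom_inv_id, e.inv_hom_id⟩

/-- An isomorphism in `Fun(𝔊, ℌ)`, as a natural isomorphism. -/
def toNatIso {F G : ContFunctor 𝔊 ℌ} (e : F ≅ G) : F.toFunctor ≅ G.toFunctor :=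
  ⟨e.hom, e.inv, e.hom_inv_id, e.inv_hom_id⟩

/-- The identity functor. -/
def id (𝔊 : TopGrpd) : ContFunctor 𝔊 𝔊 := ⟨𝟭 _, fun _ _ => continuous_id⟩

/-- Composition of continuous functors, in diagrammatic order. -/
def comp (F : ContFunctor 𝔊 ℌ) (G : ContFunctor ℌ 𝔎) : ContFunctor 𝔊 𝔎 :=
  ⟨F.toFunctor ⋙ G.toFunctor, fun _ _ => (G.continuous_map _ _).comp (F.continuous_map _ _)⟩

/-- Precomposition of an isomorphism of functors with a functor. -/
def isoWhiskerLeft (F : ContFunctor 𝔊 ℌ) {G G' : ContFunctor ℌ 𝔎} (e : G ≅ G') :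
    F.comp G ≅ F.comp G' :=
  mkIso (Functor.isoWhiskerLeft F.toFunctor (toNatIso e))

/-- Postcomposition of an isomorphism of functors with a functor. -/
def isoWhiskerRight {F F' : ContFunctor 𝔊 ℌ} (e : F ≅ F') (G : ContFunctor ℌ 𝔎) :
    F.comp G ≅ F'.comp G :=
  mkIso (Functor.isoWhiskerRight (toNatIso e) G.toFunctor)

/-- `F` is an equivalence of topological groupoids: it has a continuous inverse up to natural
isomorphism. -/
def IsEquiv (F : ContFunctor 𝔊 ℌ) : Prop :=
  ∃ G : ContFunctor ℌ 𝔊, Nonempty (F.comp G ≅ id 𝔊) ∧ Nonempty (G.comp F ≅ id ℌ)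

lemma isEquiv_id (𝔊 : TopGrpd) : (id 𝔊).IsEquiv := ⟨id 𝔊, ⟨Iso.refl _⟩, ⟨Iso.refl _⟩⟩

lemma IsEquiv.comp {F : ContFunctor 𝔊 ℌ} {G : ContFunctor ℌ 𝔎} (hF : F.IsEquiv) (hG : G.IsEquiv) :
    (F.comp G).IsEquiv := by
  obtain ⟨F', ⟨a⟩, ⟨b⟩⟩ := hF
  obtain ⟨G', ⟨c⟩, ⟨d⟩⟩ := hG
  exact ⟨G'.comp F', ⟨isoWhiskerLeft F (isoWhiskerRight c F') ≪≫ a⟩,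
    ⟨isoWhiskerLeft G' (isoWhiskerRight b G) ≪≫ d⟩⟩

end ContFunctor

/-! ### Classifying groupoids, coproducts -/

/-- The groupoid `BG` with one object and with the topological group `G` as automorphisms. -/
def TopGrpd.B (G : Type) [Group G] [TopologicalSpace G] [IsTopologicalGroup G] : TopGrpd where
  Obj := SingleObj G
  top _ _ := inferInstanceAs (TopologicalSpace G)
  continuous_comp _ _ _ := (continuous_snd.mul continuous_fst : Continuous fun q : G × G => q.2 * q.1)
  continuous_inv _ _ := (ContinuousInv.continuous_inv : Continuous fun g : G => g⁻¹)

/-- The functor `BG ⥤ BH` induced by a continuous homomorphism. -/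
def bMap {G H : Type} [Group G] [TopologicalSpace G] [IsTopologicalGroup G] [Group H]
    [TopologicalSpace H] [IsTopologicalGroup H] (f : G →ₜ* H) :
    ContFunctor (TopGrpd.B G) (TopGrpd.B H) where
  toFunctor := f.toMonoidHom.toFunctor
  continuous_map _ _ := f.continuous_toFun

/-- `BG` as a pro-`p` groupoid, for a finitely presented pro-`p` group `G`. -/
def PGrpd.B {p : ℕ} (G : Type) [Group G] [TopologicalSpace G] [IsTopologicalGroup G]
    (hG : IsFinPres p G) : PGrpd p where
  toTopGrpd := TopGrpd.B G
  finite_pi0 := by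
    have : Finite (TopGrpd.B G).Obj := inferInstanceAs (Finite (SingleObj G))
    infer_instance
  isFinPres_end x := IsFinPres.congr (H := @End (TopGrpd.B G).Obj _ x) hG
    { toFun := fun g => g, invFun := fun g => g, left_inv := fun _ => rfl,
      right_inv := fun _ => rfl, map_mul' := fun _ _ => rfl,
      continuous_toFun := continuous_id, continuous_invFun := continuous_id }

instance sumGroupoid (C D : Type) [Groupoid.{0} C] [Groupoid.{0} D] : Groupoid.{0} (C ⊕ D) where
  inv {x y} f := match x, y, f with
    | .inl _, .inl _, f => ⟨Groupoid.inv f.down⟩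
    | .inr _, .inr _, f => ⟨Groupoid.inv f.down⟩
  inv_comp {x y} f := match x, y, f with
    | .inl _, .inl _, f => congrArg ULift.up (Groupoid.inv_comp f.down)
    | .inr _, .inr _, f => congrArg ULift.up (Groupoid.inv_comp f.down)
  comp_inv {x y} f := match x, y, f with
    | .inl _, .inl _, f => congrArg ULift.up (Groupoid.comp_inv f.down)
    | .inr _, .inr _, f => congrArg ULift.up (Groupoid.comp_inv f.down)

/-- The topologies on the morphism sets of a disjoint union. -/
instance sumTop (𝔊 ℌ : TopGrpd) (x y : 𝔊.Obj ⊕ ℌ.Obj) : TopologicalSpace (x ⟶ y) :=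
  match x, y with
  | .inl x, .inl y => inferInstanceAs (TopologicalSpace (ULift (x ⟶ y)))
  | .inr x, .inr y => inferInstanceAs (TopologicalSpace (ULift (x ⟶ y)))
  | .inl _, .inr _ => ⊥
  | .inr _, .inl _ => ⊥

/-- The coproduct (disjoint union) of two topological groupoids. -/
def TopGrpd.coprod (𝔊 ℌ : TopGrpd) : TopGrpd where
  Obj := 𝔊.Obj ⊕ ℌ.Obj
  continuous_comp x y z := match x, y, z with
    | .inl x, .inl y, .inl z => continuous_uliftUp.comp ((𝔊.continuous_comp x y z).comp
        (Continuous.prodMap continuous_uliftDown continuous_uliftDown))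
    | .inr x, .inr y, .inr z => continuous_uliftUp.comp ((ℌ.continuous_comp x y z).comp
        (Continuous.prodMap continuous_uliftDown continuous_uliftDown))
    | .inl _, .inr _, _ => by
        refine continuous_iff_continuousAt.mpr fun q => (q.1 : PEmpty).elim
    | .inr _, .inl _, _ => by
        refine continuous_iff_continuousAt.mpr fun q => (q.1 : PEmpty).elim
    | .inl _, .inl _, .inr _ => by
        refine continuous_iff_continuousAt.mpr fun q => (q.2 : PEmpty).elim
    | .inr _, .inr _, .inl _ => by
        refine continuous_iff_continuousAt.mpr fun q => (q.2 : PEmpty).elim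
  continuous_inv x y := match x, y with
    | .inl x, .inl y => continuous_uliftUp.comp ((𝔊.continuous_inv x y).comp continuous_uliftDown)
    | .inr x, .inr y => continuous_uliftUp.comp ((ℌ.continuous_inv x y).comp continuous_uliftDown)
    | .inl _, .inr _ => continuous_iff_continuousAt.mpr fun q => (q : PEmpty).elim
    | .inr _, .inl _ => continuous_iff_continuousAt.mpr fun q => (q : PEmpty).elim

/-- The first inclusion into a coproduct. -/
def inl (𝔊 ℌ : TopGrpd) : ContFunctor 𝔊 (𝔊.coprod ℌ) :=
  ⟨Sum.inl_ 𝔊.Obj ℌ.Obj, fun _ _ => continuous_uliftUp⟩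

/-- The second inclusion into a coproduct. -/
def inr (𝔊 ℌ : TopGrpd) : ContFunctor ℌ (𝔊.coprod ℌ) :=
  ⟨Sum.inr_ 𝔊.Obj ℌ.Obj, fun _ _ => continuous_uliftUp⟩

/-- The functor out of a coproduct defined by a pair of functors. -/
def copair {𝔊 ℌ 𝔎 : TopGrpd} (F : ContFunctor 𝔊 𝔎) (G : ContFunctor ℌ 𝔎) :
    ContFunctor (𝔊.coprod ℌ) 𝔎 where
  toFunctor := F.toFunctor.sum' G.toFunctor
  continuous_map x y := match x, y with
    | .inl x, .inl y => ((F.continuous_map x y).comp continuous_uliftDown :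
        Continuous fun f : ULift (x ⟶ y) => F.toFunctor.map f.down)
    | .inr x, .inr y => ((G.continuous_map x y).comp continuous_uliftDown :
        Continuous fun f : ULift (x ⟶ y) => G.toFunctor.map f.down)
    | .inl _, .inr _ => continuous_of_false _ _ (fun q => (q : PEmpty).elim) _
    | .inr _, .inl _ => continuous_of_false _ _ (fun q => (q : PEmpty).elim) _

/-- The coproduct of two functors. -/
def coprodMap {𝔊 ℌ 𝔎 𝔏 : TopGrpd} (F : ContFunctor 𝔊 𝔎) (G : ContFunctor ℌ 𝔏) :
    ContFunctor (𝔊.coprod ℌ) (𝔎.coprod 𝔏) :=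
  copair (F.comp (inl 𝔎 𝔏)) (G.comp (inr 𝔎 𝔏))

/-- Functors out of a coproduct are isomorphic if their restrictions are. -/
def coprodIsoExt {𝔊 ℌ 𝔎 : TopGrpd} {F G : ContFunctor (𝔊.coprod ℌ) 𝔎}
    (a : (inl 𝔊 ℌ).comp F ≅ (inl 𝔊 ℌ).comp G) (b : (inr 𝔊 ℌ).comp F ≅ (inr 𝔊 ℌ).comp G) : F ≅ G :=
  ContFunctor.mkIso
    (Functor.sumIsoExt (F := F.toFunctor) (G := G.toFunctor) (ContFunctor.toNatIso a)
      (ContFunctor.toNatIso b))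

/-- The coproduct of two pro-`p` groupoids. -/
def PGrpd.coprod {p : ℕ} (𝔊 ℌ : PGrpd p) : PGrpd p where
  toTopGrpd := 𝔊.toTopGrpd.coprod ℌ.toTopGrpd
  finite_pi0 := by
    have := 𝔊.finite_pi0
    have := ℌ.finite_pi0
    let f : Pi0 𝔊.Obj ⊕ Pi0 ℌ.Obj → Pi0 (𝔊.toTopGrpd.coprod ℌ.toTopGrpd).Obj :=
      Sum.elim
        (Quotient.map (inl 𝔊.toTopGrpd ℌ.toTopGrpd).toFunctor.obj
          fun _ _ ⟨e⟩ => ⟨(inl 𝔊.toTopGrpd ℌ.toTopGrpd).toFunctor.mapIso e⟩)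
        (Quotient.map (inr 𝔊.toTopGrpd ℌ.toTopGrpd).toFunctor.obj
          fun _ _ ⟨e⟩ => ⟨(inr 𝔊.toTopGrpd ℌ.toTopGrpd).toFunctor.mapIso e⟩)
    refine Finite.of_surjective f ?_
    rintro ⟨x | x⟩
    · exact ⟨Sum.inl (Quotient.mk _ x), rfl⟩
    · exact ⟨Sum.inr (Quotient.mk _ x), rfl⟩
  isFinPres_end x := match x with
    | .inl x => isFinPres_end_congr (𝔊 := 𝔊.toTopGrpd) (ℌ := 𝔊.toTopGrpd.coprod ℌ.toTopGrpd)
        (x := x) (y := Sum.inl x) Homeomorph.ulift.symm (fun _ _ => rfl) (𝔊.isFinPres_end x)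
    | .inr x => isFinPres_end_congr (𝔊 := ℌ.toTopGrpd) (ℌ := 𝔊.toTopGrpd.coprod ℌ.toTopGrpd)
        (x := x) (y := Sum.inr x) Homeomorph.ulift.symm (fun _ _ => rfl) (ℌ.isFinPres_end x)

instance emptyGroupoid : Groupoid.{0} PEmpty.{1} where
  Hom x _ := x.elim
  id x := x.elim
  comp {x} _ _ := x.elim
  inv {x} _ := x.elim
  id_comp {x} _ := x.elim
  comp_id {x} _ := x.elim
  assoc {x} _ _ _ _ _ := x.elim
  inv_comp {x} _ := x.elim
  comp_inv {x} _ := x.elim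

/-- The empty groupoid. -/
def PGrpd.empty (p : ℕ) : PGrpd p where
  Obj := PEmpty
  grpd := emptyGroupoid
  top x _ := x.elim
  continuous_comp x := x.elim
  continuous_inv x := x.elim
  finite_pi0 := Quotient.finite _
  isFinPres_end x := x.elim

/-- The functor out of the empty groupoid. -/
def fromEmpty (p : ℕ) (𝔊 : TopGrpd) : ContFunctor (PGrpd.empty p).toTopGrpd 𝔊 where
  toFunctor := { obj := fun x => (x : PEmpty).elim, map := fun {x} _ => (x : PEmpty).elim,
                 map_id := fun x => (x : PEmpty).elim, map_comp := fun {x} _ _ _ _ => (x : PEmpty).elim }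
  continuous_map x := (x : PEmpty).elim

/-- The objects of the groupoid `∐ BNᵢ`. -/
structure FamObj {I : Type} (N : I → Type) : Type where
  idx : I

instance famGroupoid {I : Type} (N : I → Type) [∀ i, Group (N i)] : Groupoid.{0} (FamObj N) where
  Hom i j := {_g : N i.idx // i = j}
  id i := ⟨1, rfl⟩
  comp {i j k} f g := ⟨(f.2.symm ▸ g.1 : N i.idx) * f.1, f.2.trans g.2⟩
  inv {i j} f := ⟨(f.2 ▸ f.1⁻¹ : N j.idx), f.2.symm⟩
  id_comp {i j} f := by
    obtain ⟨f, h⟩ := f; cases h; exact Subtype.ext (mul_one f)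
  comp_id {i j} f := by
    obtain ⟨f, h⟩ := f; cases h; exact Subtype.ext (one_mul f)
  assoc {i j k l} f g e := by
    obtain ⟨f, h⟩ := f; cases h
    obtain ⟨g, h⟩ := g; cases h
    obtain ⟨e, h⟩ := e; cases h
    exact Subtype.ext (mul_assoc e g f).symm
  inv_comp {i j} f := by
    obtain ⟨f, h⟩ := f; cases h; exact Subtype.ext (mul_inv_cancel f)
  comp_inv {i j} f := by
    obtain ⟨f, h⟩ := f; cases h; exact Subtype.ext (inv_mul_cancel f)

/-- The groupoid `∐ BNᵢ` attached to a family of topological groups. -/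
def TopGrpd.fam {I : Type} (N : I → Type) [∀ i, Group (N i)] [∀ i, TopologicalSpace (N i)]
    [∀ i, IsTopologicalGroup (N i)] : TopGrpd where
  Obj := FamObj N
  top i j := inferInstanceAs (TopologicalSpace {_g : N i.idx // i = j})
  continuous_comp i j k := by
    by_cases h : i = j
    · cases h
      exact Continuous.subtype_mk ((continuous_subtype_val.comp continuous_snd).mul
        (continuous_subtype_val.comp continuous_fst)) _
    · exact continuous_of_false _ _ (fun q => h q.1.2) _
  continuous_inv i j := by
    by_cases h : i = j
    · cases h
      exact Continuous.subtype_mk continuous_subtype_val.inv _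
    · exact continuous_of_false _ _ (fun q => h q.2) _

/-- The pro-`p` groupoid `∐ BNᵢ` attached to a finite family of finitely presented pro-`p`
groups. -/
def PGrpd.fam {p : ℕ} {I : Type} [Finite I] (N : I → Type) [∀ i, Group (N i)]
    [∀ i, TopologicalSpace (N i)] [∀ i, IsTopologicalGroup (N i)] (hN : ∀ i, IsFinPres p (N i)) :
    PGrpd p where
  toTopGrpd := TopGrpd.fam N
  finite_pi0 := by
    have : Finite (TopGrpd.fam N).Obj := Finite.of_surjective FamObj.mk fun i => ⟨i.idx, rfl⟩
    infer_instance
  isFinPres_end i := (hN i.idx).congr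
    { toFun := fun g => ⟨g, rfl⟩, invFun := fun g => g.1, left_inv := fun _ => rfl,
      right_inv := fun _ => rfl, map_mul' := fun _ _ => rfl,
      continuous_toFun := Continuous.subtype_mk continuous_id _,
      continuous_invFun := continuous_subtype_val }

/-- The functor `∐ BNᵢ ⥤ BG` given by a family of continuous homomorphisms `Nᵢ → G`. -/
def famMap {I : Type} {N : I → Type} [∀ i, Group (N i)] [∀ i, TopologicalSpace (N i)]
    [∀ i, IsTopologicalGroup (N i)] {G : Type} [Group G] [TopologicalSpace G]
    [IsTopologicalGroup G] (φ : ∀ i, N i →ₜ* G) : ContFunctor (TopGrpd.fam N) (TopGrpd.B G) where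
  toFunctor :=
    { obj := fun _ => SingleObj.star G
      map := fun {i j} f => (φ i.idx f.1 : G)
      map_id := fun i => map_one (φ i.idx)
      map_comp := fun {i j k} f g => by
        obtain ⟨f, h⟩ := f; cases h
        exact map_mul (φ i.idx) g.1 f }
  continuous_map i j := (φ i.idx).continuous_toFun.comp continuous_subtype_val

end ProPDW
end
open CategoryTheory MonoidalCategory

noncomputable section

namespace ProPDW

/-! ### Cospans of pro-`p` groupoids -/

section Cospans

variable {p : ℕ}

/-- Continuous functors between pro-`p` groupoids. -/
abbrev PGrpd.Fun (𝔊 ℌ : PGrpd p) : Type := ContFunctor 𝔊.toTopGrpd ℌ.toTopGrpd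

/-- A cospan `𝔊 → 𝔎 ← ℌ` of pro-`p` groupoids. -/
structure Cospan (𝔊 ℌ : PGrpd p) where
  apex : PGrpd p
  left : 𝔊.Fun apex
  right : ℌ.Fun apex

/-- Two cospans are equivalent if there is an equivalence between their apices which is compatible
with the legs up to natural isomorphism. -/
def Cospan.Rel {𝔊 ℌ : PGrpd p} (C D : Cospan 𝔊 ℌ) : Prop :=
  ∃ e : C.apex.Fun D.apex, e.IsEquiv ∧
    Nonempty (C.left.comp e ≅ D.left) ∧ Nonempty (C.right.comp e ≅ D.right)

instance cospanSetoid (𝔊 ℌ : PGrpd p) : Setoid (Cospan 𝔊 ℌ) where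
  r := Cospan.Rel
  iseqv := by
    refine ⟨fun C => ⟨ContFunctor.id _, ContFunctor.isEquiv_id _, ⟨Iso.refl _⟩, ⟨Iso.refl _⟩⟩, ?_, ?_⟩
    · rintro C D ⟨e, ⟨e', ⟨a⟩, ⟨b⟩⟩, ⟨l⟩, ⟨r⟩⟩
      exact ⟨e', ⟨e, ⟨b⟩, ⟨a⟩⟩,
        ⟨ContFunctor.isoWhiskerRight l.symm e' ≪≫ ContFunctor.isoWhiskerLeft C.left a⟩,
        ⟨ContFunctor.isoWhiskerRight r.symm e' ≪≫ ContFunctor.isoWhiskerLeft C.right a⟩⟩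
    · rintro C D E ⟨e, he, ⟨l⟩, ⟨r⟩⟩ ⟨f, hf, ⟨l'⟩, ⟨r'⟩⟩
      exact ⟨e.comp f, he.comp hf, ⟨ContFunctor.isoWhiskerRight l f ≪≫ l'⟩,
        ⟨ContFunctor.isoWhiskerRight r f ≪≫ r'⟩⟩

/-- The square with sides `f, g, i, j` and filling `θ : i ∘ f ≅ j ∘ g` is a homotopy pushout of
pro-`p` groupoids: for every pro-`p` groupoid `𝔗`, restriction is an equivalence from `Fun(𝔓, 𝔗)`
to the groupoid of triples `(u, v, η)` with `u : 𝔎 ⥤ 𝔗`, `v : 𝔏 ⥤ 𝔗` and `η : u ∘ f ≅ v ∘ g`. -/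
structure IsHPushout {𝔖 𝔎 𝔏 𝔓 : PGrpd p} (f : 𝔖.Fun 𝔎) (g : 𝔖.Fun 𝔏) (i : 𝔎.Fun 𝔓) (j : 𝔏.Fun 𝔓)
    (θ : f.comp i ≅ g.comp j) : Prop where
  exists_desc : ∀ (𝔗 : PGrpd p) (u : 𝔎.Fun 𝔗) (v : 𝔏.Fun 𝔗) (η : f.comp u ≅ g.comp v),
    ∃ (w : 𝔓.Fun 𝔗) (a : i.comp w ≅ u) (b : j.comp w ≅ v), ∀ x : 𝔖.Obj,
      w.toFunctor.map (NatTrans.app θ.hom x) ≫ NatTrans.app b.hom (g.toFunctor.obj x) =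
        NatTrans.app a.hom (f.toFunctor.obj x) ≫ NatTrans.app η.hom x
  existsUnique_hom : ∀ (𝔗 : PGrpd p) (w w' : 𝔓.Fun 𝔗) (a : i.comp w ⟶ i.comp w')
    (b : j.comp w ⟶ j.comp w'),
    (∀ x : 𝔖.Obj,
      w.toFunctor.map (NatTrans.app θ.hom x) ≫ NatTrans.app b (g.toFunctor.obj x) =
        NatTrans.app a (f.toFunctor.obj x) ≫ w'.toFunctor.map (NatTrans.app θ.hom x)) →
    ∃! c : w ⟶ w', (∀ k : 𝔎.Obj, NatTrans.app c (i.toFunctor.obj k) = NatTrans.app a k) ∧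
      ∀ l : 𝔏.Obj, NatTrans.app c (j.toFunctor.obj l) = NatTrans.app b l

variable {𝔊 ℌ 𝔎 𝔊' ℌ' : PGrpd p}

/-- `E` is a composite of the cospans `𝔊 → 𝔎₁ ← ℌ` and `ℌ → 𝔎₂ ← 𝔎`: its apex is a homotopy
pushout of `𝔎₁ ← ℌ → 𝔎₂`, with the evident legs. -/
def Cospan.IsComposite (C : Cospan 𝔊 ℌ) (D : Cospan ℌ 𝔎) (E : Cospan 𝔊 𝔎) : Prop :=
  ∃ (i : C.apex.Fun E.apex) (j : D.apex.Fun E.apex) (θ : C.right.comp i ≅ D.left.comp j),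
    IsHPushout C.right D.left i j θ ∧
      Nonempty (C.left.comp i ≅ E.left) ∧ Nonempty (D.right.comp j ≅ E.right)

/-- The cospan `𝔊 → ℌ ← ℌ` of a functor `𝔊 → ℌ`, with the identity as second leg. -/
def Cospan.ofFun (f : 𝔊.Fun ℌ) : Cospan 𝔊 ℌ := ⟨ℌ, f, ContFunctor.id _⟩

/-- The coproduct of two cospans. -/
def Cospan.coprod (C : Cospan 𝔊 ℌ) (D : Cospan 𝔊' ℌ') : Cospan (𝔊.coprod 𝔊') (ℌ.coprod ℌ') :=
  ⟨C.apex.coprod D.apex, coprodMap C.left D.left, coprodMap C.right D.right⟩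

instance (𝔊 ℌ : PGrpd p) : Nonempty (Cospan 𝔊 ℌ) :=
  ⟨⟨𝔊.coprod ℌ, inl _ _, inr _ _⟩⟩

/-- Equivalence classes of cospans. -/
def CospanHom (𝔊 ℌ : PGrpd p) : Type 1 := Quotient (cospanSetoid 𝔊 ℌ)

/-- The class of a cospan. -/
def Cospan.cls (C : Cospan 𝔊 ℌ) : CospanHom 𝔊 ℌ := Quotient.mk _ C

namespace CospanHom

/-- The class of the identity cospan. -/
def idn (𝔊 : PGrpd p) : CospanHom 𝔊 𝔊 := (Cospan.ofFun (ContFunctor.id 𝔊.toTopGrpd)).cls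

/-- Composition of classes of cospans, in diagrammatic order, by means of a chosen homotopy
pushout. -/
def comp (C : CospanHom 𝔊 ℌ) (D : CospanHom ℌ 𝔎) : CospanHom 𝔊 𝔎 :=
  (Classical.epsilon fun E => Cospan.IsComposite (Quotient.out C) (Quotient.out D) E).cls

/-- The class of the cospan of a functor. -/
def ofFun (f : 𝔊.Fun ℌ) : CospanHom 𝔊 ℌ := (Cospan.ofFun f).cls

/-- The coproduct of classes of cospans. -/
def tensor (C : CospanHom 𝔊 ℌ) (D : CospanHom 𝔊' ℌ') :
    CospanHom (𝔊.coprod 𝔊') (ℌ.coprod ℌ') :=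
  Quotient.map₂ Cospan.coprod (by
    rintro C C' ⟨e, ⟨e', ⟨a⟩, ⟨b⟩⟩, ⟨l⟩, ⟨r⟩⟩ D D' ⟨f, ⟨f', ⟨a'⟩, ⟨b'⟩⟩, ⟨l'⟩, ⟨r'⟩⟩
    exact ⟨coprodMap e f, ⟨coprodMap e' f',
      ⟨coprodIsoExt (ContFunctor.isoWhiskerRight a (inl _ _))
        (ContFunctor.isoWhiskerRight a' (inr _ _))⟩,
      ⟨coprodIsoExt (ContFunctor.isoWhiskerRight b (inl _ _))
        (ContFunctor.isoWhiskerRight b' (inr _ _))⟩⟩,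
      ⟨coprodIsoExt (ContFunctor.isoWhiskerRight l (inl _ _))
        (ContFunctor.isoWhiskerRight l' (inr _ _))⟩,
      ⟨coprodIsoExt (ContFunctor.isoWhiskerRight r (inl _ _))
        (ContFunctor.isoWhiskerRight r' (inr _ _))⟩⟩) C D

end CospanHom

/-- The associator `(𝔊 ∐ ℌ) ∐ 𝔎 ⥤ 𝔊 ∐ (ℌ ∐ 𝔎)`. -/
def assocFun (𝔊 ℌ 𝔎 : PGrpd p) : ((𝔊.coprod ℌ).coprod 𝔎).Fun (𝔊.coprod (ℌ.coprod 𝔎)) :=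
  copair (copair (inl _ _) ((inl ℌ.toTopGrpd 𝔎.toTopGrpd).comp (inr _ _)))
    ((inr ℌ.toTopGrpd 𝔎.toTopGrpd).comp (inr _ _))

/-- The inverse associator `𝔊 ∐ (ℌ ∐ 𝔎) ⥤ (𝔊 ∐ ℌ) ∐ 𝔎`. -/
def assocInvFun (𝔊 ℌ 𝔎 : PGrpd p) : (𝔊.coprod (ℌ.coprod 𝔎)).Fun ((𝔊.coprod ℌ).coprod 𝔎) :=
  copair ((inl 𝔊.toTopGrpd ℌ.toTopGrpd).comp (inl _ _))
    (copair ((inr 𝔊.toTopGrpd ℌ.toTopGrpd).comp (inl _ _)) (inr _ _))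

/-- The unitor `∅ ∐ 𝔊 ⥤ 𝔊`. -/
def leftUnitorFun (𝔊 : PGrpd p) : ((PGrpd.empty p).coprod 𝔊).Fun 𝔊 :=
  copair (fromEmpty p _) (ContFunctor.id _)

/-- The inverse unitor `𝔊 ⥤ ∅ ∐ 𝔊`. -/
def leftUnitorInvFun (𝔊 : PGrpd p) : 𝔊.Fun ((PGrpd.empty p).coprod 𝔊) := inr _ _

/-- The unitor `𝔊 ∐ ∅ ⥤ 𝔊`. -/
def rightUnitorFun (𝔊 : PGrpd p) : (𝔊.coprod (PGrpd.empty p)).Fun 𝔊 :=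
  copair (ContFunctor.id _) (fromEmpty p _)

/-- The inverse unitor `𝔊 ⥤ 𝔊 ∐ ∅`. -/
def rightUnitorInvFun (𝔊 : PGrpd p) : 𝔊.Fun (𝔊.coprod (PGrpd.empty p)) := inl _ _

/-- The symmetry `𝔊 ∐ ℌ ⥤ ℌ ∐ 𝔊`. -/
def swapFun (𝔊 ℌ : PGrpd p) : (𝔊.coprod ℌ).Fun (ℌ.coprod 𝔊) := copair (inr _ _) (inl _ _)

end Cospans

open CospanHom in
/-- The laws of a symmetric monoidal category for classes of cospans of pro-`p` groupoids, with
composition by homotopy pushouts, with the coproduct as tensor product and with the evident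
associators, unitors and symmetries. -/
structure CospanLaws (p : ℕ) : Prop where
  exists_composite : ∀ {𝔊 ℌ 𝔎 : PGrpd p} (C : Cospan 𝔊 ℌ) (D : Cospan ℌ 𝔎), ∃ E, C.IsComposite D E
  comp_eq : ∀ {𝔊 ℌ 𝔎 : PGrpd p} (C : Cospan 𝔊 ℌ) (D : Cospan ℌ 𝔎) (E : Cospan 𝔊 𝔎),
    C.IsComposite D E → comp C.cls D.cls = E.cls
  id_comp : ∀ {𝔊 ℌ : PGrpd p} (f : CospanHom 𝔊 ℌ), comp (idn 𝔊) f = f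
  comp_id : ∀ {𝔊 ℌ : PGrpd p} (f : CospanHom 𝔊 ℌ), comp f (idn ℌ) = f
  assoc : ∀ {𝔊 ℌ 𝔎 𝔏 : PGrpd p} (f : CospanHom 𝔊 ℌ) (g : CospanHom ℌ 𝔎) (h : CospanHom 𝔎 𝔏),
    comp (comp f g) h = comp f (comp g h)
  tensor_id : ∀ 𝔊 ℌ : PGrpd p, tensor (idn 𝔊) (idn ℌ) = idn (𝔊.coprod ℌ)
  tensor_comp : ∀ {𝔊 ℌ 𝔎 𝔊' ℌ' 𝔎' : PGrpd p} (f : CospanHom 𝔊 ℌ) (f' : CospanHom 𝔊' ℌ')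
    (g : CospanHom ℌ 𝔎) (g' : CospanHom ℌ' 𝔎'),
    comp (tensor f f') (tensor g g') = tensor (comp f g) (comp f' g')
  assoc_hom_inv : ∀ 𝔊 ℌ 𝔎 : PGrpd p,
    comp (ofFun (assocFun 𝔊 ℌ 𝔎)) (ofFun (assocInvFun 𝔊 ℌ 𝔎)) = idn _
  assoc_inv_hom : ∀ 𝔊 ℌ 𝔎 : PGrpd p,
    comp (ofFun (assocInvFun 𝔊 ℌ 𝔎)) (ofFun (assocFun 𝔊 ℌ 𝔎)) = idn _
  leftUnitor_hom_inv : ∀ 𝔊 : PGrpd p,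
    comp (ofFun (leftUnitorFun 𝔊)) (ofFun (leftUnitorInvFun 𝔊)) = idn _
  leftUnitor_inv_hom : ∀ 𝔊 : PGrpd p,
    comp (ofFun (leftUnitorInvFun 𝔊)) (ofFun (leftUnitorFun 𝔊)) = idn _
  rightUnitor_hom_inv : ∀ 𝔊 : PGrpd p,
    comp (ofFun (rightUnitorFun 𝔊)) (ofFun (rightUnitorInvFun 𝔊)) = idn _
  rightUnitor_inv_hom : ∀ 𝔊 : PGrpd p,
    comp (ofFun (rightUnitorInvFun 𝔊)) (ofFun (rightUnitorFun 𝔊)) = idn _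
  assoc_naturality : ∀ {𝔊 ℌ 𝔎 𝔊' ℌ' 𝔎' : PGrpd p} (f : CospanHom 𝔊 𝔊') (g : CospanHom ℌ ℌ')
    (h : CospanHom 𝔎 𝔎'),
    comp (tensor (tensor f g) h) (ofFun (assocFun 𝔊' ℌ' 𝔎')) =
      comp (ofFun (assocFun 𝔊 ℌ 𝔎)) (tensor f (tensor g h))
  leftUnitor_naturality : ∀ {𝔊 ℌ : PGrpd p} (f : CospanHom 𝔊 ℌ),
    comp (tensor (idn (PGrpd.empty p)) f) (ofFun (leftUnitorFun ℌ)) =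
      comp (ofFun (leftUnitorFun 𝔊)) f
  rightUnitor_naturality : ∀ {𝔊 ℌ : PGrpd p} (f : CospanHom 𝔊 ℌ),
    comp (tensor f (idn (PGrpd.empty p))) (ofFun (rightUnitorFun ℌ)) =
      comp (ofFun (rightUnitorFun 𝔊)) f
  pentagon : ∀ 𝔊 ℌ 𝔎 𝔏 : PGrpd p,
    comp (tensor (ofFun (assocFun 𝔊 ℌ 𝔎)) (idn 𝔏))
        (comp (ofFun (assocFun 𝔊 (ℌ.coprod 𝔎) 𝔏)) (tensor (idn 𝔊) (ofFun (assocFun ℌ 𝔎 𝔏)))) =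
      comp (ofFun (assocFun (𝔊.coprod ℌ) 𝔎 𝔏)) (ofFun (assocFun 𝔊 ℌ (𝔎.coprod 𝔏)))
  triangle : ∀ 𝔊 ℌ : PGrpd p,
    comp (ofFun (assocFun 𝔊 (PGrpd.empty p) ℌ)) (tensor (idn 𝔊) (ofFun (leftUnitorFun ℌ))) =
      tensor (ofFun (rightUnitorFun 𝔊)) (idn ℌ)
  swap_naturality : ∀ {𝔊 ℌ 𝔊' ℌ' : PGrpd p} (f : CospanHom 𝔊 𝔊') (g : CospanHom ℌ ℌ'),
    comp (tensor f g) (ofFun (swapFun 𝔊' ℌ')) = comp (ofFun (swapFun 𝔊 ℌ)) (tensor g f)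
  swap_swap : ∀ 𝔊 ℌ : PGrpd p, comp (ofFun (swapFun 𝔊 ℌ)) (ofFun (swapFun ℌ 𝔊)) = idn _
  hexagon_forward : ∀ 𝔊 ℌ 𝔎 : PGrpd p,
    comp (ofFun (assocFun 𝔊 ℌ 𝔎))
        (comp (ofFun (swapFun 𝔊 (ℌ.coprod 𝔎))) (ofFun (assocFun ℌ 𝔎 𝔊))) =
      comp (tensor (ofFun (swapFun 𝔊 ℌ)) (idn 𝔎))
        (comp (ofFun (assocFun ℌ 𝔊 𝔎)) (tensor (idn ℌ) (ofFun (swapFun 𝔊 𝔎))))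
  hexagon_reverse : ∀ 𝔊 ℌ 𝔎 : PGrpd p,
    comp (ofFun (assocInvFun 𝔊 ℌ 𝔎))
        (comp (ofFun (swapFun (𝔊.coprod ℌ) 𝔎)) (ofFun (assocInvFun 𝔎 𝔊 ℌ))) =
      comp (tensor (idn 𝔊) (ofFun (swapFun ℌ 𝔎)))
        (comp (ofFun (assocInvFun 𝔊 𝔎 ℌ)) (tensor (ofFun (swapFun 𝔊 𝔎)) (idn ℌ)))

/-- The category `Cospan(pGrpd)`: its objects are the pro-`p` groupoids. The argument `h` is the
proof of the laws which enters the instances below. -/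
def CospanCat {p : ℕ} (_h : CospanLaws p) : Type 1 := PGrpd p

section Instances

variable {p : ℕ} (h : CospanLaws p)

instance : Category.{1} (CospanCat h) where
  Hom 𝔊 ℌ := CospanHom (p := p) 𝔊 ℌ
  id 𝔊 := CospanHom.idn (p := p) 𝔊
  comp f g := CospanHom.comp f g
  id_comp := h.id_comp
  comp_id := h.comp_id
  assoc := h.assoc

instance : MonoidalCategoryStruct (CospanCat h) where
  tensorObj 𝔊 ℌ := PGrpd.coprod (p := p) 𝔊 ℌ
  tensorUnit := PGrpd.empty p
  tensorHom f g := CospanHom.tensor f g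
  whiskerLeft 𝔊 _ _ f := CospanHom.tensor (CospanHom.idn (p := p) 𝔊) f
  whiskerRight f ℌ := CospanHom.tensor f (CospanHom.idn (p := p) ℌ)
  associator 𝔊 ℌ 𝔎 := ⟨CospanHom.ofFun (assocFun (p := p) 𝔊 ℌ 𝔎),
    CospanHom.ofFun (assocInvFun (p := p) 𝔊 ℌ 𝔎), h.assoc_hom_inv 𝔊 ℌ 𝔎, h.assoc_inv_hom 𝔊 ℌ 𝔎⟩
  leftUnitor 𝔊 := ⟨CospanHom.ofFun (leftUnitorFun (p := p) 𝔊),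
    CospanHom.ofFun (leftUnitorInvFun (p := p) 𝔊), h.leftUnitor_hom_inv 𝔊, h.leftUnitor_inv_hom 𝔊⟩
  rightUnitor 𝔊 := ⟨CospanHom.ofFun (rightUnitorFun (p := p) 𝔊),
    CospanHom.ofFun (rightUnitorInvFun (p := p) 𝔊), h.rightUnitor_hom_inv 𝔊,
    h.rightUnitor_inv_hom 𝔊⟩

instance : MonoidalCategory (CospanCat h) :=
  MonoidalCategory.ofTensorHom (C := CospanCat h)
    (id_tensorHom_id := h.tensor_id)
    (id_tensorHom := fun _ _ _ _ => rfl)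
    (tensorHom_id := fun _ _ => rfl)
    (tensorHom_comp_tensorHom := h.tensor_comp)
    (associator_naturality := h.assoc_naturality)
    (leftUnitor_naturality := h.leftUnitor_naturality)
    (rightUnitor_naturality := h.rightUnitor_naturality)
    (pentagon := h.pentagon)
    (triangle := h.triangle)

instance : SymmetricCategory (CospanCat h) where
  braiding 𝔊 ℌ := ⟨CospanHom.ofFun (swapFun (p := p) 𝔊 ℌ), CospanHom.ofFun (swapFun (p := p) ℌ 𝔊),
    h.swap_swap 𝔊 ℌ, h.swap_swap ℌ 𝔊⟩
  braiding_naturality_right 𝔊 _ _ f := h.swap_naturality (CospanHom.idn (p := p) 𝔊) f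
  braiding_naturality_left f ℌ := h.swap_naturality f (CospanHom.idn (p := p) ℌ)
  hexagon_forward := h.hexagon_forward
  hexagon_reverse := h.hexagon_reverse
  symmetry := h.swap_swap

end Instances

/-! ### The Dijkgraaf–Witten theory -/

section DW

variable (Γ : Type) [Group Γ] [TopologicalSpace Γ] [DiscreteTopology Γ]

/-- `Fun(𝔊, BΓ)`, the groupoid of principal `Γ`-bundles over `𝔊`. -/
abbrev Bun (𝔊 : TopGrpd) : Type := ContFunctor 𝔊 (TopGrpd.B Γ)

variable {Γ}

/-- The value of a functor to `BΓ` at a morphism, as an element of `Γ`. -/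
def Bun.val {𝔊 : TopGrpd} (P : Bun Γ 𝔊) {x y : 𝔊.Obj} (f : x ⟶ y) : Γ := P.toFunctor.map f

lemma Bun.val_comp {𝔊 : TopGrpd} (P : Bun Γ 𝔊) {x y z : 𝔊.Obj} (f : x ⟶ y) (g : y ⟶ z) :
    P.val (f ≫ g) = P.val g * P.val f := P.toFunctor.map_comp f g

lemma Bun.val_id {𝔊 : TopGrpd} (P : Bun Γ 𝔊) (x : 𝔊.Obj) : P.val (𝟙 x) = 1 := P.toFunctor.map_id x

lemma Bun.iso_of_loops {𝔊 : TopGrpd} (P P' : Bun Γ 𝔊)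
    (hl : ∀ (c : Pi0 𝔊.Obj) (f : c.out ⟶ c.out), P.val f = P'.val f) : Nonempty (P ≅ P') := by
  have hpath : ∀ x : 𝔊.Obj, Nonempty ((Quotient.mk (isIsomorphicSetoid 𝔊.Obj) x).out ⟶ x) :=
    fun x => (Quotient.mk_out (s := isIsomorphicSetoid 𝔊.Obj) x).map Iso.hom
  let e : ∀ x : 𝔊.Obj, (Quotient.mk (isIsomorphicSetoid 𝔊.Obj) x).out ⟶ x := fun x => (hpath x).some
  have key : ∀ {x y : 𝔊.Obj} (f : x ⟶ y) (c c' : Pi0 𝔊.Obj) (_ : c = c') (a : c.out ⟶ x)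
      (b : c'.out ⟶ y), (P'.val b * (P.val b)⁻¹) * P.val f = P'.val f * (P'.val a * (P.val a)⁻¹) := by
    rintro x y f c _ rfl a b
    have h1 := hl c (a ≫ f ≫ Groupoid.inv b)
    have hb : ∀ Q : Bun Γ 𝔊, Q.val (Groupoid.inv b) = (Q.val b)⁻¹ := fun Q => by
      rw [eq_inv_iff_mul_eq_one, ← Q.val_comp, Groupoid.comp_inv, Q.val_id]
    simp only [Bun.val_comp, hb] at h1
    have h2 : P.val f = P.val b * ((P.val b)⁻¹ * P.val f * P.val a) * (P.val a)⁻¹ := by group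
    rw [h2, h1]
    group
  refine ⟨ContFunctor.mkIso (NatIso.ofComponents
    (fun x => Groupoid.isoEquivHom _ _ |>.symm
      ((P'.val (e x) * (P.val (e x))⁻¹ : Γ) : P.toFunctor.obj x ⟶ P'.toFunctor.obj x)) ?_)⟩
  intro x y f
  exact key f _ _ (Quotient.sound ⟨(Groupoid.isoEquivHom x y).symm f⟩) (e x) (e y)

/-- There are finitely many isomorphism classes of principal `Γ`-bundles. -/
instance finite_pi0_bun {p : ℕ} [Finite Γ] (𝔊 : PGrpd p) : Finite (Pi0 (Bun Γ 𝔊.toTopGrpd)) := by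
  have := 𝔊.finite_pi0
  choose n π R hs _ using fun c : Pi0 𝔊.Obj => (𝔊.isFinPres_end c.out).2
  let Θ : Bun Γ 𝔊.toTopGrpd → ∀ c : Pi0 𝔊.Obj, Fin (n c) → Γ := fun P c i =>
    P.val (x := c.out) (y := c.out) (π c (FreeProP.gen p i))
  refine Finite.of_injective (fun q : Pi0 (Bun Γ 𝔊.toTopGrpd) => Θ q.out) ?_
  intro q q' hq
  suffices h : Nonempty (q.out ≅ q'.out) by
    rw [← Quotient.out_eq q, ← Quotient.out_eq q']
    exact Quotient.sound h
  refine Bun.iso_of_loops _ _ fun c f => ?_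
  obtain ⟨y, rfl⟩ := hs c f
  let φ : Bun Γ 𝔊.toTopGrpd → FreeProP p (Fin (n c)) →* Γ := fun P =>
    { toFun := fun y => P.val (x := c.out) (y := c.out) (π c y)
      map_one' := by rw [map_one]; exact P.val_id _
      map_mul' := fun a b => by rw [map_mul]; exact P.val_comp _ _ }
  have hc : ∀ P, Continuous (φ P) := fun P => (P.continuous_map _ _).comp (π c).continuous_toFun
  have heq : (φ q.out : FreeProP p (Fin (n c)) → Γ) = φ q'.out := by
    refine (FreeProP.denseRange_ofFree p (Fin (n c))).equalizer (hc _) (hc _) ?_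
    have : (φ q.out).comp (FreeProP.ofFree p _) = (φ q'.out).comp (FreeProP.ofFree p _) := by
      ext i
      exact congrFun (congrFun hq c) i
    exact congrArg DFunLike.coe this
  exact congrFun heq y

/-- Restriction of bundles along a functor, on isomorphism classes. -/
def res {𝔊 ℌ : TopGrpd} (f : ContFunctor 𝔊 ℌ) : Pi0 (Bun Γ ℌ) → Pi0 (Bun Γ 𝔊) :=
  Quotient.map (fun P => f.comp P) fun _ _ ⟨e⟩ => ⟨ContFunctor.isoWhiskerLeft f e⟩

/-- `|Aut(P)|` for an isomorphism class `P` of bundles. -/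
def autCard {𝔊 : TopGrpd} : Pi0 (Bun Γ 𝔊) → ℕ :=
  Quotient.lift (fun P => Nat.card (Aut P)) fun _ _ ⟨e⟩ => Nat.card_congr e.conjAut.toEquiv

/-- The isomorphism class of a bundle. -/
def Bun.cls {𝔊 : TopGrpd} (P : Bun Γ 𝔊) : Pi0 (Bun Γ 𝔊) := Quotient.mk _ P

variable {p : ℕ}

/-- `𝒪(Fun(𝔊, BΓ))`: complex functions on the set of isomorphism classes of bundles. -/
abbrev Fld (Γ : Type) [Group Γ] [TopologicalSpace Γ] [DiscreteTopology Γ] (𝔊 : PGrpd p) : Type :=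
  Pi0 (Bun Γ 𝔊.toTopGrpd) → ℂ

/-- The pullback `r^*` of functions. -/
def pull {𝔊 ℌ : PGrpd p} (r : 𝔊.Fun ℌ) : Fld Γ 𝔊 →ₗ[ℂ] Fld Γ ℌ := LinearMap.funLeft ℂ ℂ (res r)

open Classical in
/-- The pushforward `r_*` of functions: the value of `r_* F` at `P` is the sum of
`|Aut(P)| / |Aut(Q)| * F(Q)` over the isomorphism classes `Q` which restrict to `P`. -/
def push [Finite Γ] {𝔊 ℌ : PGrpd p} (r : 𝔊.Fun ℌ) : Fld Γ ℌ →ₗ[ℂ] Fld Γ 𝔊 :=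
  haveI := Fintype.ofFinite (Pi0 (Bun Γ ℌ.toTopGrpd))
  { toFun := fun F P => ∑ Q with res r Q = P, (autCard P : ℂ) / (autCard Q : ℂ) * F Q
    map_add' := fun F F' => by ext P; simp [mul_add, Finset.sum_add_distrib]
    map_smul' := fun c F => by ext P; simp [Finset.mul_sum, mul_left_comm] }

/-- The linear map of a cospan: pullback along the first leg, then pushforward along the second. -/
def pullPush [Finite Γ] {𝔊 ℌ : PGrpd p} (C : Cospan 𝔊 ℌ) : Fld Γ 𝔊 →ₗ[ℂ] Fld Γ ℌ :=
  push C.right ∘ₗ pull C.left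

end DW

end ProPDW
end
open CategoryTheory MonoidalCategory

noncomputable section

namespace ProPDW

section Theory

variable {Γ : Type} [Group Γ] [TopologicalSpace Γ] [DiscreteTopology Γ]

lemma res_comp {𝔊 ℌ 𝔎 : TopGrpd} (f : ContFunctor 𝔊 ℌ) (g : ContFunctor ℌ 𝔎)
    (Q : Pi0 (Bun Γ 𝔎)) : res (f.comp g) Q = res f (res g Q) := by
  induction Q using Quotient.inductionOn
  rfl

lemma res_congr {𝔊 ℌ : TopGrpd} {f f' : ContFunctor 𝔊 ℌ} (e : f ≅ f') (Q : Pi0 (Bun Γ ℌ)) :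
    res f Q = res f' Q := by
  induction Q using Quotient.inductionOn with | _ Q =>
  exact Quotient.sound ⟨ContFunctor.isoWhiskerRight e Q⟩

lemma res_id {𝔊 : TopGrpd} (Q : Pi0 (Bun Γ 𝔊)) : res (ContFunctor.id 𝔊) Q = Q := by
  induction Q using Quotient.inductionOn
  rfl

lemma whisker_injective {𝔊 ℌ : TopGrpd} (f : ContFunctor 𝔊 ℌ) (hf : f.IsEquiv) (Q : Bun Γ ℌ) :
    Function.Injective fun a : Aut Q => (ContFunctor.isoWhiskerLeft f a : Aut (f.comp Q)) := by
  obtain ⟨f', -, ⟨c⟩⟩ := hf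
  intro a b hab
  refine Iso.ext (NatTrans.ext (funext fun y => ?_))
  have h : ∀ x : 𝔊.Obj, NatTrans.app a.hom (f.toFunctor.obj x) =
      NatTrans.app b.hom (f.toFunctor.obj x) := fun x =>
    congrArg (fun u : Aut (f.comp Q) => NatTrans.app u.hom x) hab
  have ha := NatTrans.naturality a.hom (NatTrans.app c.hom y)
  have hb := NatTrans.naturality b.hom (NatTrans.app c.hom y)
  rw [show NatTrans.app a.hom ((f'.comp f).toFunctor.obj y) = NatTrans.app b.hom _ from h _,
    ← hb] at ha
  have := IsIso.of_groupoid (NatTrans.app c.hom y)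
  have : IsIso (Q.toFunctor.map (NatTrans.app c.hom y)) := Functor.map_isIso _ _
  exact (IsIso.epi_of_iso (Q.toFunctor.map (NatTrans.app c.hom y))).left_cancellation _ _ ha

lemma autCard_res {𝔊 ℌ : TopGrpd} (f : ContFunctor 𝔊 ℌ) (hf : f.IsEquiv) (Q : Pi0 (Bun Γ ℌ)) :
    autCard (res f Q) = autCard Q := by
  induction Q using Quotient.inductionOn with | _ Q =>
  obtain ⟨f', hl, ⟨c⟩⟩ := id hf
  have hf' : f'.IsEquiv := ⟨f, ⟨c⟩, hl⟩
  have e : Aut (f'.comp (f.comp Q)) ≃ Aut Q :=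
    (Iso.conjAut (ContFunctor.isoWhiskerRight c Q : f'.comp (f.comp Q) ≅ Q)).toEquiv
  obtain ⟨e'⟩ := Function.Embedding.antisymm
    (⟨_, whisker_injective f hf Q⟩ : Aut Q ↪ Aut (f.comp Q))
    ((⟨_, whisker_injective f' hf' (f.comp Q)⟩ :
      Aut (f.comp Q) ↪ Aut (f'.comp (f.comp Q))).trans e.toEmbedding)
  exact (Nat.card_congr e').symm

lemma pullPush_eq_of_rel {p : ℕ} [Finite Γ] {𝔊 ℌ : PGrpd p} {C D : Cospan 𝔊 ℌ} (h : C.Rel D) :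
    pullPush (Γ := Γ) C = pullPush D := by
  obtain ⟨e, he, ⟨l⟩, ⟨r⟩⟩ := h
  obtain ⟨e', ⟨a⟩, ⟨b⟩⟩ := id he
  refine LinearMap.ext fun F => funext fun P => ?_
  symm
  refine Finset.sum_bij' (fun Q _ => res e Q) (fun Q _ => res e' Q) ?_ ?_ ?_ ?_ ?_
  · intro Q hQ
    simp only [Finset.mem_filter, Finset.mem_univ, true_and] at hQ ⊢
    rw [← res_comp, res_congr r, hQ]
  · intro Q hQ
    simp only [Finset.mem_filter, Finset.mem_univ, true_and] at hQ ⊢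
    rw [← res_congr r, res_comp, ← res_comp e e', res_congr a, res_id, hQ]
  · intro Q _
    rw [← res_comp, res_congr b, res_id]
  · intro Q _
    rw [← res_comp, res_congr a, res_id]
  · intro Q _
    rw [autCard_res e he]
    congr 1
    change F (res D.left Q) = F (res C.left (res e Q))
    rw [← res_comp, res_congr l]

/-- The linear map attached to a morphism of `Cospan(pGrpd)`. -/
def dwMap (Γ : Type) [Group Γ] [TopologicalSpace Γ] [DiscreteTopology Γ] [Finite Γ] {p : ℕ}
    {𝔊 ℌ : PGrpd p} (c : CospanHom 𝔊 ℌ) : Fld Γ 𝔊 →ₗ[ℂ] Fld Γ ℌ :=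
  Quotient.lift pullPush (fun _ _ h => pullPush_eq_of_rel h) c

/-- Functoriality of the assignment `dwMap`. -/
structure DWLaws (p : ℕ) (Γ : Type) [Group Γ] [TopologicalSpace Γ] [DiscreteTopology Γ]
    [Finite Γ] : Prop where
  map_id : ∀ 𝔊 : PGrpd p, dwMap Γ (CospanHom.idn 𝔊) = LinearMap.id
  map_comp : ∀ {𝔊 ℌ 𝔎 : PGrpd p} (c : CospanHom 𝔊 ℌ) (d : CospanHom ℌ 𝔎),
    dwMap Γ (CospanHom.comp c d) = dwMap Γ d ∘ₗ dwMap Γ c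

instance {p : ℕ} [Finite Γ] (𝔊 : PGrpd p) : Module.Finite ℂ (Fld Γ 𝔊) :=
  Module.Finite.pi (R := ℂ) (ι := Pi0 (Bun Γ 𝔊.toTopGrpd)) (M := fun _ => ℂ)

/-- The value `Z(𝔊) = 𝒪(Fun(𝔊, BΓ))`, as a finitely generated (projective) `ℂ`-module. -/
def dwObj (Γ : Type) [Group Γ] [TopologicalSpace Γ] [DiscreteTopology Γ] [Finite Γ] {p : ℕ}
    (𝔊 : PGrpd p) : FGModuleCat.{0} ℂ := FGModuleCat.of ℂ (Fld Γ 𝔊)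

/-- The linear map `dwMap Γ c`, as a morphism of finitely generated `ℂ`-modules. -/
def dwHom (Γ : Type) [Group Γ] [TopologicalSpace Γ] [DiscreteTopology Γ] [Finite Γ] {p : ℕ}
    {𝔊 ℌ : PGrpd p} (c : CospanHom 𝔊 ℌ) : dwObj Γ 𝔊 ⟶ dwObj Γ ℌ := FGModuleCat.ofHom (dwMap Γ c)

lemma dwHom_id {p : ℕ} [Finite Γ] (hZ : DWLaws p Γ) (𝔊 : PGrpd p) :
    dwHom Γ (CospanHom.idn 𝔊) = 𝟙 (dwObj Γ 𝔊) := congrArg FGModuleCat.ofHom (hZ.map_id 𝔊)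

lemma dwHom_comp {p : ℕ} [Finite Γ] (hZ : DWLaws p Γ) {𝔊 ℌ 𝔎 : PGrpd p} (c : CospanHom 𝔊 ℌ)
    (d : CospanHom ℌ 𝔎) : dwHom Γ (CospanHom.comp c d) = dwHom Γ c ≫ dwHom Γ d :=
  congrArg FGModuleCat.ofHom (hZ.map_comp c d)

/-- The functor `Z : Cospan(pGrpd) ⥤ Proj(ℂ)`, `𝔊 ↦ 𝒪(Fun(𝔊, BΓ))`. -/
def dwFunctor {p : ℕ} [Finite Γ] (h : CospanLaws p) (hZ : DWLaws p Γ) :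
    CospanCat h ⥤ FGModuleCat.{0} ℂ where
  obj 𝔊 := dwObj (p := p) Γ 𝔊
  map c := dwHom Γ c
  map_id 𝔊 := dwHom_id hZ 𝔊
  map_comp c d := dwHom_comp hZ c d

/-- The external product of functions, `(F, F') ↦ ((P, P') ↦ F(P) F'(P'))`. -/
def box {p : ℕ} {𝔊 ℌ : PGrpd p} (F : Fld Γ 𝔊) (F' : Fld Γ ℌ) : Fld Γ (𝔊.coprod ℌ) := fun P =>
  F (res (inl 𝔊.toTopGrpd ℌ.toTopGrpd) P) * F' (res (inr 𝔊.toTopGrpd ℌ.toTopGrpd) P)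

open TensorProduct in
/-- The canonical map `𝒪(Fun(𝔊, BΓ)) ⊗ 𝒪(Fun(ℌ, BΓ)) → 𝒪(Fun(𝔊 ∐ ℌ, BΓ))`. -/
def boxMap (Γ : Type) [Group Γ] [TopologicalSpace Γ] [DiscreteTopology Γ] {p : ℕ} (𝔊 ℌ : PGrpd p) :
    Fld Γ 𝔊 ⊗[ℂ] Fld Γ ℌ →ₗ[ℂ] Fld Γ (𝔊.coprod ℌ) :=
  TensorProduct.lift (LinearMap.mk₂ ℂ box
    (fun _ _ _ => funext fun _ => add_mul _ _ _)
    (fun _ _ _ => funext fun _ => mul_assoc _ _ _)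
    (fun _ _ _ => funext fun _ => mul_add _ _ _)
    (fun _ _ _ => funext fun _ => mul_left_comm _ _ _))

/-- The map `boxMap`, as a morphism of finitely generated `ℂ`-modules. -/
def muHom (Γ : Type) [Group Γ] [TopologicalSpace Γ] [DiscreteTopology Γ] [Finite Γ] {p : ℕ}
    (𝔊 ℌ : PGrpd p) : dwObj Γ 𝔊 ⊗ dwObj Γ ℌ ⟶ dwObj Γ (𝔊.coprod ℌ) :=
  FGModuleCat.ofHom (boxMap Γ 𝔊 ℌ)

/-- The canonical map `ℂ → 𝒪(Fun(∅, BΓ))` which sends `1` to the constant function `1`. -/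
def epsHom (Γ : Type) [Group Γ] [TopologicalSpace Γ] [DiscreteTopology Γ] [Finite Γ] (p : ℕ) :
    𝟙_ (FGModuleCat.{0} ℂ) ⟶ dwObj Γ (PGrpd.empty p) :=
  FGModuleCat.ofHom (V := ℂ) (W := Fld Γ (PGrpd.empty p)) (LinearMap.toSpanSingleton ℂ _ fun _ => 1)

/-- The linear isomorphism `f_#` attached to an equivalence `f` (and more generally the linear map
attached to any functor `f`): the value at the cospan `𝔊 → ℌ ← ℌ` with legs `f` and `id`. -/
def sharp (Γ : Type) [Group Γ] [TopologicalSpace Γ] [DiscreteTopology Γ] [Finite Γ] {p : ℕ}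
    {𝔊 ℌ : PGrpd p} (f : 𝔊.Fun ℌ) : Fld Γ 𝔊 →ₗ[ℂ] Fld Γ ℌ := dwMap Γ (CospanHom.ofFun f)

end Theory

/-! ### Conjugacy classes of homomorphisms -/

section Hom

variable {G Γ : Type} [Group G] [TopologicalSpace G] [Group Γ] [TopologicalSpace Γ]

/-- Two homomorphisms to `Γ` are conjugate by an element of `Γ`. -/
def HomConj (ρ σ : G →ₜ* Γ) : Prop := ∃ γ : Γ, ∀ x, σ x = γ * ρ x * γ⁻¹

variable (G Γ) in
/-- The conjugation relation on `Hom(G, Γ)`. -/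
def homSetoid : Setoid (G →ₜ* Γ) where
  r := HomConj
  iseqv := ⟨fun ρ => ⟨1, by simp⟩,
    fun ⟨γ, h⟩ => ⟨γ⁻¹, fun x => by rw [h]; group⟩,
    fun ⟨γ, h⟩ ⟨δ, k⟩ => ⟨δ * γ, fun x => by rw [k, h]; group⟩⟩

variable (G Γ) in
/-- `Hom(G, Γ)/∼`. -/
abbrev HomCls : Type := Quotient (homSetoid G Γ)

/-- The order of the centralizer in `Γ` of a homomorphism to `Γ`. -/
def centCard (ρ : G →ₜ* Γ) : ℕ := Nat.card (Subgroup.centralizer (Set.range ρ))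

end Hom

/-! ### The generating cobordisms -/

section Generators

variable (p : ℕ) [Fact p.Prime]

/-- `Bℤ_p`. -/
abbrev BZp : PGrpd p := PGrpd.B (Zp p) (isFinPres_zp p)

/-- The classifying groupoid of the trivial group. -/
abbrev BOne : PGrpd p := PGrpd.B Unit (isFinPres_unit p)

/-- The classifying groupoid of the free pro-`p` group of rank `n`. -/
abbrev BFree (n : ℕ) : PGrpd p := PGrpd.B (FreeProP p (Fin n)) (FreeProP.isFinPres p n)

variable {p} in
/-- The functor `Bℤ_p ⥤ BF` given by an element of the free pro-`p` group `F`. -/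
def loop {n : ℕ} (g : FreeProP p (Fin n)) : (BZp p).Fun (BFree p n) := bMap (FreeProP.zpHom g)

/-- The functor `Bℤ_p ⥤ B1`. -/
def collapse : (BZp p).Fun (BOne p) := bMap (1 : Zp p →ₜ* Unit)

/-- `C_{1,0} = (1; {ℤ_p}, ∅)`. -/
def genCounit : Cospan (BZp p) (PGrpd.empty p) := ⟨BOne p, collapse p, fromEmpty p _⟩

/-- `C_{0,1} = (1; ∅, {ℤ_p})`. -/
def genUnit : Cospan (PGrpd.empty p) (BZp p) := ⟨BOne p, fromEmpty p _, collapse p⟩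

/-- `P_{2,1} = (⟨a, b⟩; {⟨a⟩, ⟨b⟩}, {⟨ab⟩})`. -/
def genMul : Cospan ((BZp p).coprod (BZp p)) (BZp p) :=
  ⟨BFree p 2, copair (loop (FreeProP.gen p 0)) (loop (FreeProP.gen p 1)),
    loop (FreeProP.gen p 0 * FreeProP.gen p 1)⟩

/-- `P_{1,2} = (⟨a, b⟩; {⟨ab⟩}, {⟨a⟩, ⟨b⟩})`. -/
def genComul : Cospan (BZp p) ((BZp p).coprod (BZp p)) :=
  ⟨BFree p 2, loop (FreeProP.gen p 0 * FreeProP.gen p 1),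
    copair (loop (FreeProP.gen p 0)) (loop (FreeProP.gen p 1))⟩

/-- The commutator `[x, y] = x⁻¹ y⁻¹ x y`. -/
def comm {G : Type} [Group G] (x y : G) : G := x⁻¹ * y⁻¹ * x * y

/-- `T_{1,1} = (⟨s, x, y⟩; {⟨s⟩}, {⟨s [x, y]⟩})`. -/
def genTorus : Cospan (BZp p) (BZp p) :=
  ⟨BFree p 3, loop (FreeProP.gen p 0),
    loop (FreeProP.gen p 0 * comm (FreeProP.gen p 1) (FreeProP.gen p 2))⟩

/-- `T^r_{1,1} = (⟨s, x, y⟩; {⟨s⟩}, {⟨s x^{p^r} [x, y]⟩})`. -/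
def genTorusLevel (r : ℕ) : Cospan (BZp p) (BZp p) :=
  ⟨BFree p 3, loop (FreeProP.gen p 0),
    loop (FreeProP.gen p 0 * FreeProP.gen p 1 ^ p ^ r *
      comm (FreeProP.gen p 1) (FreeProP.gen p 2))⟩

variable {p} in
/-- The functor `Bℤ_p ⥤ Bℤ_p` induced by the homomorphism `f_α : ℤ_p → ℤ_p`, `1 ↦ α`. -/
def twistFun (α : ℤ_[p]ˣ) : (BZp p).Fun (BZp p) :=
  bMap (G := Zp p) (H := Zp p)
    { toMonoidHom := AddMonoidHom.toMultiplicative (AddMonoidHom.mulLeft (α : ℤ_[p]))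
      continuous_toFun := (continuous_const.mul continuous_id : Continuous fun l : ℤ_[p] => α * l) }

variable {p} in
/-- The twist `C^α_{1,1}`: the cospan `ℤ_p → ℤ_p ← ℤ_p` with legs `f_α` and `id`. -/
def genTwist (α : ℤ_[p]ˣ) : Cospan (BZp p) (BZp p) := ⟨BZp p, twistFun α, ContFunctor.id _⟩

variable {p} in
/-- The cospan `ℤ_p → ℤ_p ← ℤ_p` with legs `id` and `f_α`, in which the outgoing boundary is twisted
by `α`. -/
def genTwistOut (α : ℤ_[p]ˣ) : Cospan (BZp p) (BZp p) := ⟨BZp p, ContFunctor.id _, twistFun α⟩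

end Generators

end ProPDW
end

open CategoryTheory MonoidalCategory

noncomputable section

namespace ProPDW

/-! ### Homomorphisms out of free and finitely presented pro-`p` groups -/

section ProPGroups

variable {p : ℕ}

/-! `Z` counts `Γ`-bundles with weight the inverse order of the automorphism group, and its
functoriality is base change for groupoid cardinality. A homotopy pushout `𝔓` of `𝔎 ← 𝔖 → 𝔏` has as
groupoid of bundles the homotopy fibre product of the groupoids of bundles on `𝔎` and `𝔏` over the
one on `𝔖`. Fix bundles `a` on `𝔎` and `b` on `𝔏`. Each isomorphism `η` between their restrictions
to `𝔖` glues them to a bundle on `𝔓` in exactly one class `q`, and the ways of presenting `η` by the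
representative of `q` form a torsor under its automorphism group (`IsHPushout.card_fibre`). Counting
the isomorphisms `η` therefore gives a weighted count of the classes `q` (`card_iso_eq_sum`,
`sum_inv_autCard`), which is exactly what makes pull-push compatible with composition
(`pullPush_of_isComposite`). The universal property is tested only against objects of `pGrpd`, so
`BΓ` has to be one of them; this is `isFinPres_of_finite`.

The category of cospans rests on the existence of homotopy pushouts. A pushout is a coequalizer of
two functors into a coproduct, and the target of these functors may be replaced by its skeleton `∐
BAᵢ`. The data then form a finite graph of groups, with the components of the target as vertices and
the components of the source as edges, and the coequalizer is the disjoint union of the classifying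
groupoids of the fundamental groups of its connected components (`exists_hcoeq_fam`). Such a
fundamental group is finitely presented, because an edge relation need only be imposed on finitely
many topological generators of the edge group (`exists_freeProduct`, `exists_graphGroup`).
Associativity of composition is the pasting law `IsHPushout.paste`. The coherence laws reduce to
isomorphisms between functors, since composing with the cospan of a functor is precomposition on one
side (`CospanHom.ofFun_comp`) and, for an equivalence, transport of a leg on the other
(`CospanHom.comp_ofFun`). Monoidality of `Z` holds because a bundle on a coproduct is a pair of
bundles, with automorphism groups multiplying.

For the explicit values, a bundle on `BG` is a homomorphism `G → Γ` up to conjugation, and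
orbit-stabilizer turns the weighted sum over classes into a sum over all homomorphisms
(`dwMap_b_apply`). With a single outgoing circle every normalising factor cancels
(`dwMap_circle_apply`). Homomorphisms from a free pro-`p` group to `Γ` are arbitrary tuples, so the
generators become sums of characters over solutions of word equations. Schur's lemma evaluates them
in the form `sum_character_conj_mul`, which separates a conjugation average into a product of
characters. The comultiplication in terms of all irreducible representations uses the second
orthogonality relation `sum_character_mul_character_inv_eq`, hence the completeness of the
characters among class functions. -/

lemma FreeProP.hom_ext {X T : Type} [Group T] [TopologicalSpace T] [T2Space T]
    {φ ψ : FreeProP p X →ₜ* T}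
    (h : ∀ x, φ (FreeProP.gen p x) = ψ (FreeProP.gen p x)) : φ = ψ := by
  have hcomp : φ.toMonoidHom.comp (FreeProP.ofFree p X) = ψ.toMonoidHom.comp (FreeProP.ofFree p X) :=
    FreeGroup.ext_hom _ _ h
  refine DFunLike.coe_injective ?_
  refine (FreeProP.denseRange_ofFree p X).equalizer φ.continuous_toFun ψ.continuous_toFun ?_
  exact congrArg DFunLike.coe hcomp

/-- In a pro-`p` group, an element lying in all open normal subgroups is trivial. -/
lemma IsProP.eq_one {T : Type} [Group T] [TopologicalSpace T] (hT : IsProP p T) {g : T}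
    (hg : ∀ (U : Subgroup T) [U.Normal], IsOpen (U : Set T) → g ∈ U) : g = 1 := by
  have := hT.isTopologicalGroup
  have := hT.compactSpace
  have := hT.t2Space
  have := hT.totallyDisconnectedSpace
  by_contra h
  obtain ⟨U, hU⟩ := ProfiniteGrp.exist_openNormalSubgroup_sub_open_nhds_of_one
    (isOpen_compl_singleton (x := g)) (by simpa using Ne.symm h)
  exact hU (hg U.toSubgroup U.isOpen') rfl

lemma IsProP.finite_quotient {T : Type} [Group T] [TopologicalSpace T] (hT : IsProP p T)
    (U : Subgroup T) (hU : IsOpen (U : Set T)) : Finite (T ⧸ U) := by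
  have := hT.isTopologicalGroup
  have := hT.compactSpace
  exact Subgroup.quotient_finite_of_isOpen U hU

/-- The kernel of a homomorphism from a free group to a finite `p`-group. -/
def PIndex.ker [Fact p.Prime] {X Q : Type} [Group Q] [Finite Q] (hQ : IsPGroup p Q) (f : FreeGroup X →* Q) :
    PIndex p X :=
  ⟨f.ker, inferInstance, by
    rw [Subgroup.index_ker]
    exact (IsPGroup.iff_card (p := p)).mp (hQ.to_subgroup f.range)⟩

/-- The universal property of the free pro-`p` group. -/
lemma FreeProP.exists_lift [Fact p.Prime] {X T : Type} [Group T] [TopologicalSpace T] (hT : IsProP p T)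
    (v : X → T) : ∃ φ : FreeProP p X →ₜ* T, ∀ x, φ (FreeProP.gen p x) = v x := by
  have := hT.isTopologicalGroup
  have := hT.compactSpace
  have := hT.t2Space
  have := (FreeProP.isProP p X).compactSpace
  have := (FreeProP.isProP p X).t2Space
  let f : FreeGroup X →* T := FreeGroup.lift v
  let j : FreeGroup X →* FreeProP p X × T := (FreeProP.ofFree p X).prod f
  -- The lift is obtained as a closed graph: `H` is the closure of the graph of `f` over the free
  -- group. Its projection to the free pro-`p` group is a continuous bijection from a compact space,
  -- hence a homeomorphism, and the second coordinate of its inverse is the lift.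
  let H : Subgroup (FreeProP p X × T) := j.range.topologicalClosure
  have hH : IsClosed (H : Set (FreeProP p X × T)) := Subgroup.isClosed_topologicalClosure _
  have : CompactSpace H := isCompact_iff_compactSpace.mp hH.isCompact
  have hj : ∀ w, j w ∈ H := fun w => subset_closure ⟨w, rfl⟩
  let π₁ : H →* FreeProP p X := (MonoidHom.fst _ _).comp H.subtype
  have hc₁ : Continuous π₁ := continuous_fst.comp continuous_subtype_val
  have hsurj : Function.Surjective π₁ := by
    have hcl : IsClosed (Set.range π₁) := (isCompact_range hc₁).isClosed
    have hd : DenseRange π₁ := (FreeProP.denseRange_ofFree p X).mono (by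
      rintro _ ⟨w, rfl⟩
      exact ⟨⟨j w, hj w⟩, rfl⟩)
    exact Set.range_eq_univ.mp (by rw [← hcl.closure_eq]; exact hd.closure_eq)
  have hinj : Function.Injective π₁ := by
    refine (injective_iff_map_eq_one π₁).mpr ?_
    rintro ⟨⟨x, g⟩, hg⟩ (rfl : x = 1)
    have : g = 1 := by
      refine hT.eq_one fun U _ hU => ?_
      have := hT.finite_quotient U hU
      -- Single-valuedness of the graph: `T ⧸ U` is a finite `p`-group, so the kernel of `FreeGroup
      -- X → T ⧸ U` is one of the indices of the inverse limit. A point `j w` close to `(1, g)` has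
      -- `w` in this kernel and `f w` in `g U`, which forces `g ∈ U`.
      let N : PIndex p X := PIndex.ker (hT.isPGroup_quotient U hU) ((QuotientGroup.mk' U).comp f)
      have hV : IsOpen {y : FreeProP p X × T | y.1.1 N = 1 ∧ g⁻¹ * y.2 ∈ (U : Set T)} := by
        refine IsOpen.inter ?_ ?_
        · exact (isOpen_discrete ({1} : Set (PQuot N))).preimage
            ((continuous_apply N).comp (continuous_subtype_val.comp continuous_fst))
        · exact hU.preimage (continuous_const.mul continuous_snd)
      obtain ⟨_, ⟨h1, h2⟩, ⟨w, rfl⟩⟩ := mem_closure_iff.mp hg _ hV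
        ⟨rfl, by simp⟩
      have h3 : w ∈ N.1 := (QuotientGroup.eq_one_iff w).mp h1
      have h4 : f w ∈ U := (QuotientGroup.eq_one_iff (f w)).mp h3
      have h5 := U.mul_mem h4 (U.inv_mem h2)
      simpa [j] using h5
    subst this
    rfl
  let e : H ≃* FreeProP p X := MulEquiv.ofBijective π₁ ⟨hinj, hsurj⟩
  have he : Continuous e.symm :=
    (Continuous.homeoOfEquivCompactToT2 (f := e.toEquiv) hc₁).symm.continuous
  refine ⟨⟨(MonoidHom.snd _ _).comp (H.subtype.comp e.symm.toMonoidHom),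
    continuous_snd.comp (continuous_subtype_val.comp he)⟩, fun x => ?_⟩
  have h1 : e.symm (FreeProP.gen p x) = ⟨j (FreeGroup.of x), hj _⟩ := by
    rw [MulEquiv.symm_apply_eq]
    rfl
  change (e.symm (FreeProP.gen p x)).1.2 = v x
  rw [h1]
  exact FreeGroup.lift_apply_of

/-- A continuous homomorphism factors through a surjection of compact groups if it kills the
kernel. -/
lemma exists_factor {F A T : Type} [Group F] [TopologicalSpace F] [CompactSpace F] [Group A]
    [TopologicalSpace A] [T2Space A] [Group T] [TopologicalSpace T] (π : F →ₜ* A)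
    (hπ : Function.Surjective π) (ψ : F →ₜ* T) (h : π.toMonoidHom.ker ≤ ψ.toMonoidHom.ker) :
    ∃ φ : A →ₜ* T, ∀ x, φ (π x) = ψ x := by
  have hq : Topology.IsQuotientMap π :=
    (π.continuous_toFun.isClosedMap).isQuotientMap π.continuous_toFun hπ
  let φ : A →* T := π.toMonoidHom.liftOfSurjective hπ ⟨ψ.toMonoidHom, h⟩
  have hφ : ∀ x, φ (π x) = ψ x := fun x =>
    MonoidHom.liftOfRightInverse_comp_apply π.toMonoidHom _ _ ⟨ψ.toMonoidHom, h⟩ x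
  refine ⟨⟨φ, hq.continuous_iff.mpr ?_⟩, hφ⟩
  exact ψ.continuous_toFun.congr fun x => (hφ x).symm

/-- The kernel is normal, and closed because points of `T` are closed. This allows topological
relations to be checked on the relators alone. -/
lemma closure_le_ker {F T : Type} [Group F] [TopologicalSpace F] [IsTopologicalGroup F] [Group T]
    [TopologicalSpace T] [T1Space T] (ψ : F →ₜ* T) (R : Set F) (h : ∀ r ∈ R, ψ r = 1) :
    (Subgroup.normalClosure R).topologicalClosure ≤ ψ.toMonoidHom.ker := by
  refine Subgroup.topologicalClosure_minimal _ (Subgroup.normalClosure_le_normal h) ?_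
  exact isClosed_singleton.preimage ψ.continuous_toFun

instance normal_topologicalClosure_normalClosure {G : Type} [Group G] [TopologicalSpace G]
    [IsTopologicalGroup G] (R : Set G) : (Subgroup.normalClosure R).topologicalClosure.Normal :=
  Subgroup.is_normal_topologicalClosure _

/-- The quotient of a topological group by the closed normal subgroup generated by `R`. -/
abbrev Presented {G : Type} [Group G] [TopologicalSpace G] [IsTopologicalGroup G] (R : Set G) :
    Type := G ⧸ (Subgroup.normalClosure R).topologicalClosure

/-- The projection to the quotient by the closed normal subgroup generated by `R`. -/
def Presented.mk {G : Type} [Group G] [TopologicalSpace G] [IsTopologicalGroup G] (R : Set G) :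
    G →ₜ* Presented R :=
  ⟨QuotientGroup.mk' _, QuotientGroup.continuous_mk⟩

lemma Presented.mk_surjective {G : Type} [Group G] [TopologicalSpace G] [IsTopologicalGroup G]
    (R : Set G) : Function.Surjective (Presented.mk R) := QuotientGroup.mk_surjective

lemma Presented.ker_mk {G : Type} [Group G] [TopologicalSpace G] [IsTopologicalGroup G]
    (R : Set G) :
    (Presented.mk R).toMonoidHom.ker = (Subgroup.normalClosure R).topologicalClosure :=
  QuotientGroup.ker_mk' _

lemma Presented.mk_eq_one {G : Type} [Group G] [TopologicalSpace G] [IsTopologicalGroup G]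
    {R : Set G} {r : G} (hr : r ∈ R) : Presented.mk R r = 1 :=
  (QuotientGroup.eq_one_iff r).mpr (subset_closure (Subgroup.subset_normalClosure hr))

/-- The quotient of a pro-`p` group by a closed normal subgroup is pro-`p`. -/
lemma IsProP.presented {G : Type} [Group G] [TopologicalSpace G] [IsTopologicalGroup G]
    (hG : IsProP p G) (R : Set G) : IsProP p (Presented R) := by
  have := hG.compactSpace
  have := hG.t2Space
  have := hG.totallyDisconnectedSpace
  set N := (Subgroup.normalClosure R).topologicalClosure with hN
  have hcl : IsClosed (N : Set G) := Subgroup.isClosed_topologicalClosure _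
  have : T2Space (G ⧸ N) := inferInstance
  have hts : TotallySeparatedSpace (G ⧸ N) := by
    refine totallySeparatedSpace_iff_exists_isClopen.mpr fun a b hab => ?_
    obtain ⟨x, rfl⟩ := QuotientGroup.mk_surjective a
    obtain ⟨y, rfl⟩ := QuotientGroup.mk_surjective b
    have hxy : x⁻¹ * y ∉ N := fun h => hab (QuotientGroup.eq.mpr h)
    -- A closed subgroup of a profinite group is the intersection of the open subgroups containing
    -- it, so some open `M ≥ N` separates the cosets of `x` and `y`.
    have hcs := ProfiniteGrp.closedSubgroup_eq_sInf_open (⟨N, hcl⟩ : ClosedSubgroup G)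
    have : ∃ M : Subgroup G, (IsOpen (M : Set G) ∧ N ≤ M) ∧ x⁻¹ * y ∉ M := by
      by_contra hcon
      push Not at hcon
      refine hxy ?_
      have : x⁻¹ * y ∈ sInf {M : Subgroup G | IsOpen (M : Set G) ∧ N ≤ M} :=
        Subgroup.mem_sInf.mpr fun M hM => hcon M hM
      have h2 := congrArg (fun K : Subgroup G => x⁻¹ * y ∈ K) hcs
      exact h2.mpr this
    obtain ⟨M, ⟨hMo, hNM⟩, hM⟩ := this
    have hMc : IsClosed (M : Set G) := M.isClosed_of_isOpen hMo
    -- This is the image of `xM`. Since `N ≤ M`, the condition does not depend on the lift `z`, so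
    -- the preimage in `G` is the clopen set `xM`.
    refine ⟨{c | ∀ z : G, QuotientGroup.mk z = c → x⁻¹ * z ∈ M}, ?_, ?_, ?_⟩
    · have hpre : (QuotientGroup.mk : G → G ⧸ N) ⁻¹'
          {c | ∀ z : G, QuotientGroup.mk z = c → x⁻¹ * z ∈ M} = {z | x⁻¹ * z ∈ M} := by
        ext z
        refine ⟨fun h => h z rfl, fun h z' hz' => ?_⟩
        have h1 : z'⁻¹ * z ∈ M := hNM (QuotientGroup.eq.mp hz')
        have h2 : x⁻¹ * z' = x⁻¹ * z * (z'⁻¹ * z)⁻¹ := by group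
        change x⁻¹ * z' ∈ M
        rw [h2]
        exact M.mul_mem h (M.inv_mem h1)
      rw [← (QuotientGroup.isQuotientMap_mk N).isClopen_preimage, hpre]
      have hc : Continuous fun z : G => x⁻¹ * z := continuous_const.mul continuous_id
      exact ⟨hMc.preimage hc, hMo.preimage hc⟩
    · intro z hz
      exact hNM (QuotientGroup.eq.mp hz.symm)
    · intro h
      exact hM (h y rfl)
  refine ⟨inferInstance, inferInstance, inferInstance, inferInstance, ?_⟩
  intro U hU hUo x
  obtain ⟨y, rfl⟩ := QuotientGroup.mk_surjective x
  obtain ⟨z, rfl⟩ := QuotientGroup.mk_surjective y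
  obtain ⟨k, hk⟩ := hG.isPGroup_quotient (U.comap (QuotientGroup.mk' N))
    (hUo.preimage QuotientGroup.continuous_mk) (QuotientGroup.mk z)
  refine ⟨k, ?_⟩
  rw [← QuotientGroup.mk_pow, QuotientGroup.eq_one_iff] at hk ⊢
  simpa using hk

/-- The quotient of a finitely presented pro-`p` group by the closed normal subgroup generated by
finitely many elements is finitely presented. -/
lemma IsFinPres.presented [Fact p.Prime] {G : Type} [Group G] [TopologicalSpace G] [IsTopologicalGroup G]
    (hG : IsFinPres p G) {R : Set G} (hR : R.Finite) : IsFinPres p (Presented R) := by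
  have hQ := hG.1.presented R
  obtain ⟨hG, n, π, R₀, hs, hk⟩ := hG
  have := hG.t2Space
  have := (FreeProP.isProP p (Fin n)).compactSpace
  have := (FreeProP.isProP p (Fin n)).t2Space
  have := hQ.t2Space
  classical
  -- The presentation of the quotient: the relators of `G` together with one chosen lift of each new
  -- relator.
  let R₁ : Finset (FreeProP p (Fin n)) := R₀ ∪ (hR.image (Function.surjInv hs)).toFinset
  have hR₁ : (R₁ : Set (FreeProP p (Fin n))) = (R₀ : Set _) ∪ Function.surjInv hs '' R := by
    simp [R₁]
  refine ⟨hQ, n, (Presented.mk R).comp π, R₁, (Presented.mk_surjective R).comp hs, ?_⟩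
  refine le_antisymm ?_ ?_
  · set M := (Subgroup.normalClosure (R₁ : Set (FreeProP p (Fin n)))).topologicalClosure with hM
    have hMc : IsClosed (M : Set (FreeProP p (Fin n))) := Subgroup.isClosed_topologicalClosure _
    have hkM : π.toMonoidHom.ker ≤ M := by
      rw [hk]
      refine Subgroup.topologicalClosure_mono (Subgroup.normalClosure_mono ?_)
      rw [hR₁]
      exact Set.subset_union_left
    have hMn : (M.map π.toMonoidHom).Normal := Subgroup.Normal.map inferInstance _ hs
    have hle : (Subgroup.normalClosure R).topologicalClosure ≤ M.map π.toMonoidHom := by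
      refine Subgroup.topologicalClosure_minimal _ (Subgroup.normalClosure_le_normal ?_) ?_
      · intro r hr
        refine ⟨Function.surjInv hs r, ?_, Function.surjInv_eq hs r⟩
        refine subset_closure (Subgroup.subset_normalClosure ?_)
        rw [hR₁]
        exact Or.inr ⟨r, hr, rfl⟩
      -- The image of the compact group `M` in the Hausdorff group `G` is closed, so it contains the
      -- closure of the normal subgroup generated by `R`.
      · exact (hMc.isCompact.image π.continuous_toFun).isClosed
    intro x hx
    have hx' : π x ∈ (Subgroup.normalClosure R).topologicalClosure :=
      (QuotientGroup.eq_one_iff _).mp hx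
    obtain ⟨y, hy, hyx⟩ := hle hx'
    -- An element of `M` with the same image as `x` differs from `x` by an element of the kernel of
    -- `π`, which already lies in `M`.
    have : y⁻¹ * x ∈ M := hkM (by
      change π (y⁻¹ * x) = 1
      rw [map_mul, map_inv, show π y = π x from hyx, inv_mul_cancel])
    simpa using M.mul_mem hy this
  · refine closure_le_ker _ _ fun r hr => ?_
    rw [hR₁] at hr
    change Presented.mk R (π r) = 1
    rcases hr with hr | ⟨s, hs', rfl⟩
    · have : π r = 1 := by
        have : r ∈ π.toMonoidHom.ker := by
          rw [hk]
          exact subset_closure (Subgroup.subset_normalClosure hr)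
        exact this
      rw [this, map_one]
    · rw [Function.surjInv_eq hs]
      exact Presented.mk_eq_one hs'

lemma Presented.exists_desc {G T : Type} [Group G] [TopologicalSpace G] [IsTopologicalGroup G]
    (hG : IsProP p G) [Group T] [TopologicalSpace T] [T1Space T] {R : Set G} (ψ : G →ₜ* T)
    (h : ∀ r ∈ R, ψ r = 1) : ∃ φ : Presented R →ₜ* T, ∀ x, φ (Presented.mk R x) = ψ x := by
  have := hG.compactSpace
  have := (hG.presented R).t2Space
  refine exists_factor _ (Presented.mk_surjective R) ψ ?_
  rw [Presented.ker_mk]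
  exact closure_le_ker ψ R h

/-- Finite coproducts of finitely presented pro-`p` groups with a free pro-`p` group of finite rank
exist. -/
lemma exists_freeProduct [Fact p.Prime] {I J : Type} [Finite I] [Finite J] (A : I → Type) [∀ i, Group (A i)]
    [∀ i, TopologicalSpace (A i)] (hA : ∀ i, IsFinPres p (A i)) :
    ∃ (G : Type) (_ : Group G) (_ : TopologicalSpace G) (_ : IsTopologicalGroup G)
      (ι : ∀ i, A i →ₜ* G) (t : J → G), IsFinPres p G ∧
      (∀ (T : Type) [Group T] [TopologicalSpace T], IsProP p T → ∀ (ι' : ∀ i, A i →ₜ* T) (t' : J → T),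
        ∃ w : G →ₜ* T, (∀ i a, w (ι i a) = ι' i a) ∧ ∀ j, w (t j) = t' j) ∧
      ∀ (T : Type) [Group T] [TopologicalSpace T] [T2Space T] (w w' : G →ₜ* T),
        (∀ i a, w (ι i a) = w' (ι i a)) → (∀ j, w (t j) = w' (t j)) → w = w' := by
  choose n π R hs hk using fun i => (hA i).2
  -- The generators are those of all the `A i` and one more for each `j : J`; the relators `S` below
  -- are those of the `A i`, carried over by the homomorphisms `k i`.
  let X : Type := (Σ i, Fin (n i)) ⊕ J
  have : Finite X := inferInstanceAs (Finite ((Σ i, Fin (n i)) ⊕ J))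
  obtain ⟨m, ⟨e⟩⟩ := Finite.exists_equiv_fin X
  let F := FreeProP p (Fin m)
  have hF := FreeProP.isProP p (Fin m)
  choose k hkg using fun i => FreeProP.exists_lift (X := Fin (n i)) hF
    (fun l => FreeProP.gen p (e (Sum.inl ⟨i, l⟩)))
  let S : Set F := ⋃ i, k i '' (R i : Set (FreeProP p (Fin (n i))))
  have hSf : S.Finite := Set.finite_iUnion fun i => (R i).finite_toSet.image _
  have hfp : IsFinPres p (Presented S) := (FreeProP.isFinPres p m).presented hSf
  have := hfp.1.t2Space
  have hι : ∀ i, ∃ φ : A i →ₜ* Presented S, ∀ x, φ (π i x) = Presented.mk S (k i x) := by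
    intro i
    have := (FreeProP.isProP p (Fin (n i))).compactSpace
    have := (hA i).1.t2Space
    refine exists_factor (π i) (hs i) ((Presented.mk S).comp (k i)) ?_
    rw [hk i]
    refine closure_le_ker _ _ fun r hr => Presented.mk_eq_one ?_
    exact Set.mem_iUnion.mpr ⟨i, r, hr, rfl⟩
  choose ι hι using hι
  refine ⟨Presented S, inferInstance, inferInstance, inferInstance, ι,
    fun j => Presented.mk S (FreeProP.gen p (e (Sum.inr j))), hfp, ?_, ?_⟩
  · intro T _ _ hT ι' t'
    have := hT.t2Space
    obtain ⟨ψ, hψ⟩ := FreeProP.exists_lift hT fun y : Fin m =>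
      Sum.elim (fun z : Σ i, Fin (n i) => ι' z.1 (π z.1 (FreeProP.gen p z.2))) t' (e.symm y)
    -- Both sides are continuous homomorphisms on a free pro-`p` group, so agreement on generators
    -- suffices. Hence `ψ` kills the transported relators.
    have hψk : ∀ i x, ψ (k i x) = ι' i (π i x) := by
      intro i x
      have : ψ.comp (k i) = (ι' i).comp (π i) := FreeProP.hom_ext fun l => by
        change ψ (k i _) = ι' i (π i _)
        rw [hkg, hψ, Equiv.symm_apply_apply]
        rfl
      exact DFunLike.congr_fun this x
    obtain ⟨w, hw⟩ := Presented.exists_desc hF (R := S) ψ (by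
      intro r hr
      obtain ⟨i, r, hri, rfl⟩ := Set.mem_iUnion.mp hr
      rw [hψk]
      have : r ∈ (π i).toMonoidHom.ker := by
        rw [hk]
        exact subset_closure (Subgroup.subset_normalClosure hri)
      rw [show π i r = 1 from this, map_one])
    refine ⟨w, fun i a => ?_, fun j => ?_⟩
    · obtain ⟨x, rfl⟩ := hs i a
      rw [hι, hw, hψk]
    · rw [hw, hψ, Equiv.symm_apply_apply]
      rfl
  · intro T _ _ _ w w' h1 h2
    have : w.comp (Presented.mk S) = w'.comp (Presented.mk S) := FreeProP.hom_ext fun y => by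
      change w (Presented.mk S _) = w' (Presented.mk S _)
      obtain ⟨x, rfl⟩ := e.surjective y
      rcases x with ⟨i, l⟩ | j
      · rw [← hkg, ← hι, h1]
      · exact h2 j
    refine DFunLike.ext _ _ fun x => ?_
    obtain ⟨y, rfl⟩ := Presented.mk_surjective S x
    exact DFunLike.congr_fun this y

/-- A finite `p`-group is a finitely presented pro-`p` group. -/
lemma isFinPres_of_finite [Fact p.Prime] {Γ : Type} [Group Γ] [Finite Γ] [TopologicalSpace Γ] [DiscreteTopology Γ]
    (hΓ : IsPGroup p Γ) : IsFinPres p Γ := by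
  have hpro : IsProP p Γ := ⟨inferInstance, inferInstance, inferInstance, inferInstance,
    fun U _ _ => hΓ.to_quotient U⟩
  obtain ⟨n, ⟨e⟩⟩ := Finite.exists_equiv_fin Γ
  obtain ⟨π, hπ⟩ := FreeProP.exists_lift hpro e.symm
  let f : FreeGroup (Fin n) →* Γ := π.toMonoidHom.comp (FreeProP.ofFree p (Fin n))
  -- A subgroup of finite index in a finitely generated group is finitely generated. Its generators
  -- provide the finitely many relators.
  have hfg : f.ker.FG := by
    have : Finite (FreeGroup (Fin n) ⧸ f.ker) :=
      Finite.of_injective _ (QuotientGroup.kerLift_injective f)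
    have : f.ker.FiniteIndex := Subgroup.finiteIndex_of_finite_quotient
    exact (Group.fg_iff_subgroup_fg _).mp (Subgroup.fg_of_index_ne_zero f.ker)
  obtain ⟨S, hS⟩ := hfg
  classical
  refine ⟨hpro, n, π, S.image (FreeProP.ofFree p (Fin n)), ?_, le_antisymm ?_ ?_⟩
  · intro γ
    exact ⟨FreeProP.gen p (e γ), by rw [hπ, Equiv.symm_apply_apply]⟩
  · intro x hx
    refine mem_closure_iff.mpr fun V hV hxV => ?_
    -- As `Γ` is discrete, the kernel of `π` is open. Elements of the dense free group that
    -- approximate `x` can thus be taken in `f.ker`, where they are products of the chosen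
    -- generators and their inverses.
    have hK : IsOpen (π.toMonoidHom.ker : Set (FreeProP p (Fin n))) :=
      (isOpen_discrete ({1} : Set Γ)).preimage π.continuous_toFun
    obtain ⟨_, ⟨hwV, hwK⟩, ⟨w, rfl⟩⟩ := mem_closure_iff.mp
      (FreeProP.denseRange_ofFree p (Fin n) x) _ (hV.inter hK) ⟨hxV, hx⟩
    refine ⟨_, hwV, ?_⟩
    have hw : w ∈ f.ker := hwK
    rw [← hS] at hw
    have h2 : Subgroup.closure (S : Set (FreeGroup (Fin n))) ≤
        (Subgroup.normalClosure ((S.image (FreeProP.ofFree p (Fin n)) : Finset _) :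
          Set (FreeProP p (Fin n)))).comap (FreeProP.ofFree p (Fin n)) := by
      rw [Subgroup.closure_le]
      intro s hs
      exact Subgroup.subset_normalClosure (by simpa using ⟨s, hs, rfl⟩)
    exact h2 hw
  · refine closure_le_ker _ _ fun r hr => ?_
    simp only [Finset.coe_image] at hr
    obtain ⟨s, hs, rfl⟩ := hr
    have : s ∈ f.ker := hS ▸ Subgroup.subset_closure hs
    exact this

end ProPGroups

end ProPDW
end

open CategoryTheory MonoidalCategory

noncomputable section

namespace ProPDW

/-! ### Natural transformations between functors on topological groupoids -/

section NatTrans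

namespace ContFunctor

variable {𝔊 ℌ 𝔎 𝔏 : TopGrpd}

lemma hom_ext {F G : ContFunctor 𝔊 ℌ} {a b : F ⟶ G}
    (h : ∀ x, NatTrans.app a x = NatTrans.app b x) : a = b :=
  NatTrans.ext (funext h)

lemma naturality {F G : ContFunctor 𝔊 ℌ} (a : F ⟶ G) {x y : 𝔊.Obj} (f : x ⟶ y) :
    F.toFunctor.map f ≫ NatTrans.app a y = NatTrans.app a x ≫ G.toFunctor.map f :=
  NatTrans.naturality a f

@[simp]
lemma hom_inv_app {F G : ContFunctor 𝔊 ℌ} (e : F ≅ G) (x : 𝔊.Obj) :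
    NatTrans.app e.hom x ≫ NatTrans.app e.inv x = 𝟙 _ :=
  congrArg (fun a : F ⟶ F => NatTrans.app a x) e.hom_inv_id

@[simp]
lemma inv_hom_app {F G : ContFunctor 𝔊 ℌ} (e : F ≅ G) (x : 𝔊.Obj) :
    NatTrans.app e.inv x ≫ NatTrans.app e.hom x = 𝟙 _ :=
  congrArg (fun a : G ⟶ G => NatTrans.app a x) e.inv_hom_id

/-- All natural transformations between functors of groupoids are invertible. -/
def homIso {F G : ContFunctor 𝔊 ℌ} (a : F ⟶ G) : F ≅ G :=
  have : ∀ x, IsIso (NatTrans.app (F := F.toFunctor) (G := G.toFunctor) a x) :=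
    fun _ => IsIso.of_groupoid _
  mkIso (NatIso.ofComponents (fun x => asIso (NatTrans.app (F := F.toFunctor) (G := G.toFunctor) a x))
    fun f => NatTrans.naturality (F := F.toFunctor) (G := G.toFunctor) a f)

/-- A path from the chosen representative of the component of `x` to `x`. -/
def path (x : 𝔊.Obj) : (Quotient.mk (isIsomorphicSetoid 𝔊.Obj) x).out ⟶ x :=
  (Quotient.mk_out (s := isIsomorphicSetoid 𝔊.Obj) x).some.hom

/-- Naturality along `path x` determines the value at `x` from the value at the representative of
its component, since the image of the path is invertible. -/
lemma hom_ext_out {F G : ContFunctor 𝔊 ℌ} {a b : F ⟶ G}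
    (h : ∀ c : Pi0 𝔊.Obj, NatTrans.app a c.out = NatTrans.app b c.out) : a = b := by
  refine hom_ext fun x => ?_
  have ha := naturality a (path x)
  have hb := naturality b (path x)
  rw [h, ← hb] at ha
  have := IsIso.of_groupoid (F.toFunctor.map (path x))
  exact (cancel_epi _).mp ha

/-- A natural transformation can be constructed from its values at representatives of the
components. -/
lemma exists_hom_of_loops (F G : ContFunctor 𝔊 ℌ)
    (θ : ∀ c : Pi0 𝔊.Obj, F.toFunctor.obj c.out ⟶ G.toFunctor.obj c.out)
    (hθ : ∀ (c : Pi0 𝔊.Obj) (a : c.out ⟶ c.out),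
      F.toFunctor.map a ≫ θ c = θ c ≫ G.toFunctor.map a) :
    ∃ α : F ⟶ G, ∀ c : Pi0 𝔊.Obj, NatTrans.app α c.out = θ c := by
  -- The component of `c.out` equals `c` only propositionally. Allowing two equal components makes
  -- the loop condition applicable to morphisms between their representatives.
  have key : ∀ (c c' : Pi0 𝔊.Obj) (_ : c = c') (a : c.out ⟶ c'.out),
      F.toFunctor.map a ≫ θ c' = θ c ≫ G.toFunctor.map a := by
    rintro c _ rfl a
    exact hθ c a
  have hi : ∀ {x y : 𝔊.Obj} (f : x ⟶ y), IsIso f := fun f => IsIso.of_groupoid f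
  refine ⟨({ app := fun x => inv (F.toFunctor.map (path x)) ≫ θ _ ≫ G.toFunctor.map (path x)
             naturality := ?_ } : F.toFunctor ⟶ G.toFunctor), ?_⟩
  · intro x y f
    have h := key _ _ (Quotient.sound ⟨asIso f⟩) (path x ≫ f ≫ inv (path y))
    simp only [Functor.map_comp, Functor.map_inv, Category.assoc] at h
    rw [← cancel_epi (F.toFunctor.map (path x)), Category.assoc, IsIso.hom_inv_id_assoc,
      reassoc_of% h]
    simp
  · intro c
    have h := key _ _ (Quotient.out_eq c) (path c.out)
    change inv (F.toFunctor.map (path c.out)) ≫ θ _ ≫ G.toFunctor.map (path c.out) = θ c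
    rw [← h, IsIso.inv_hom_id_assoc]

lemma IsEquiv.isEquivalence {E : ContFunctor 𝔊 ℌ} (hE : E.IsEquiv) :
    E.toFunctor.IsEquivalence := by
  obtain ⟨E', ⟨a⟩, ⟨b⟩⟩ := hE
  exact (CategoryTheory.Equivalence.mk E.toFunctor E'.toFunctor (toNatIso a).symm
    (toNatIso b)).isEquivalence_functor

lemma IsEquiv.symm {E : ContFunctor 𝔊 ℌ} (hE : E.IsEquiv) :
    ∃ E' : ContFunctor ℌ 𝔊, E'.IsEquiv ∧ Nonempty (E.comp E' ≅ id 𝔊) ∧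
      Nonempty (E'.comp E ≅ id ℌ) := by
  obtain ⟨E', a, b⟩ := hE
  exact ⟨E', ⟨E, b, a⟩, a, b⟩

/-- Restriction along an equivalence is fully faithful. -/
lemma IsEquiv.exists_hom {E : ContFunctor 𝔊 ℌ} (hE : E.IsEquiv) {F G : ContFunctor ℌ 𝔎}
    (a : E.comp F ⟶ E.comp G) :
    ∃ b : F ⟶ G, ∀ x, NatTrans.app b (E.toFunctor.obj x) = NatTrans.app a x := by
  have := hE.isEquivalence
  obtain ⟨b, hb⟩ := ((Functor.whiskeringLeft 𝔊.Obj ℌ.Obj 𝔎.Obj).obj E.toFunctor).map_surjective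
    (X := F.toFunctor) (Y := G.toFunctor) a
  exact ⟨b, fun x => congrArg (fun t : E.toFunctor ⋙ F.toFunctor ⟶ E.toFunctor ⋙ G.toFunctor =>
    NatTrans.app t x) hb⟩

lemma IsEquiv.hom_ext {E : ContFunctor 𝔊 ℌ} (hE : E.IsEquiv) {F G : ContFunctor ℌ 𝔎}
    {a b : F ⟶ G} (h : ∀ x, NatTrans.app a (E.toFunctor.obj x) =
      NatTrans.app b (E.toFunctor.obj x)) : a = b := by
  have := hE.isEquivalence
  refine ((Functor.whiskeringLeft 𝔊.Obj ℌ.Obj 𝔎.Obj).obj E.toFunctor).map_injective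
    (X := F.toFunctor) (Y := G.toFunctor) ?_
  exact NatTrans.ext (funext h)

/-- A fully faithful, essentially surjective functor which induces the topologies is an
equivalence. -/
lemma isEquiv_of_isEquivalence (F : ContFunctor 𝔊 ℌ) [F.toFunctor.IsEquivalence]
    (hF : ∀ x y : 𝔊.Obj, Topology.IsInducing fun f : x ⟶ y => F.toFunctor.map f) : F.IsEquiv := by
  refine ⟨⟨F.toFunctor.inv, fun x y => ?_⟩, ⟨mkIso F.toFunctor.asEquivalence.unitIso.symm⟩,
    ⟨mkIso F.toFunctor.asEquivalence.counitIso⟩⟩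
  rw [(hF _ _).continuous_iff]
  -- After applying `F`, the inverse functor becomes composition with the counit and its inverse,
  -- which is continuous. As `F` induces the topologies, the inverse functor is continuous.
  have h : ((fun f => F.toFunctor.map f) ∘ fun f : x ⟶ y => F.toFunctor.inv.map f) = fun f =>
      F.toFunctor.asEquivalence.counit.app x ≫ f ≫ F.toFunctor.asEquivalence.counitInv.app y :=
    funext fun f => F.toFunctor.fun_inv_map _ _ f
  rw [h]
  have h1 : Continuous fun f : x ⟶ y => f ≫ F.toFunctor.asEquivalence.counitInv.app y :=
    (ℌ.continuous_comp _ _ _).comp (continuous_id.prodMk continuous_const)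
  exact (ℌ.continuous_comp _ _ _).comp (continuous_const.prodMk h1)

end ContFunctor

end NatTrans

/-! ### Functors out of `∐ BNᵢ`, skeleta -/

section Fam

variable {I : Type} {N : I → Type} [∀ i, Group (N i)] [∀ i, TopologicalSpace (N i)]
  [∀ i, IsTopologicalGroup (N i)]

variable (N) in
/-- The objects of `∐ BNᵢ`. -/
def famPt (i : I) : (TopGrpd.fam N).Obj := FamObj.mk i

/-- An element of `Nᵢ`, as an automorphism in `∐ BNᵢ`. -/
def famLoop (i : I) (a : N i) : famPt N i ⟶ famPt N i := ⟨a, rfl⟩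

/-- The morphism in `∐ BNᵢ` between equal objects. -/
def famEq {i j : I} (h : i = j) : famPt N i ⟶ famPt N j := ⟨1, congrArg FamObj.mk h⟩

lemma famLoop_mul (i : I) (a b : N i) : famLoop i (a * b) = famLoop i b ≫ famLoop i a := rfl

/-- The functor `∐ BNᵢ ⥤ 𝔗` given by objects `oᵢ` and homomorphisms `Nᵢ → Aut(oᵢ)`. -/
def famDesc {𝔗 : TopGrpd} (o : I → 𝔗.Obj) (h : ∀ i, N i →ₜ* End (o i)) :
    ContFunctor (TopGrpd.fam N) 𝔗 where
  toFunctor :=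
    { obj := fun i => o i.idx
      map := fun {i j} f => (h i.idx f.1 : o i.idx ⟶ o i.idx) ≫
        eqToHom (congrArg (fun k : FamObj N => o k.idx) f.2)
      map_id := fun i => by
        have : (h i.idx (1 : N i.idx) : o i.idx ⟶ o i.idx) = 𝟙 _ := map_one (h i.idx)
        exact (Category.comp_id _).trans this
      map_comp := fun {i j k} f g => by
        obtain ⟨f, rfl⟩ := f
        obtain ⟨g, rfl⟩ := g
        have : (h i.idx (g * f) : o i.idx ⟶ o i.idx) =
            (h i.idx f : o i.idx ⟶ o i.idx) ≫ (h i.idx g : o i.idx ⟶ o i.idx) :=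
          map_mul (h i.idx) g f
        change (h i.idx (g * f) : o i.idx ⟶ o i.idx) ≫ 𝟙 _ =
          ((h i.idx f : o i.idx ⟶ o i.idx) ≫ 𝟙 _) ≫ ((h i.idx g : o i.idx ⟶ o i.idx) ≫ 𝟙 _)
        rw [this]
        simp only [Category.comp_id] }
  continuous_map i j := by
    by_cases hij : i = j
    · cases hij
      exact (𝔗.continuous_comp _ _ _).comp
        (((h i.idx).continuous_toFun.comp continuous_subtype_val).prodMk continuous_const)
    · exact continuous_of_false _ _ (fun q => hij q.2) _

lemma famDesc_loop {𝔗 : TopGrpd} (o : I → 𝔗.Obj) (h : ∀ i, N i →ₜ* End (o i)) (i : I) (a : N i) :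
    (famDesc o h).toFunctor.map (famLoop i a) = (h i a : o i ⟶ o i) := Category.comp_id _

/-- A natural transformation out of `∐ BNᵢ` is given by a family of morphisms commuting with the
loops. -/
lemma exists_hom_fam {𝔗 : TopGrpd} (F G : ContFunctor (TopGrpd.fam N) 𝔗)
    (θ : ∀ i : I, F.toFunctor.obj (famPt N i) ⟶ G.toFunctor.obj (famPt N i))
    (hθ : ∀ (i : I) (a : N i), F.toFunctor.map (famLoop i a) ≫ θ i =
      θ i ≫ G.toFunctor.map (famLoop i a)) :
    ∃ α : F ⟶ G, ∀ i : I, NatTrans.app α (famPt N i) = θ i := by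
  refine ⟨({ app := fun i => θ i.idx, naturality := ?_ } : F.toFunctor ⟶ G.toFunctor),
    fun i => rfl⟩
  rintro ⟨i⟩ j ⟨a, rfl⟩
  exact hθ i a

end Fam

section Skeleton

variable {p : ℕ}

instance (𝔐 : PGrpd p) (x : 𝔐.Obj) : IsTopologicalGroup (End x) :=
  (𝔐.isFinPres_end x).1.isTopologicalGroup

/-- The skeleton of a pro-`p` groupoid: the coproduct of the classifying groupoids of the
automorphism groups of representatives of the components. -/
def PGrpd.skel (𝔐 : PGrpd p) : PGrpd p :=
  haveI := 𝔐.finite_pi0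
  PGrpd.fam (fun c : Pi0 𝔐.Obj => End c.out) fun c => 𝔐.isFinPres_end c.out

/-- The inclusion of the skeleton. -/
def PGrpd.skelFun (𝔐 : PGrpd p) : 𝔐.skel.Fun 𝔐 :=
  famDesc (fun c : Pi0 𝔐.Obj => c.out) fun _ => ContinuousMonoidHom.id _

/-- On automorphism groups this functor is the identity, and morphisms between distinct
representatives do not exist. It is therefore fully faithful and induces the topologies, so that its
algebraic inverse is continuous as well. -/
lemma PGrpd.isEquiv_skelFun (𝔐 : PGrpd p) : 𝔐.skelFun.IsEquiv := by
  have hloop : ∀ (c : Pi0 𝔐.Obj) (a : End c.out),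
      𝔐.skelFun.toFunctor.map (famLoop (N := fun c : Pi0 𝔐.Obj => End c.out) c a) = a :=
    fun c a => famDesc_loop (N := fun c : Pi0 𝔐.Obj => End c.out) (fun c : Pi0 𝔐.Obj => c.out)
      (fun _ => ContinuousMonoidHom.id _) c a
  have hfaith : 𝔐.skelFun.toFunctor.Faithful := ⟨by
    rintro ⟨c⟩ _ ⟨a, rfl⟩ ⟨b, hb⟩ hab
    exact Subtype.ext ((hloop c a).symm.trans (hab.trans (hloop c b)))⟩
  have hfull : 𝔐.skelFun.toFunctor.Full := ⟨by
    rintro ⟨c⟩ ⟨d⟩ a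
    have hcd : c = d := by
      rw [← Quotient.out_eq c, ← Quotient.out_eq d]
      exact Quotient.sound ⟨(Groupoid.isoEquivHom c.out d.out).symm a⟩
    subst hcd
    exact ⟨famLoop (N := fun c : Pi0 𝔐.Obj => End c.out) c a, hloop c a⟩⟩
  have hess : 𝔐.skelFun.toFunctor.EssSurj := ⟨fun x =>
    ⟨⟨Quotient.mk _ x⟩, Quotient.mk_out (s := isIsomorphicSetoid 𝔐.Obj) x⟩⟩
  have : 𝔐.skelFun.toFunctor.IsEquivalence := {}
  refine ContFunctor.isEquiv_of_isEquivalence _ ?_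
  rintro x y
  by_cases h : x = y
  · subst h
    have : (fun f : x ⟶ x => 𝔐.skelFun.toFunctor.map f) =
        fun f : x ⟶ x => (Subtype.val f : End x.idx.out) := funext fun f => hloop x.idx f.1
    exact (congrArg Topology.IsInducing this).mpr Topology.IsInducing.subtypeVal
  · have : IsEmpty (x ⟶ y) := ⟨fun f => h f.2⟩
    exact Topology.IsInducing.of_subsingleton _

end Skeleton

end ProPDW
end

open CategoryTheory MonoidalCategory

noncomputable section

namespace ProPDW

/-! ### Fundamental groups of finite graphs of pro-`p` groups -/

section GraphGroup

/-- Edge paths, from the vertex `v`, in the graph with vertices `I` and edges `J`. -/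
inductive GPath {I J : Type} (src tgt : J → I) (v : I) : I → Type
  | nil : GPath src tgt v v
  | fwd (s : J) (q : GPath src tgt v (src s)) : GPath src tgt v (tgt s)
  | bwd (s : J) (q : GPath src tgt v (tgt s)) : GPath src tgt v (src s)

namespace GPath

variable {I J : Type} {src tgt : J → I} {v : I}

/-- The composite along a path of morphisms of a groupoid attached to the edges. -/
def eval {C : Type} [Groupoid.{0} C] (o : I → C) (η : ∀ s, o (src s) ⟶ o (tgt s)) :
    ∀ {i : I}, GPath src tgt v i → (o v ⟶ o i)
  | _, nil => 𝟙 _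
  | _, fwd s q => eval o η q ≫ η s
  | _, bwd s q => eval o η q ≫ inv (η s)

/-- The product along a path of elements of a group attached to the edges. -/
def prod {G : Type} [Group G] (t : J → G) : ∀ {i : I}, GPath src tgt v i → G
  | _, nil => 1
  | _, fwd s q => t s * prod t q
  | _, bwd s q => (t s)⁻¹ * prod t q

lemma map_prod {G H : Type} [Group G] [Group H] (w : G →* H) (t : J → G) {i : I}
    (q : GPath src tgt v i) : w (q.prod t) = q.prod fun s => w (t s) := by
  induction q with
  | nil => exact map_one w
  | fwd s q ih => rw [prod, prod, map_mul, ih]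
  | bwd s q ih => rw [prod, prod, map_mul, map_inv, ih]

/-- The conjugated edges telescope along a path. Multiplication in `End x` is composition in the
opposite order, which is why `GPath.prod` multiplies each new edge on the left. -/
lemma prod_conj {C : Type} [Groupoid.{0} C] (o : I → C) (η : ∀ s, o (src s) ⟶ o (tgt s)) {x : C}
    (ε : ∀ i, x ⟶ o i) {i : I} (q : GPath src tgt v i) :
    q.prod (G := End x) (fun s => ε (src s) ≫ η s ≫ inv (ε (tgt s))) =
      ε v ≫ q.eval o η ≫ inv (ε i) := by
  induction q with
  | nil => simp [prod, eval, End.one_def]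
  | fwd s q ih =>
    rw [prod, ih]
    change (ε v ≫ q.eval o η ≫ inv (ε (src s))) ≫ ε (src s) ≫ η s ≫ inv (ε (tgt s)) = _
    simp [eval]
  | bwd s q ih =>
    rw [prod, ih, eval, inv_mul_eq_iff_eq_mul]
    change _ = (ε v ≫ (q.eval o η ≫ inv (η s)) ≫ inv (ε (src s))) ≫
      ε (src s) ≫ η s ≫ inv (ε (tgt s))
    simp

/-- Intertwining relations compose along edges and can be inverted. Paths whose products are
identified in the group will later force the values of `b` at their end points to coincide. -/
lemma prod_intertwine {C G : Type} [Groupoid.{0} C] [Group G] {x y : C} (w : G →* End x)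
    (w' : G →* End y) (t : J → G) (b : I → (x ⟶ y))
    (h : ∀ s, (w (t s) : x ⟶ x) ≫ b (tgt s) = b (src s) ≫ (w' (t s) : y ⟶ y)) {i : I}
    (q : GPath src tgt v i) :
    (w (q.prod t) : x ⟶ x) ≫ b i = b v ≫ (w' (q.prod t) : y ⟶ y) := by
  induction q with
  | nil => simp [prod, End.one_def]
  | fwd s q ih => simp [prod, End.mul_def, h, reassoc_of% ih]
  | bwd s q ih =>
    have h1 : (w (t s)⁻¹ : x ⟶ x) ≫ b (src s) = b (tgt s) ≫ (w' (t s)⁻¹ : y ⟶ y) := by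
      have e1 : (w (t s)⁻¹ : x ⟶ x) ≫ (w (t s) : x ⟶ x) = 𝟙 x := by
        rw [← End.mul_def, ← map_mul, mul_inv_cancel, map_one, End.one_def]
      have e2 : (w' (t s) : y ⟶ y) ≫ (w' (t s)⁻¹ : y ⟶ y) = 𝟙 y := by
        rw [← End.mul_def, ← map_mul, inv_mul_cancel, map_one, End.one_def]
      calc (w (t s)⁻¹ : x ⟶ x) ≫ b (src s)
          = (w (t s)⁻¹ : x ⟶ x) ≫ (b (src s) ≫ (w' (t s) : y ⟶ y)) ≫ (w' (t s)⁻¹ : y ⟶ y) := by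
            rw [Category.assoc, e2, Category.comp_id]
        _ = _ := by rw [← h, Category.assoc, reassoc_of% e1]
    rw [prod, map_mul, End.mul_def, Category.assoc, h1, ← Category.assoc, ih, map_mul, End.mul_def,
      Category.assoc]

end GPath

/-- The fundamental group of a finite connected graph of finitely presented pro-`p` groups with
base point `v`. -/
lemma exists_graphGroup {p : ℕ} [Fact p.Prime] {I J : Type} [Finite I] [Finite J] (A : I → Type)
    [∀ i, Group (A i)] [∀ i, TopologicalSpace (A i)] (hA : ∀ i, IsFinPres p (A i))
    (src tgt : J → I) (rel : ∀ s, Set (A (src s) × A (tgt s))) (hrel : ∀ s, (rel s).Finite)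
    (v : I) (γ : ∀ i, GPath src tgt v i) :
    ∃ (P : Type) (_ : Group P) (_ : TopologicalSpace P) (_ : IsTopologicalGroup P)
      (ι : ∀ i, A i →ₜ* P) (t : J → P), IsFinPres p P ∧
      (∀ s, ∀ r ∈ rel s, t s * ι _ r.1 = ι _ r.2 * t s) ∧
      (∀ i, (γ i).prod t = (γ v).prod t) ∧
      (∀ (T : Type) [Group T] [TopologicalSpace T], IsProP p T →
        ∀ (ι' : ∀ i, A i →ₜ* T) (t' : J → T),
          (∀ s, ∀ r ∈ rel s, t' s * ι' _ r.1 = ι' _ r.2 * t' s) →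
          (∀ i, (γ i).prod t' = (γ v).prod t') →
          ∃ w : P →ₜ* T, (∀ i a, w (ι i a) = ι' i a) ∧ ∀ j, w (t j) = t' j) ∧
      ∀ (T : Type) [Group T] [TopologicalSpace T] [T2Space T] (w w' : P →ₜ* T),
        (∀ i a, w (ι i a) = w' (ι i a)) → (∀ j, w (t j) = w' (t j)) → w = w' := by
  obtain ⟨G, _, _, _, ι, t, hG, hex, hun⟩ := exists_freeProduct (p := p) (J := J) A hA
  -- The first relators identify the two images of the edge group up to the stable letter `t s`. The
  -- others equalise the products along the chosen paths and play the role of a maximal tree; the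
  -- comparison is with the product along `γ v` and not with `1`, since `γ v` may be a nontrivial
  -- loop.
  let R : Set G := (⋃ s, (fun r : A (src s) × A (tgt s) => (ι _ r.2 * t s)⁻¹ * (t s * ι _ r.1)) ''
    rel s) ∪ Set.range fun i => ((γ v).prod t)⁻¹ * (γ i).prod t
  have hR : R.Finite := (Set.finite_iUnion fun s => (hrel s).image _).union (Set.finite_range _)
  have hmk : ∀ a b : G, a⁻¹ * b ∈ R → Presented.mk R b = Presented.mk R a := fun a b h => by
    have := Presented.mk_eq_one h
    rw [map_mul, map_inv, inv_mul_eq_one] at this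
    exact this.symm
  refine ⟨Presented R, inferInstance, inferInstance, inferInstance,
    fun i => (Presented.mk R).comp (ι i), fun s => Presented.mk R (t s), hG.presented hR, ?_, ?_,
    ?_, ?_⟩
  · intro s r hr
    have := hmk (ι _ r.2 * t s) (t s * ι _ r.1) (Or.inl (Set.mem_iUnion.mpr ⟨s, r, hr, rfl⟩))
    rwa [map_mul, map_mul] at this
  · intro i
    have := hmk ((γ v).prod t) ((γ i).prod t) (Or.inr ⟨i, rfl⟩)
    exact (GPath.map_prod (Presented.mk R).toMonoidHom t (γ i)).symm.trans
      (this.trans (GPath.map_prod (Presented.mk R).toMonoidHom t (γ v)))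
  · intro T _ _ hT ι' t' h1 h2
    have := hT.t2Space
    obtain ⟨w, hw1, hw2⟩ := hex T hT ι' t'
    obtain ⟨w', hw'⟩ := Presented.exists_desc hG.1 (R := R) w (by
      rintro _ (hr | ⟨i, rfl⟩)
      · obtain ⟨s, r, hrs, rfl⟩ := Set.mem_iUnion.mp hr
        simp only [map_mul, map_inv, hw1, hw2]
        rw [inv_mul_eq_one, h1 s r hrs]
      · simp only [map_mul, map_inv]
        have h3 : ∀ i, w ((γ i).prod t) = (γ i).prod t' := fun i =>
          (GPath.map_prod w.toMonoidHom t (γ i)).trans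
            (congrArg (fun t' => (γ i).prod t') (funext hw2))
        rw [h3, h3, h2 i, inv_mul_cancel])
    exact ⟨w', fun i a => (hw' _).trans (hw1 i a), fun j => (hw' _).trans (hw2 j)⟩
  · intro T _ _ _ w w' h1 h2
    have := hun T (w.comp (Presented.mk R)) (w'.comp (Presented.mk R)) h1 h2
    refine DFunLike.ext _ _ fun x => ?_
    obtain ⟨y, rfl⟩ := Presented.mk_surjective R x
    exact DFunLike.congr_fun this y

end GraphGroup

/-! ### Homotopy coequalizers -/

section HCoeq

variable {p : ℕ}

/-- `𝔓` is a homotopy coequalizer of the functors `f, g : 𝔖 ⥤ 𝔐`. -/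
structure IsHCoeq {𝔖 𝔐 𝔓 : PGrpd p} (f g : 𝔖.Fun 𝔐) (q : 𝔐.Fun 𝔓)
    (θ : f.comp q ≅ g.comp q) : Prop where
  exists_desc : ∀ (𝔗 : PGrpd p) (u : 𝔐.Fun 𝔗) (η : f.comp u ≅ g.comp u),
    ∃ (w : 𝔓.Fun 𝔗) (a : q.comp w ≅ u), ∀ x : 𝔖.Obj,
      w.toFunctor.map (NatTrans.app θ.hom x) ≫ NatTrans.app a.hom (g.toFunctor.obj x) =
        NatTrans.app a.hom (f.toFunctor.obj x) ≫ NatTrans.app η.hom x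
  existsUnique_hom : ∀ (𝔗 : PGrpd p) (w w' : 𝔓.Fun 𝔗) (a : q.comp w ⟶ q.comp w'),
    (∀ x : 𝔖.Obj,
      w.toFunctor.map (NatTrans.app θ.hom x) ≫ NatTrans.app a (g.toFunctor.obj x) =
        NatTrans.app a (f.toFunctor.obj x) ≫ w'.toFunctor.map (NatTrans.app θ.hom x)) →
    ∃! c : w ⟶ w', ∀ k : 𝔐.Obj, NatTrans.app c (q.toFunctor.obj k) = NatTrans.app a k

/-- The homomorphism on automorphism groups induced by a functor. -/
def ContFunctor.mapEnd {𝔊 ℌ : TopGrpd} (F : ContFunctor 𝔊 ℌ) (x : 𝔊.Obj) :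
    End x →ₜ* End (F.toFunctor.obj x) where
  toFun a := F.toFunctor.map a
  map_one' := F.toFunctor.map_id x
  map_mul' a b := F.toFunctor.map_comp b a
  continuous_toFun := F.continuous_map x x

/-- Transport of automorphisms along a morphism. -/
def TopGrpd.conjEnd (𝔊 : TopGrpd) {x y : 𝔊.Obj} (ε : x ⟶ y) : End y →ₜ* End x where
  toFun a := ε ≫ (a : y ⟶ y) ≫ inv ε
  map_one' := by simp [End.one_def]
  map_mul' a b := by simp [End.mul_def]
  continuous_toFun := by
    have h1 : Continuous fun f : y ⟶ y => f ≫ inv ε :=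
      (𝔊.continuous_comp _ _ _).comp (continuous_id.prodMk continuous_const)
    exact (𝔊.continuous_comp _ _ _).comp (continuous_const.prodMk h1)

/-- The identification of `Nᵢ` with an automorphism group of `∐ BNᵢ`. -/
def famEnd {I : Type} (N : I → Type) [∀ i, Group (N i)] [∀ i, TopologicalSpace (N i)]
    [∀ i, IsTopologicalGroup (N i)] (i : I) : N i →ₜ* End (famPt N i) where
  toFun a := famLoop i a
  map_one' := rfl
  map_mul' _ _ := rfl
  continuous_toFun := Continuous.subtype_mk continuous_id _

/-- The inverse of `famEnd`. -/
def famEndInv {I : Type} (N : I → Type) [∀ i, Group (N i)] [∀ i, TopologicalSpace (N i)]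
    [∀ i, IsTopologicalGroup (N i)] (x : (TopGrpd.fam N).Obj) : End x →ₜ* N x.idx where
  toFun a := a.1
  map_one' := rfl
  map_mul' _ _ := rfl
  continuous_toFun := continuous_subtype_val

lemma famEq_trans {I : Type} {N : I → Type} [∀ i, Group (N i)] [∀ i, TopologicalSpace (N i)]
    [∀ i, IsTopologicalGroup (N i)] {i j k : I} (h : i = j) (h' : j = k) :
    famEq (N := N) h ≫ famEq h' = famEq (h.trans h') := by
  subst h h'
  exact Category.id_comp _

lemma conj_comp_self {C : Type} [Groupoid.{0} C] {x y : C} (ε : x ⟶ y) (m : y ⟶ y) :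
    (ε ≫ m ≫ inv ε) ≫ ε = ε ≫ m := by simp

lemma comp_eq_of_comp_eq {C : Type} [Category.{0} C] {x y z x' y' z' : C} {a : x ⟶ y}
    {b : y ⟶ z} {c : z ⟶ z'} {a' : x ⟶ x'} {b' : x' ⟶ y'} {d : y' ⟶ z'} {e : z' ⟶ y'}
    (h : (a ≫ b) ≫ c = a' ≫ b' ≫ d) (hde : d ≫ e = 𝟙 _) : a ≫ b ≫ c ≫ e = a' ≫ b' := by
  have := congrArg (fun t => t ≫ e) h
  simpa [hde] using this

/-- Homotopy coequalizers exist in the skeletal case. -/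
lemma exists_hcoeq_fam [Fact p.Prime] {I : Type} [Finite I] (A : I → Type) [∀ i, Group (A i)]
    [∀ i, TopologicalSpace (A i)] [∀ i, IsTopologicalGroup (A i)] (hA : ∀ i, IsFinPres p (A i))
    {𝔖 : PGrpd p} (f g : ContFunctor 𝔖.toTopGrpd (TopGrpd.fam A)) :
    ∃ (𝔓 : PGrpd p) (q : ContFunctor (TopGrpd.fam A) 𝔓.toTopGrpd) (θ : f.comp q ≅ g.comp q),
      IsHCoeq (𝔐 := PGrpd.fam A hA) f g q θ := by
  have := 𝔖.finite_pi0
  -- The graph of groups: vertices `I`, an edge for each component of `𝔖`, and end points given by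
  -- the values of `f` and `g` at a representative. The components `C` of the graph will be the
  -- objects of the coequalizer.
  let J := Pi0 𝔖.Obj
  let src : J → I := fun s => (f.toFunctor.obj s.out).idx
  let tgt : J → I := fun s => (g.toFunctor.obj s.out).idx
  let φ : ∀ s : J, End s.out →ₜ* A (src s) := fun s => (famEndInv A _).comp (f.mapEnd s.out)
  let ψ : ∀ s : J, End s.out →ₜ* A (tgt s) := fun s => (famEndInv A _).comp (g.mapEnd s.out)
  let r : I → I → Prop := fun i j => ∃ s, src s = i ∧ tgt s = j
  let C := Quot r
  have : Finite C := Quot.finite _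
  have htgt : ∀ s, Quot.mk r (tgt s) = Quot.mk r (src s) := fun s =>
    (Quot.sound (⟨s, rfl, rfl⟩ : r (src s) (tgt s))).symm
  let Ic : C → Type := fun c => {i : I // Quot.mk r i = c}
  let Jc : C → Type := fun c => {s : J // Quot.mk r (src s) = c}
  let srcc : ∀ c, Jc c → Ic c := fun c s => ⟨src s.1, s.2⟩
  let tgtc : ∀ c, Jc c → Ic c := fun c s => ⟨tgt s.1, (htgt s.1).trans s.2⟩
  let base : ∀ c, Ic c := fun c => ⟨c.out, Quot.out_eq c⟩
  have hpath : ∀ c (i : Ic c), Nonempty (GPath (srcc c) (tgtc c) (base c) i) := by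
    intro c i
    -- Being reachable from the base vertex is invariant under crossing an edge in either direction,
    -- so it descends to `Quot r` and holds on the whole component of the base vertex.
    let reach : I → Prop := fun k => ∃ h : Quot.mk r k = c,
      Nonempty (GPath (srcc c) (tgtc c) (base c) ⟨k, h⟩)
    have hr : ∀ k l, r k l → reach k = reach l := by
      rintro _ _ ⟨s, rfl, rfl⟩
      refine propext ⟨?_, ?_⟩
      · rintro ⟨h, ⟨q⟩⟩
        exact ⟨(htgt s).trans h, ⟨GPath.fwd (src := srcc c) (tgt := tgtc c) ⟨s, h⟩ q⟩⟩
      · rintro ⟨h, ⟨q⟩⟩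
        exact ⟨(htgt s).symm.trans h,
          ⟨GPath.bwd (src := srcc c) (tgt := tgtc c) ⟨s, (htgt s).symm.trans h⟩ q⟩⟩
    have h1 : reach (base c).1 := ⟨(base c).2, ⟨GPath.nil⟩⟩
    have h2 : Quot.lift reach hr (Quot.mk r i.1) := by
      rw [i.2, ← (base c).2]
      exact h1
    exact h2.2
  let γ : ∀ c (i : Ic c), GPath (srcc c) (tgtc c) (base c) i := fun c i => (hpath c i).some
  choose n π R hs _ using fun s : J => (𝔖.isFinPres_end s.out).2
  -- Only the images of finitely many topological generators of the edge group enter, which keeps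
  -- the fundamental group finitely presented.
  let rel : ∀ c (s : Jc c), Set (A (srcc c s).1 × A (tgtc c s).1) := fun c s =>
    Set.range fun k : Fin (n s.1) =>
      (φ s.1 (π s.1 (FreeProP.gen p k)), ψ s.1 (π s.1 (FreeProP.gen p k)))
  choose P gP tP iP ι t hfp hrel hγ hex hun using fun c : C => exists_graphGroup (p := p)
    (fun i : Ic c => A i.1) (fun i => hA i.1) (srcc c) (tgtc c) (rel c)
    (fun s => Set.finite_range _) (base c) (γ c)
  -- The relation extends from the generators to the whole edge group: both sides give continuous
  -- homomorphisms on the free pro-`p` group that covers it.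
  have hrel' : ∀ c (s : Jc c) (a : End s.1.out),
      t c s * ι c (srcc c s) (φ s.1 a) = ι c (tgtc c s) (ψ s.1 a) * t c s := by
    intro c s a
    have := (hfp c).1.t2Space
    obtain ⟨y, rfl⟩ := hs s.1 a
    let w₁ : FreeProP p (Fin (n s.1)) →ₜ* P c := 
      ((ι c (srcc c s)).comp (φ s.1)).comp (π s.1)
    let w₂ : FreeProP p (Fin (n s.1)) →ₜ* P c := 
      ⟨(MulAut.conj (t c s)⁻¹).toMonoidHom.comp
        (((ι c (tgtc c s)).comp (ψ s.1)).comp (π s.1)).toMonoidHom,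
        (continuous_const.mul (((ι c (tgtc c s)).comp (ψ s.1)).comp (π s.1)).continuous_toFun).mul
          continuous_const⟩
    have hw : w₁ = w₂ := FreeProP.hom_ext fun k => by
      have := hrel c s _ ⟨k, rfl⟩
      change ι c (srcc c s) (φ s.1 (π s.1 (FreeProP.gen p k))) =
        (t c s)⁻¹ * ι c (tgtc c s) (ψ s.1 (π s.1 (FreeProP.gen p k))) * (t c s)⁻¹⁻¹
      rw [inv_inv, mul_assoc, ← this, inv_mul_cancel_left]
    have h1 : ι c (srcc c s) (φ s.1 (π s.1 y)) =
        (t c s)⁻¹ * ι c (tgtc c s) (ψ s.1 (π s.1 y)) * (t c s)⁻¹⁻¹ := DFunLike.congr_fun hw y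
    rw [h1]
    group
  let q : ContFunctor (TopGrpd.fam A) (TopGrpd.fam P) := famDesc (N := A) (𝔗 := TopGrpd.fam P)
    (fun i => famPt P (Quot.mk r i)) fun i => (famEnd P _).comp (ι (Quot.mk r i) ⟨i, rfl⟩)
  have hq : ∀ i a, q.toFunctor.map (famLoop i a) =
      famLoop (N := P) (Quot.mk r i) (ι (Quot.mk r i) ⟨i, rfl⟩ a) := fun i a =>
    famDesc_loop (N := A) (𝔗 := TopGrpd.fam P) (fun i => famPt P (Quot.mk r i))
      (fun i => (famEnd P _).comp (ι (Quot.mk r i) ⟨i, rfl⟩)) i a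
  -- The two ends of an edge lie in components that are equal but not definitionally so. Keeping `c`
  -- variable permits elimination of the equality.
  have hq' : ∀ i c (h : c = Quot.mk r i) a, famEq (N := P) h ≫ q.toFunctor.map (famLoop i a) =
      famLoop (N := P) c (ι c ⟨i, h.symm⟩ a) ≫ famEq h := by
    rintro i _ rfl a
    exact (Category.id_comp _).trans ((hq i a).trans (Category.comp_id _).symm)
  -- At the representative of an edge the filling is the stable letter of that edge; naturality for
  -- loops there is precisely `hrel'`.
  obtain ⟨θ, hθ⟩ := ContFunctor.exists_hom_of_loops (f.comp q) (g.comp q)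
    (fun s => famLoop (N := P) (Quot.mk r (src s)) (t _ ⟨s, rfl⟩) ≫ famEq (htgt s).symm) (by
      intro s a
      have h1 := hq (src s) (φ s a)
      have h2 := hq' (tgt s) _ (htgt s).symm (ψ s a)
      change q.toFunctor.map (famLoop (src s) (φ s a)) ≫ _ =
        (famLoop (N := P) (Quot.mk r (src s)) (t _ ⟨s, rfl⟩) ≫ famEq (htgt s).symm) ≫
          q.toFunctor.map (famLoop (tgt s) (ψ s a))
      erw [h1, Category.assoc, h2, ← Category.assoc, ← Category.assoc, ← famLoop_mul,
        ← famLoop_mul]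
      exact congrArg (fun z => famLoop (N := P) (Quot.mk r (src s)) z ≫ famEq (htgt s).symm)
        (hrel' (Quot.mk r (src s)) ⟨s, rfl⟩ a))
  refine ⟨PGrpd.fam P hfp, q, ContFunctor.homIso θ, ⟨?_, ?_⟩⟩
  · intro 𝔗 (u : ContFunctor (TopGrpd.fam A) 𝔗.toTopGrpd) (η : f.comp u ≅ g.comp u)
    let o : ∀ c, Ic c → 𝔗.Obj := fun c i => u.toFunctor.obj (famPt A i.1)
    let ηc : ∀ c (s : Jc c), o c (srcc c s) ⟶ o c (tgtc c s) := fun c s =>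
      NatTrans.app η.hom s.1.out
    -- Transport along the chosen path from the base vertex. Conjugation by `ε` moves all vertex
    -- groups and edges into the automorphism group of one object.
    let ε : ∀ c (i : Ic c), o c (base c) ⟶ o c i := fun c i => (γ c i).eval (o c) (ηc c)
    have hη : ∀ c (s : Jc c) (a : End s.1.out),
        u.toFunctor.map (famLoop (src s.1) (φ s.1 a)) ≫ ηc c s =
          ηc c s ≫ u.toFunctor.map (famLoop (tgt s.1) (ψ s.1 a)) := fun c s a =>
      ContFunctor.naturality η.hom a
    have hW : ∀ c, ∃ w : P c →ₜ* End (o c (base c)),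
        (∀ i a, w (ι c i a) = ε c i ≫ u.toFunctor.map (famLoop i.1 a) ≫ inv (ε c i)) ∧
          ∀ s, w (t c s) = ε c (srcc c s) ≫ ηc c s ≫ inv (ε c (tgtc c s)) := by
      intro c
      refine hex c (End (o c (base c))) (𝔗.isFinPres_end _).1
        (fun i => ((𝔗.conjEnd (ε c i)).comp (u.mapEnd _)).comp (famEnd A i.1))
        (fun s => ε c (srcc c s) ≫ ηc c s ≫ inv (ε c (tgtc c s))) ?_ ?_
      · rintro s _ ⟨k, rfl⟩
        have h := hη c s (π s.1 (FreeProP.gen p k))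
        change (ε c (srcc c s) ≫ u.toFunctor.map (famLoop (src s.1) (φ s.1 _)) ≫
            inv (ε c (srcc c s))) ≫ ε c (srcc c s) ≫ ηc c s ≫ inv (ε c (tgtc c s)) =
          (ε c (srcc c s) ≫ ηc c s ≫ inv (ε c (tgtc c s))) ≫
            ε c (tgtc c s) ≫ u.toFunctor.map (famLoop (tgt s.1) (ψ s.1 _)) ≫
              inv (ε c (tgtc c s))
        simp only [Category.assoc, IsIso.inv_hom_id_assoc, reassoc_of% h]
      · intro i
        -- The telescoping product ends in `ε ≫ inv ε` and leaves the transport along the path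
        -- chosen at the base vertex, whichever `i` was taken. This is the path relation of the
        -- fundamental group.
        have h : ∀ i, (γ c i).prod (G := End (o c (base c)))
            (fun s => ε c (srcc c s) ≫ ηc c s ≫ inv (ε c (tgtc c s))) = ε c (base c) := fun i => by
          rw [GPath.prod_conj (o c) (ηc c) (ε c) (γ c i)]
          change ε c (base c) ≫ ε c i ≫ inv (ε c i) = _
          simp
        exact (h i).trans (h _).symm
    choose W hW1 hW2 using hW
    let w : ContFunctor (TopGrpd.fam P) 𝔗.toTopGrpd := famDesc (N := P) (fun c => o c (base c)) W
    have hw : ∀ c x, w.toFunctor.map (famLoop (N := P) c x) = (W c x : o c (base c) ⟶ _) :=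
      fun c x => famDesc_loop (N := P) (fun c => o c (base c)) W c x
    obtain ⟨a, ha⟩ := exists_hom_fam (N := A) (q.comp w) u
      (fun i => ε (Quot.mk r i) ⟨i, rfl⟩) (by
        intro i x
        have h1 : (q.comp w).toFunctor.map (famLoop i x) = ε (Quot.mk r i) ⟨i, rfl⟩ ≫
            u.toFunctor.map (famLoop i x) ≫ inv (ε (Quot.mk r i) ⟨i, rfl⟩) :=
          (congrArg (fun z => w.toFunctor.map z) (hq i x)).trans ((hw _ _).trans (hW1 _ _ _))
        rw [h1]
        exact conj_comp_self _ _)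
    have hwe : ∀ i c (h : c = Quot.mk r i),
        w.toFunctor.map (famEq (N := P) h) ≫ ε (Quot.mk r i) ⟨i, rfl⟩ = ε c ⟨i, h.symm⟩ := by
      rintro i _ rfl
      exact (congrArg (fun z => z ≫ _) (w.toFunctor.map_id _)).trans (Category.id_comp _)
    refine ⟨w, ContFunctor.homIso a, fun x => ?_⟩
    -- Both sides are components of natural transformations, so the identity need only be verified
    -- at the representatives, where `θ` is known.
    refine congrArg (fun z : f.comp (q.comp w) ⟶ g.comp u => NatTrans.app z x)
      (ContFunctor.hom_ext_out (a := (ContFunctor.isoWhiskerRight (ContFunctor.homIso θ) w).hom ≫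
        (ContFunctor.isoWhiskerLeft g (ContFunctor.homIso a)).hom)
        (b := (ContFunctor.isoWhiskerLeft f (ContFunctor.homIso a)).hom ≫ η.hom) fun s => ?_)
    change w.toFunctor.map (NatTrans.app θ s.out) ≫ NatTrans.app a (famPt A (tgt s)) =
      NatTrans.app a (famPt A (src s)) ≫ ηc (Quot.mk r (src s)) ⟨s, rfl⟩
    rw [ha, ha]
    have h1 : w.toFunctor.map (NatTrans.app θ s.out) =
        (ε _ (srcc _ ⟨s, rfl⟩) ≫ ηc (Quot.mk r (src s)) ⟨s, rfl⟩ ≫ inv (ε _ (tgtc _ ⟨s, rfl⟩))) ≫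
          w.toFunctor.map (famEq (N := P) (htgt s).symm) :=
      (congrArg (fun z => w.toFunctor.map z) (hθ s)).trans ((w.toFunctor.map_comp _ _).trans
        (congrArg (fun z => z ≫ _) ((hw _ _).trans (hW2 _ _))))
    refine (congrArg (fun z => z ≫ _) h1).trans ?_
    refine (Category.assoc _ _ _).trans ((congrArg (fun z => _ ≫ z)
      (hwe (tgt s) _ (htgt s).symm)).trans ?_)
    change (ε _ (srcc _ ⟨s, rfl⟩) ≫ ηc (Quot.mk r (src s)) ⟨s, rfl⟩ ≫
      inv (ε _ (tgtc _ ⟨s, rfl⟩))) ≫ ε _ (tgtc _ ⟨s, rfl⟩) = ε _ (srcc _ ⟨s, rfl⟩) ≫ _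
    simp only [Category.assoc, IsIso.inv_hom_id, Category.comp_id]
  · intro 𝔗 (w : ContFunctor (TopGrpd.fam P) 𝔗.toTopGrpd)
      (w' : ContFunctor (TopGrpd.fam P) 𝔗.toTopGrpd) (a : q.comp w ⟶ q.comp w') ha
    -- Each vertex of a component proposes a value at the corresponding object of the coequalizer.
    -- The proposals have to be shown equal.
    let b : ∀ c (i : Ic c), w.toFunctor.obj (famPt P c) ⟶ w'.toFunctor.obj (famPt P c) :=
      fun c i => w.toFunctor.map (famEq (N := P) i.2.symm) ≫ NatTrans.app a (famPt A i.1) ≫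
        w'.toFunctor.map (famEq (N := P) i.2)
    have hb : ∀ i, b (Quot.mk r i) ⟨i, rfl⟩ = NatTrans.app a (famPt A i) := fun i => by
      change w.toFunctor.map (𝟙 _) ≫ NatTrans.app a (famPt A i) ≫ w'.toFunctor.map (𝟙 _) = _
      erw [w.toFunctor.map_id, w'.toFunctor.map_id, Category.id_comp, Category.comp_id]
    have hbι : ∀ c (i : Ic c) x, w.toFunctor.map (famLoop (N := P) c (ι c i x)) ≫ b c i =
        b c i ≫ w'.toFunctor.map (famLoop (N := P) c (ι c i x)) := by
      rintro _ ⟨i, rfl⟩ x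
      have h := ContFunctor.naturality a (famLoop i x)
      rw [hb]
      have h1 := hq i x
      change w.toFunctor.map (q.toFunctor.map _) ≫ _ = _ ≫ w'.toFunctor.map (q.toFunctor.map _) at h
      rw [h1] at h
      exact h
    have hbt : ∀ c (s : Jc c), w.toFunctor.map (famLoop (N := P) c (t c s)) ≫ b c (tgtc c s) =
        b c (srcc c s) ≫ w'.toFunctor.map (famLoop (N := P) c (t c s)) := by
      rintro _ ⟨s, rfl⟩
      have e : ∀ v : ContFunctor (TopGrpd.fam P) 𝔗.toTopGrpd,
          v.toFunctor.map (NatTrans.app θ s.out) =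
            v.toFunctor.map (famLoop (N := P) (Quot.mk r (src s)) (t _ ⟨s, rfl⟩)) ≫
              v.toFunctor.map (famEq (N := P) (htgt s).symm) := fun v =>
        (congrArg (fun z => v.toFunctor.map z) (hθ s)).trans (v.toFunctor.map_comp _ _)
      have h := ((congrArg (fun z => z ≫ _) (e w)).symm.trans
        ((ha s.out).trans (congrArg (fun z => _ ≫ z) (e w')))).trans
          (congrArg (fun z => z ≫ _) (hb (src s)).symm)
      change w.toFunctor.map (famLoop (N := P) (Quot.mk r (src s)) (t _ ⟨s, rfl⟩)) ≫
        w.toFunctor.map (famEq (N := P) (htgt s).symm) ≫ NatTrans.app a (famPt A (tgt s)) ≫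
        w'.toFunctor.map (famEq (N := P) (htgt s)) = _
      have h3 : w'.toFunctor.map (famEq (N := P) (htgt s).symm) ≫
          w'.toFunctor.map (famEq (N := P) (htgt s)) = 𝟙 _ := by
        rw [← Functor.map_comp, famEq_trans]
        exact w'.toFunctor.map_id _
      exact comp_eq_of_comp_eq h h3
    -- Intertwine along `γ c i` and along `γ c (base c)`. Their products agree in `P c`, and
    -- cancelling the common invertible factor leaves `b c i = b c (base c)`.
    have hbb : ∀ c (i : Ic c), b c i = b c (base c) := by
      intro c i
      have h := fun i => GPath.prod_intertwine ((w.mapEnd (famPt P c)).comp (famEnd P c)).toMonoidHom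
        ((w'.mapEnd (famPt P c)).comp (famEnd P c)).toMonoidHom (t c) (b c) (hbt c) (γ c i)
      have h1 := h i
      rw [hγ c i, ← h (base c)] at h1
      have := IsIso.of_groupoid (((w.mapEnd (famPt P c)).comp (famEnd P c)).toMonoidHom
        ((γ c (base c)).prod (t c)) : w.toFunctor.obj (famPt P c) ⟶ w.toFunctor.obj (famPt P c))
      exact (cancel_epi _).mp h1
    -- Naturality says that `w` and the conjugate of `w'` by `b` agree on `P c`. They agree on the
    -- vertex groups and stable letters, hence everywhere by the uniqueness clause of the
    -- fundamental group.
    obtain ⟨d, hd⟩ := exists_hom_fam (N := P) w w' (fun c => b c (base c)) (by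
      intro c x
      have := (𝔗.isFinPres_end (w.toFunctor.obj (famPt P c))).1.t2Space
      have h := hun c (End (w.toFunctor.obj (famPt P c))) ((w.mapEnd (famPt P c)).comp (famEnd P c))
        (((𝔗.conjEnd (b c (base c))).comp (w'.mapEnd (famPt P c))).comp (famEnd P c))
        (fun i y => by
          change w.toFunctor.map (famLoop (N := P) c (ι c i y)) = b c (base c) ≫
            w'.toFunctor.map (famLoop (N := P) c (ι c i y)) ≫ inv (b c (base c))
          have h1 := hbι c i y
          rw [hbb c i] at h1
          rw [← Category.assoc, ← h1, Category.assoc, IsIso.hom_inv_id, Category.comp_id])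
        (fun s => by
          change w.toFunctor.map (famLoop (N := P) c (t c s)) = b c (base c) ≫
            w'.toFunctor.map (famLoop (N := P) c (t c s)) ≫ inv (b c (base c))
          have h1 := hbt c s
          rw [hbb c (tgtc c s), hbb c (srcc c s)] at h1
          rw [← Category.assoc, ← h1, Category.assoc, IsIso.hom_inv_id, Category.comp_id])
      have h1 : w.toFunctor.map (famLoop (N := P) c x) = b c (base c) ≫
          w'.toFunctor.map (famLoop (N := P) c x) ≫ inv (b c (base c)) := DFunLike.congr_fun h x
      rw [h1]
      simp only [Category.assoc, IsIso.inv_hom_id, Category.comp_id])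
    refine ⟨d, fun k => ?_, fun d' hd' => ?_⟩
    · exact (hd _).trans ((hbb _ ⟨k.idx, rfl⟩).symm.trans (hb k.idx))
    · refine ContFunctor.hom_ext fun c => ?_
      obtain ⟨c⟩ := c
      -- Every object of the coequalizer is the image of a vertex under `q`, so a transformation
      -- with the prescribed restriction is unique.
      induction c using Quot.ind with | _ i =>
      refine (hd' (famPt A i)).trans ?_
      exact ((hd _).trans ((hbb _ ⟨i, rfl⟩).symm.trans (hb i))).symm

end HCoeq

end ProPDW
end

open CategoryTheory MonoidalCategory

noncomputable section

namespace ProPDW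

/-! ### Cancellation of an isomorphism of functors with its inverse at an object. -/

namespace ContFunctor

variable {𝔊 ℌ 𝔎 𝔏 : TopGrpd}

@[simp]
lemma hom_inv_app_assoc {F G : ContFunctor 𝔊 ℌ} (e : F ≅ G) (x : 𝔊.Obj) {y : ℌ.Obj}
    (m : F.toFunctor.obj x ⟶ y) : NatTrans.app e.hom x ≫ NatTrans.app e.inv x ≫ m = m := by
  rw [← Category.assoc, hom_inv_app, Category.id_comp]

@[simp]
lemma inv_hom_app_assoc {F G : ContFunctor 𝔊 ℌ} (e : F ≅ G) (x : 𝔊.Obj) {y : ℌ.Obj}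
    (m : G.toFunctor.obj x ⟶ y) : NatTrans.app e.inv x ≫ NatTrans.app e.hom x ≫ m = m := by
  rw [← Category.assoc, inv_hom_app, Category.id_comp]

@[simp]
lemma map_hom_inv_app {F G : ContFunctor 𝔊 ℌ} (e : F ≅ G) (w : ContFunctor ℌ 𝔎) (x : 𝔊.Obj) :
    w.toFunctor.map (NatTrans.app e.hom x) ≫ w.toFunctor.map (NatTrans.app e.inv x) = 𝟙 _ := by
  rw [← Functor.map_comp, hom_inv_app, CategoryTheory.Functor.map_id]

@[simp]
lemma map_inv_hom_app {F G : ContFunctor 𝔊 ℌ} (e : F ≅ G) (w : ContFunctor ℌ 𝔎) (x : 𝔊.Obj) :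
    w.toFunctor.map (NatTrans.app e.inv x) ≫ w.toFunctor.map (NatTrans.app e.hom x) = 𝟙 _ := by
  rw [← Functor.map_comp, inv_hom_app, CategoryTheory.Functor.map_id]

@[simp]
lemma map_hom_inv_app_assoc {F G : ContFunctor 𝔊 ℌ} (e : F ≅ G) (w : ContFunctor ℌ 𝔎) (x : 𝔊.Obj)
    {y : 𝔎.Obj} (m : w.toFunctor.obj (F.toFunctor.obj x) ⟶ y) :
    w.toFunctor.map (NatTrans.app e.hom x) ≫ w.toFunctor.map (NatTrans.app e.inv x) ≫ m = m := by
  rw [← Category.assoc, map_hom_inv_app, Category.id_comp]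

@[simp]
lemma map_inv_hom_app_assoc {F G : ContFunctor 𝔊 ℌ} (e : F ≅ G) (w : ContFunctor ℌ 𝔎) (x : 𝔊.Obj)
    {y : 𝔎.Obj} (m : w.toFunctor.obj (G.toFunctor.obj x) ⟶ y) :
    w.toFunctor.map (NatTrans.app e.inv x) ≫ w.toFunctor.map (NatTrans.app e.hom x) ≫ m = m := by
  rw [← Category.assoc, map_inv_hom_app, Category.id_comp]

/-- Precomposition of a natural transformation with a functor. -/
def whiskerL (F : ContFunctor 𝔊 ℌ) {G G' : ContFunctor ℌ 𝔎} (a : G ⟶ G') : F.comp G ⟶ F.comp G' :=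
  Functor.whiskerLeft F.toFunctor a

end ContFunctor

open ContFunctor

/-! ### Horizontal and vertical composition and inversion of commutative squares. -/

section Squares

variable {C : Type} [Category.{0} C]

lemma sq_hcomp {x y z x' y' z' : C} {t₁ : x ⟶ y} {t₂ : y ⟶ z} {s₁ : x' ⟶ y'} {s₂ : y' ⟶ z'}
    {a : x ⟶ x'} {b : y ⟶ y'} {c : z ⟶ z'} (h₁ : t₁ ≫ b = a ≫ s₁) (h₂ : t₂ ≫ c = b ≫ s₂) :
    (t₁ ≫ t₂) ≫ c = a ≫ s₁ ≫ s₂ := by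
  rw [Category.assoc, h₂, ← Category.assoc, h₁, Category.assoc]

lemma sq_vcomp {x y z x' y' z' : C} {t : x ⟶ x'} {s : y ⟶ y'} {r : z ⟶ z'} {a : x ⟶ y} {a' : y ⟶ z}
    {b : x' ⟶ y'} {b' : y' ⟶ z'} (h₁ : t ≫ b = a ≫ s) (h₂ : s ≫ b' = a' ≫ r) :
    t ≫ b ≫ b' = (a ≫ a') ≫ r := by
  rw [← Category.assoc, h₁, Category.assoc, h₂, Category.assoc]

lemma sq_hinv {x y x' y' : C} {t : x ⟶ y} {s : x' ⟶ y'} {a : x ⟶ x'} {b : y ⟶ y'} {t' : y ⟶ x}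
    {s' : y' ⟶ x'} (h : t ≫ b = a ≫ s) (ht : t' ≫ t = 𝟙 _) (hs : s ≫ s' = 𝟙 _) :
    t' ≫ a = b ≫ s' := by
  calc t' ≫ a = t' ≫ (a ≫ s) ≫ s' := by rw [Category.assoc, hs, Category.comp_id]
    _ = b ≫ s' := by rw [← h, Category.assoc, ← Category.assoc, ht, Category.id_comp]

lemma sq_vinv {x y x' y' : C} {t : x ⟶ y} {s : x' ⟶ y'} {a : x ⟶ x'} {b : y ⟶ y'} {a' : x' ⟶ x}
    {b' : y' ⟶ y} (h : t ≫ b = a ≫ s) (ha : a' ≫ a = 𝟙 _) (hb : b ≫ b' = 𝟙 _) :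
    s ≫ b' = a' ≫ t :=
  (sq_hinv h.symm ha hb).symm

lemma sq_of_conj {x y x' y' : C} {t : x ⟶ y} {s : x' ⟶ y'} {a : x ⟶ x'} {b' : y' ⟶ y}
    {b : y ⟶ y'} (h : t = a ≫ s ≫ b') (hb : b' ≫ b = 𝟙 _) : t ≫ b = a ≫ s := by
  rw [h, Category.assoc, Category.assoc, hb, Category.comp_id]

end Squares

/-! ### From homotopy coequalizers to homotopy pushouts. -/

section HPushout

variable {p : ℕ}

/-- Restriction along `E` is an equivalence of functor groupoids: data on `𝔐` move to `𝔑` through a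
quasi-inverse of `E`, and transformations extend uniquely. This reduces the construction of
coequalizers to a skeletal target. -/
lemma IsHCoeq.of_equiv {𝔖 𝔐 𝔑 𝔓 : PGrpd p} {f g : 𝔖.Fun 𝔐} {E : 𝔐.Fun 𝔑} (hE : E.IsEquiv)
    {q : 𝔑.Fun 𝔓} {θ : (f.comp E).comp q ≅ (g.comp E).comp q}
    (h : IsHCoeq (f.comp E) (g.comp E) q θ) : IsHCoeq f g (E.comp q) θ := by
  obtain ⟨E', ⟨m⟩, -⟩ := id hE
  refine ⟨fun 𝔗 u η => ?_, fun 𝔗 w w' a ha => ?_⟩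
  · obtain ⟨w, a, ha⟩ := h.exists_desc 𝔗 (E'.comp u)
      (isoWhiskerLeft f (isoWhiskerRight m u) ≪≫ η ≪≫ (isoWhiskerLeft g (isoWhiskerRight m u)).symm)
    exact ⟨w, isoWhiskerLeft E a ≪≫ isoWhiskerRight m u, fun x =>
      sq_vcomp (ha x) (sq_of_conj rfl (map_inv_hom_app m u _))⟩
  · obtain ⟨a', ha'⟩ := hE.exists_hom (F := q.comp w) (G := q.comp w') a
    obtain ⟨c, hc, hcu⟩ := h.existsUnique_hom 𝔗 w w' a' (fun x => by
      have := ha x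
      rw [← ha', ← ha'] at this
      exact this)
    refine ⟨c, fun k => (hc _).trans (ha' k), fun d hd => hcu d fun k => ?_⟩
    have : whiskerL q d = a' := hE.hom_ext fun x => (hd x).trans (ha' x).symm
    rw [← this]
    rfl

/-- Homotopy coequalizers exist. -/
lemma exists_hcoeq [Fact p.Prime] {𝔖 𝔐 : PGrpd p} (f g : 𝔖.Fun 𝔐) :
    ∃ (𝔓 : PGrpd p) (q : 𝔐.Fun 𝔓) (θ : f.comp q ≅ g.comp q), IsHCoeq f g q θ := by
  -- `E` is a quasi-inverse of the inclusion of the skeleton. Only the target is made skeletal; for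
  -- `𝔖` the representatives of the components are enough.
  obtain ⟨E, hE, -, -⟩ := 𝔐.isEquiv_skelFun.symm
  have := 𝔐.finite_pi0
  obtain ⟨𝔓, q, θ, h⟩ := exists_hcoeq_fam (fun c : Pi0 𝔐.Obj => End c.out)
    (fun c => 𝔐.isFinPres_end c.out) (f.comp E) (g.comp E)
  exact ⟨𝔓, E.comp q, θ, IsHCoeq.of_equiv (𝔑 := 𝔐.skel) hE h⟩

/-- A homotopy pushout is a homotopy coequalizer of functors to the coproduct. -/
lemma IsHCoeq.isHPushout {𝔖 𝔎 𝔏 𝔓 : PGrpd p} {f : 𝔖.Fun 𝔎} {g : 𝔖.Fun 𝔏}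
    {q : (𝔎.coprod 𝔏).Fun 𝔓}
    {θ : (f.comp (inl 𝔎.toTopGrpd 𝔏.toTopGrpd)).comp q ≅
      (g.comp (inr 𝔎.toTopGrpd 𝔏.toTopGrpd)).comp q}
    (h : IsHCoeq (𝔐 := 𝔎.coprod 𝔏) (f.comp (inl _ _)) (g.comp (inr _ _)) q θ) :
    IsHPushout f g ((inl 𝔎.toTopGrpd 𝔏.toTopGrpd).comp q) ((inr 𝔎.toTopGrpd 𝔏.toTopGrpd).comp q)
      θ := by
  refine ⟨fun 𝔗 u v η => ?_, fun 𝔗 w w' a b hab => ?_⟩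
  · obtain ⟨w, a, ha⟩ := h.exists_desc 𝔗 (copair u v) η
    exact ⟨w, isoWhiskerLeft (inl _ _) a, isoWhiskerLeft (inr _ _) a, ha⟩
  · let ab : q.comp w ⟶ q.comp w' := (coprodIsoExt (F := q.comp w) (G := q.comp w') (homIso a)
      (homIso b)).hom
    have h1 : ∀ k, NatTrans.app ab ((inl 𝔎.toTopGrpd 𝔏.toTopGrpd).toFunctor.obj k) =
        NatTrans.app a k := fun k => by
      exact (Functor.sumIsoExt_hom_app_inl _ _ _)
    have h2 : ∀ k, NatTrans.app ab ((inr 𝔎.toTopGrpd 𝔏.toTopGrpd).toFunctor.obj k) =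
        NatTrans.app b k := fun k => by
      exact (Functor.sumIsoExt_hom_app_inr _ _ _)
    obtain ⟨c, hc, hcu⟩ := h.existsUnique_hom 𝔗 w w' ab (fun x => by
      have := hab x
      rw [← h1, ← h2] at this
      exact this)
    refine ⟨c, ⟨fun k => (hc _).trans (h1 k), fun k => (hc _).trans (h2 k)⟩, fun d hd => hcu d ?_⟩
    rintro (k | k)
    · exact (hd.1 k).trans (h1 k).symm
    · exact (hd.2 k).trans (h2 k).symm

/-- Homotopy pushouts exist. -/
lemma exists_hpushout [Fact p.Prime] {𝔖 𝔎 𝔏 : PGrpd p} (f : 𝔖.Fun 𝔎) (g : 𝔖.Fun 𝔏) :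
    ∃ (𝔓 : PGrpd p) (i : 𝔎.Fun 𝔓) (j : 𝔏.Fun 𝔓) (θ : f.comp i ≅ g.comp j),
      IsHPushout f g i j θ := by
  obtain ⟨𝔓, q, θ, h⟩ := exists_hcoeq (𝔐 := 𝔎.coprod 𝔏) (f.comp (inl _ _)) (g.comp (inr _ _))
  exact ⟨𝔓, (inl 𝔎.toTopGrpd 𝔏.toTopGrpd).comp q, (inr 𝔎.toTopGrpd 𝔏.toTopGrpd).comp q, θ,
    h.isHPushout⟩

end HPushout

end ProPDW
end

open CategoryTheory MonoidalCategory

noncomputable section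

namespace ProPDW

open ContFunctor

/-! ### The calculus of homotopy pushouts -/

section Calculus

variable {p : ℕ} {𝔖 𝔎 𝔏 𝔓 𝔎' 𝔓' : PGrpd p}

lemma IsHPushout.symm {f : 𝔖.Fun 𝔎} {g : 𝔖.Fun 𝔏} {i : 𝔎.Fun 𝔓} {j : 𝔏.Fun 𝔓}
    {θ : f.comp i ≅ g.comp j} (h : IsHPushout f g i j θ) : IsHPushout g f j i θ.symm := by
  refine ⟨fun 𝔗 u v η => ?_, fun 𝔗 w w' a b hab => ?_⟩
  · obtain ⟨w, a, b, hab⟩ := h.exists_desc 𝔗 v u η.symm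
    exact ⟨w, b, a, fun x => sq_hinv (hab x) (map_inv_hom_app θ w x) (inv_hom_app η x)⟩
  · obtain ⟨c, ⟨hc1, hc2⟩, hcu⟩ := h.existsUnique_hom 𝔗 w w' b a fun x =>
      sq_hinv (hab x) (map_hom_inv_app θ w x) (map_inv_hom_app θ w' x)
    exact ⟨c, ⟨hc2, hc1⟩, fun d hd => hcu d ⟨hd.2, hd.1⟩⟩

/-- An isomorphism of the leg changes only the filling. Together with `IsHPushout.of_equiv_left` and
`IsHPushout.symm` it shows that pushouts depend on cospans only up to equivalence. -/
lemma IsHPushout.of_iso_left {f f' : 𝔖.Fun 𝔎} {g : 𝔖.Fun 𝔏} {i : 𝔎.Fun 𝔓} {j : 𝔏.Fun 𝔓}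
    {θ : f.comp i ≅ g.comp j} (h : IsHPushout f g i j θ) (m : f' ≅ f) :
    IsHPushout f' g i j (isoWhiskerRight m i ≪≫ θ) := by
  refine ⟨fun 𝔗 u v η => ?_, fun 𝔗 w w' a b hab => ?_⟩
  · obtain ⟨w, a, b, hab⟩ := h.exists_desc 𝔗 u v ((isoWhiskerRight m u).symm ≪≫ η)
    refine ⟨w, a, b, fun x => ?_⟩
    have h1 := sq_hcomp (naturality a.hom (NatTrans.app m.hom x)) (hab x)
    refine (congrArg (fun t => t ≫ _) (w.toFunctor.map_comp _ _)).trans (h1.trans ?_)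
    exact congrArg (fun t => _ ≫ t) (map_hom_inv_app_assoc m u x _)
  · obtain ⟨c, hc, hcu⟩ := h.existsUnique_hom 𝔗 w w' a b fun x => by
      have h1 := sq_hinv (naturality a (NatTrans.app m.hom x)) (map_inv_hom_app m (i.comp w) x)
        (map_hom_inv_app m (i.comp w') x)
      have h2 := sq_hcomp h1 ((congrArg (fun t => t ≫ _) (w.toFunctor.map_comp _ _)).symm.trans
        ((hab x).trans (congrArg (fun t => _ ≫ t) (w'.toFunctor.map_comp _ _))))
      exact (congrArg (fun t => t ≫ _) (map_inv_hom_app_assoc m (i.comp w) x _)).symm.trans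
        (h2.trans (congrArg (fun t => _ ≫ t) (map_inv_hom_app_assoc m (i.comp w') x _)))
    exact ⟨c, hc, hcu⟩

/-- Functors and transformations out of `𝔎` and `𝔎'` correspond under restriction along `κ`, so the
two universal properties are the same. -/
lemma IsHPushout.of_equiv_left {f : 𝔖.Fun 𝔎} {κ : 𝔎.Fun 𝔎'} {g : 𝔖.Fun 𝔏} {i : 𝔎'.Fun 𝔓}
    {j : 𝔏.Fun 𝔓} {θ : (f.comp κ).comp i ≅ g.comp j} (h : IsHPushout (f.comp κ) g i j θ)
    (hκ : κ.IsEquiv) : IsHPushout f g (κ.comp i) j θ := by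
  obtain ⟨κ', ⟨m⟩, -⟩ := id hκ
  refine ⟨fun 𝔗 u v η => ?_, fun 𝔗 w w' a b hab => ?_⟩
  · obtain ⟨w, a, b, hab⟩ := h.exists_desc 𝔗 (κ'.comp u) v
      (isoWhiskerLeft f (isoWhiskerRight m u) ≪≫ η)
    exact ⟨w, isoWhiskerLeft κ a ≪≫ isoWhiskerRight m u, b, fun x =>
      (hab x).trans (Category.assoc _ _ _).symm⟩
  · obtain ⟨a', ha'⟩ := hκ.exists_hom (F := i.comp w) (G := i.comp w') a
    obtain ⟨c, ⟨hc1, hc2⟩, hcu⟩ := h.existsUnique_hom 𝔗 w w' a' b (fun x => by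
      have := hab x
      rw [← ha'] at this
      exact this)
    refine ⟨c, ⟨fun k => (hc1 _).trans (ha' k), hc2⟩, fun d hd => hcu d ⟨fun k => ?_, hd.2⟩⟩
    have : whiskerL i d = a' := hκ.hom_ext fun x => (hd.1 x).trans (ha' x).symm
    rw [← this]
    rfl

/-- A functor on `𝔖` equipped with an isomorphism to the restriction of `v` adds nothing to `v`:
take `v` itself as the glued functor, with `η⁻¹` as comparison. This is the source of the identity
laws. -/
lemma isHPushout_id_left (g : 𝔖.Fun 𝔏) :
    IsHPushout (ContFunctor.id 𝔖.toTopGrpd) g g (ContFunctor.id 𝔏.toTopGrpd) (Iso.refl _) := by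
  refine ⟨fun 𝔗 u v η => ⟨v, η.symm, Iso.refl _, fun x => ?_⟩, fun 𝔗 w w' a b hab => ?_⟩
  · exact ((Category.comp_id _).trans (v.toFunctor.map_id _)).trans (inv_hom_app η x).symm
  · refine ⟨b, ⟨fun k => ?_, fun l => rfl⟩, fun d hd => ContFunctor.hom_ext hd.2⟩
    have := hab k
    refine (Category.id_comp _).symm.trans (((congrArg (fun t => t ≫ _)
      (w.toFunctor.map_id _)).symm.trans this).trans ((congrArg (fun t => _ ≫ t)
      (w'.toFunctor.map_id _)).trans (Category.comp_id _)))

/-- Homotopy pushouts are unique up to equivalence. -/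
lemma IsHPushout.exists_equiv {f : 𝔖.Fun 𝔎} {g : 𝔖.Fun 𝔏} {i : 𝔎.Fun 𝔓} {j : 𝔏.Fun 𝔓}
    {θ : f.comp i ≅ g.comp j} (h : IsHPushout f g i j θ) {i' : 𝔎.Fun 𝔓'} {j' : 𝔏.Fun 𝔓'}
    {θ' : f.comp i' ≅ g.comp j'} (h' : IsHPushout f g i' j' θ') :
    ∃ e : 𝔓.Fun 𝔓', e.IsEquiv ∧ Nonempty (i.comp e ≅ i') ∧ Nonempty (j.comp e ≅ j') := by
  -- Stated for arbitrary pushouts so that it applies to both composites. Each composite restricts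
  -- compatibly to the legs, hence is isomorphic to the identity by the universal property for
  -- transformations.
  have key : ∀ {𝔓 𝔓' : PGrpd p} {i : 𝔎.Fun 𝔓} {j : 𝔏.Fun 𝔓} {θ : f.comp i ≅ g.comp j}
      (_ : IsHPushout f g i j θ) {i' : 𝔎.Fun 𝔓'} {j' : 𝔏.Fun 𝔓'} {θ' : f.comp i' ≅ g.comp j'}
      (w : 𝔓.Fun 𝔓') (a : i.comp w ≅ i') (b : j.comp w ≅ j')
      (_ : ∀ x : 𝔖.Obj, w.toFunctor.map (NatTrans.app θ.hom x) ≫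
        NatTrans.app b.hom (g.toFunctor.obj x) =
          NatTrans.app a.hom (f.toFunctor.obj x) ≫ NatTrans.app θ'.hom x)
      (w' : 𝔓'.Fun 𝔓) (a' : i'.comp w' ≅ i) (b' : j'.comp w' ≅ j)
      (_ : ∀ x : 𝔖.Obj, w'.toFunctor.map (NatTrans.app θ'.hom x) ≫
        NatTrans.app b'.hom (g.toFunctor.obj x) =
          NatTrans.app a'.hom (f.toFunctor.obj x) ≫ NatTrans.app θ.hom x),
      Nonempty (w.comp w' ≅ ContFunctor.id 𝔓.toTopGrpd) := by
    intro 𝔓 𝔓' i j θ h i' j' θ' w a b hab w' a' b' hab'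
    obtain ⟨c, -, -⟩ := h.existsUnique_hom 𝔓 (w.comp w') (ContFunctor.id 𝔓.toTopGrpd)
      (isoWhiskerRight a w' ≪≫ a').hom (isoWhiskerRight b w' ≪≫ b').hom fun x =>
        sq_vcomp ((w'.toFunctor.map_comp _ _).symm.trans ((congrArg _ (hab x)).trans
          (w'.toFunctor.map_comp _ _))) (hab' x)
    exact ⟨homIso c⟩
  obtain ⟨w, a, b, hab⟩ := h.exists_desc 𝔓' i' j' θ'
  obtain ⟨w', a', b', hab'⟩ := h'.exists_desc 𝔓 i j θ
  exact ⟨w, ⟨w', key h w a b hab w' a' b' hab', key h' w' a' b' hab' w a b hab⟩, ⟨a⟩, ⟨b⟩⟩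

end Calculus

end ProPDW
end

open CategoryTheory MonoidalCategory

noncomputable section

namespace ProPDW

open ContFunctor

/-! ### Pasting and coproducts of homotopy pushouts. -/

section Pasting

variable {p : ℕ}

/-- Naturality at the components of `e`, solved for one value; it transfers equalities of
transformations from the image of `F` to that of `G`. -/
lemma naturality_conj {𝔊 ℌ 𝔎 : TopGrpd} {F G : ContFunctor 𝔊 ℌ} (e : F ≅ G) {w w' : ContFunctor ℌ 𝔎}
    (d : w ⟶ w') (x : 𝔊.Obj) :
    NatTrans.app d (G.toFunctor.obj x) = w.toFunctor.map (NatTrans.app e.inv x) ≫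
      NatTrans.app d (F.toFunctor.obj x) ≫ w'.toFunctor.map (NatTrans.app e.hom x) := by
  rw [← naturality, map_inv_hom_app_assoc]

/-- The pasting law for homotopy pushouts. -/
lemma IsHPushout.paste {𝔖 𝔖' 𝔎 𝔏 𝔐 𝔓 𝔔 𝔕 : PGrpd p} {f : 𝔖.Fun 𝔎} {g : 𝔖.Fun 𝔏} {i : 𝔎.Fun 𝔓}
    {j : 𝔏.Fun 𝔓} {θ : f.comp i ≅ g.comp j} (h : IsHPushout f g i j θ) {f' : 𝔖'.Fun 𝔏}
    {g' : 𝔖'.Fun 𝔐} {i₂ : 𝔏.Fun 𝔕} {j₂ : 𝔐.Fun 𝔕} {θ₂ : f'.comp i₂ ≅ g'.comp j₂}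
    (h₂ : IsHPushout f' g' i₂ j₂ θ₂) {k : 𝔓.Fun 𝔔} {l : 𝔐.Fun 𝔔}
    {θ₃ : (f'.comp j).comp k ≅ g'.comp l} (h₃ : IsHPushout (f'.comp j) g' k l θ₃) :
    ∃ (r : 𝔕.Fun 𝔔) (θ₄ : f.comp (i.comp k) ≅ (g.comp i₂).comp r),
      IsHPushout f (g.comp i₂) (i.comp k) r θ₄ ∧ Nonempty (j₂.comp r ≅ l) := by
  obtain ⟨r, a, b, hr⟩ := h₂.exists_desc 𝔔 (j.comp k) l θ₃
  refine ⟨r, isoWhiskerRight θ k ≪≫ (isoWhiskerLeft g a).symm, ⟨fun 𝔗 u v η => ?_,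
    fun 𝔗 w w' a₀ b₀ hab => ?_⟩, ⟨b⟩⟩
  · obtain ⟨w₁, a₁, b₁, h1⟩ := h.exists_desc 𝔗 u (i₂.comp v) η
    obtain ⟨w, a₂, b₂, h2⟩ := h₃.exists_desc 𝔗 w₁ (j₂.comp v)
      (isoWhiskerLeft f' b₁ ≪≫ isoWhiskerRight θ₂ v)
    have hwr : ∀ x, w.toFunctor.map (r.toFunctor.map (NatTrans.app θ₂.hom x)) ≫
        w.toFunctor.map (NatTrans.app b.hom (g'.toFunctor.obj x)) =
        w.toFunctor.map (NatTrans.app a.hom (f'.toFunctor.obj x)) ≫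
          w.toFunctor.map (NatTrans.app θ₃.hom x) := fun x =>
      (w.toFunctor.map_comp _ _).symm.trans ((congrArg _ (hr x)).trans (w.toFunctor.map_comp _ _))
    obtain ⟨B, ⟨hB1, -⟩, -⟩ := h₂.existsUnique_hom 𝔗 (r.comp w) v
      (isoWhiskerRight a w ≪≫ isoWhiskerLeft j a₂ ≪≫ b₁).hom (isoWhiskerRight b w ≪≫ b₂).hom
      fun x => sq_vcomp (hwr x) ((h2 x).trans (Category.assoc _ _ _).symm)
    refine ⟨w, isoWhiskerLeft i a₂ ≪≫ a₁, homIso B, fun x => ?_⟩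
    refine (congrArg (fun t => t ≫ _) (w.toFunctor.map_comp _ _)).trans
      ((congrArg (fun t => _ ≫ t) (hB1 (g.toFunctor.obj x))).trans ?_)
    refine (Category.assoc _ _ _).trans ((congrArg (fun t => _ ≫ t)
      (map_inv_hom_app_assoc a w _ _)).trans ?_)
    exact sq_vcomp (naturality a₂.hom (NatTrans.app θ.hom x)) (h1 x)
  · let bj : j.comp (k.comp w) ⟶ j.comp (k.comp w') := (isoWhiskerRight a w).inv ≫ whiskerL i₂ b₀ ≫
      (isoWhiskerRight a w').hom
    let bl : l.comp w ⟶ l.comp w' := (isoWhiskerRight b w).inv ≫ whiskerL j₂ b₀ ≫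
      (isoWhiskerRight b w').hom
    obtain ⟨c₁, ⟨hc1, hc1'⟩, hc1u⟩ := h.existsUnique_hom 𝔗 (k.comp w) (k.comp w') a₀ bj fun x => by
      have h1 := (congrArg (fun t => t ≫ _) (w.toFunctor.map_comp _ _)).symm.trans
        ((hab x).trans (congrArg (fun t => _ ≫ t) (w'.toFunctor.map_comp _ _)))
      exact comp_eq_of_comp_eq h1 (map_inv_hom_app a w' _)
    have hwr : ∀ (w : 𝔔.Fun 𝔗) x, w.toFunctor.map (r.toFunctor.map (NatTrans.app θ₂.hom x)) ≫
        w.toFunctor.map (NatTrans.app b.hom (g'.toFunctor.obj x)) =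
        w.toFunctor.map (NatTrans.app a.hom (f'.toFunctor.obj x)) ≫
          w.toFunctor.map (NatTrans.app θ₃.hom x) := fun w x =>
      (w.toFunctor.map_comp _ _).symm.trans ((congrArg _ (hr x)).trans (w.toFunctor.map_comp _ _))
    obtain ⟨c, ⟨hc, hc'⟩, hcu⟩ := h₃.existsUnique_hom 𝔗 w w' c₁ bl fun x => by
      refine Eq.trans ?_ (congrArg (fun t => t ≫ _) (hc1' (f'.toFunctor.obj x)).symm)
      exact sq_vcomp (sq_vinv (hwr w x) (map_inv_hom_app a w _) (map_hom_inv_app b w _))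
        (sq_vcomp (naturality b₀ (NatTrans.app θ₂.hom x)) (hwr w' x))
    have hunique : ∀ d d' : r.comp w ⟶ r.comp w',
        (∀ y, NatTrans.app d (i₂.toFunctor.obj y) = NatTrans.app d' (i₂.toFunctor.obj y)) →
        (∀ z, NatTrans.app d (j₂.toFunctor.obj z) = NatTrans.app d' (j₂.toFunctor.obj z)) →
        d = d' := fun d d' h1 h2 =>
      (h₂.existsUnique_hom 𝔗 (r.comp w) (r.comp w') (whiskerL i₂ d') (whiskerL j₂ d')
        fun x => naturality d' (NatTrans.app θ₂.hom x)).unique ⟨h1, h2⟩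
        ⟨fun _ => rfl, fun _ => rfl⟩
    refine ⟨c, ⟨fun x => (hc _).trans (hc1 x), ?_⟩, ?_⟩
    · have : whiskerL r c = b₀ := by
        refine hunique _ _ (fun y => ?_) fun z => ?_
        · refine (naturality_conj a.symm c y).trans ?_
          refine (congrArg (fun t => _ ≫ t ≫ _) ((hc _).trans (hc1' y))).trans ?_
          refine (congrArg (fun t => _ ≫ t) (Category.assoc _ _ _)).trans ?_
          refine (map_hom_inv_app_assoc a w y _).trans ?_
          refine (Category.assoc _ _ _).trans ?_
          exact (congrArg (fun t => _ ≫ t) (map_hom_inv_app a w' y)).trans (Category.comp_id _)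
        · refine (naturality_conj b.symm c z).trans ?_
          refine (congrArg (fun t => _ ≫ t ≫ _) (hc' z)).trans ?_
          refine (congrArg (fun t => _ ≫ t) (Category.assoc _ _ _)).trans ?_
          refine (map_hom_inv_app_assoc b w z _).trans ?_
          refine (Category.assoc _ _ _).trans ?_
          exact (congrArg (fun t => _ ≫ t) (map_hom_inv_app b w' z)).trans (Category.comp_id _)
      intro y
      exact congrArg (fun t : r.comp w ⟶ r.comp w' => NatTrans.app t y) this
    · rintro d ⟨hd1, hd2⟩
      refine hcu d ⟨?_, fun z => ?_⟩
      · have : whiskerL k d = c₁ := hc1u _ ⟨hd1, fun y => ?_⟩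
        · intro x
          exact congrArg (fun t : k.comp w ⟶ k.comp w' => NatTrans.app t x) this
        · refine (naturality_conj a d y).trans ?_
          exact congrArg (fun t => _ ≫ t ≫ _) (hd2 _)
      · refine (naturality_conj b d z).trans ?_
        exact congrArg (fun t => _ ≫ t ≫ _) (hd2 _)

lemma coprodIsoExt_inl {𝔊 ℌ 𝔎 : TopGrpd} {F G : ContFunctor (𝔊.coprod ℌ) 𝔎}
    (a : (inl 𝔊 ℌ).comp F ≅ (inl 𝔊 ℌ).comp G) (b : (inr 𝔊 ℌ).comp F ≅ (inr 𝔊 ℌ).comp G)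
    (x : 𝔊.Obj) : NatTrans.app (coprodIsoExt a b).hom ((inl 𝔊 ℌ).toFunctor.obj x) =
      NatTrans.app a.hom x := Functor.sumIsoExt_hom_app_inl _ _ _

lemma coprodIsoExt_inr {𝔊 ℌ 𝔎 : TopGrpd} {F G : ContFunctor (𝔊.coprod ℌ) 𝔎}
    (a : (inl 𝔊 ℌ).comp F ≅ (inl 𝔊 ℌ).comp G) (b : (inr 𝔊 ℌ).comp F ≅ (inr 𝔊 ℌ).comp G)
    (x : ℌ.Obj) : NatTrans.app (coprodIsoExt a b).hom ((inr 𝔊 ℌ).toFunctor.obj x) =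
      NatTrans.app b.hom x := Functor.sumIsoExt_hom_app_inr _ _ _

/-- The coproduct of two homotopy pushouts is a homotopy pushout. -/
lemma IsHPushout.coprod {𝔖 𝔎 𝔏 𝔓 𝔖' 𝔎' 𝔏' 𝔓' : PGrpd p} {f : 𝔖.Fun 𝔎} {g : 𝔖.Fun 𝔏}
    {i : 𝔎.Fun 𝔓} {j : 𝔏.Fun 𝔓} {θ : f.comp i ≅ g.comp j} (h : IsHPushout f g i j θ)
    {f' : 𝔖'.Fun 𝔎'} {g' : 𝔖'.Fun 𝔏'} {i' : 𝔎'.Fun 𝔓'} {j' : 𝔏'.Fun 𝔓'}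
    {θ' : f'.comp i' ≅ g'.comp j'} (h' : IsHPushout f' g' i' j' θ')
    (Θ : (coprodMap f f').comp (coprodMap i i') ≅ (coprodMap g g').comp (coprodMap j j'))
    (hΘl : ∀ x, NatTrans.app Θ.hom ((inl 𝔖.toTopGrpd 𝔖'.toTopGrpd).toFunctor.obj x) =
      (inl 𝔓.toTopGrpd 𝔓'.toTopGrpd).toFunctor.map (NatTrans.app θ.hom x))
    (hΘr : ∀ x, NatTrans.app Θ.hom ((inr 𝔖.toTopGrpd 𝔖'.toTopGrpd).toFunctor.obj x) =
      (inr 𝔓.toTopGrpd 𝔓'.toTopGrpd).toFunctor.map (NatTrans.app θ'.hom x)) :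
    IsHPushout (𝔖 := 𝔖.coprod 𝔖') (𝔎 := 𝔎.coprod 𝔎') (𝔏 := 𝔏.coprod 𝔏') (𝔓 := 𝔓.coprod 𝔓')
      (coprodMap f f') (coprodMap g g') (coprodMap i i') (coprodMap j j') Θ := by
  refine ⟨fun 𝔗 u v η => ?_, fun 𝔗 w w' a b hab => ?_⟩
  · obtain ⟨w₁, a₁, b₁, h1⟩ := h.exists_desc 𝔗 ((inl _ _).comp u) ((inl _ _).comp v)
      (isoWhiskerLeft (inl _ _) η)
    obtain ⟨w₂, a₂, b₂, h2⟩ := h'.exists_desc 𝔗 ((inr _ _).comp u) ((inr _ _).comp v)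
      (isoWhiskerLeft (inr _ _) η)
    refine ⟨copair w₁ w₂, coprodIsoExt a₁ a₂, coprodIsoExt b₁ b₂, ?_⟩
    rintro (x | x)
    · refine Eq.trans ?_ ((h1 x).trans ?_)
      · exact congrArg₂ (fun s t => s ≫ t)
          (congrArg (fun t => (copair w₁ w₂).toFunctor.map t) (hΘl x)) (coprodIsoExt_inl _ _ _)
      · exact congrArg (fun t => t ≫ _) (coprodIsoExt_inl
          (F := (coprodMap i i').comp (copair w₁ w₂)) (G := u) a₁ a₂ (f.toFunctor.obj x)).symm
    · refine Eq.trans ?_ ((h2 x).trans ?_)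
      · exact congrArg₂ (fun s t => s ≫ t)
          (congrArg (fun t => (copair w₁ w₂).toFunctor.map t) (hΘr x)) (coprodIsoExt_inr _ _ _)
      · exact congrArg (fun t => t ≫ _) (coprodIsoExt_inr
          (F := (coprodMap i i').comp (copair w₁ w₂)) (G := u) a₁ a₂ (f'.toFunctor.obj x)).symm
  · obtain ⟨c₁, ⟨hc1, hc1'⟩, hc1u⟩ := h.existsUnique_hom 𝔗 ((inl _ _).comp w) ((inl _ _).comp w')
      (whiskerL (inl _ _) a) (whiskerL (inl _ _) b) fun x => by
        exact (congrArg (fun t => t ≫ _) (congrArg (fun t => w.toFunctor.map t) (hΘl x))).symm.trans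
          ((hab ((inl _ _).toFunctor.obj x)).trans
            (congrArg (fun t => _ ≫ t) (congrArg (fun t => w'.toFunctor.map t) (hΘl x))))
    obtain ⟨c₂, ⟨hc2, hc2'⟩, hc2u⟩ := h'.existsUnique_hom 𝔗 ((inr _ _).comp w) ((inr _ _).comp w')
      (whiskerL (inr _ _) a) (whiskerL (inr _ _) b) fun x => by
        exact (congrArg (fun t => t ≫ _) (congrArg (fun t => w.toFunctor.map t) (hΘr x))).symm.trans
          ((hab ((inr _ _).toFunctor.obj x)).trans
            (congrArg (fun t => _ ≫ t) (congrArg (fun t => w'.toFunctor.map t) (hΘr x))))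
    refine ⟨(coprodIsoExt (homIso c₁) (homIso c₂)).hom, ⟨?_, ?_⟩, fun d hd => ?_⟩
    · rintro (x | x)
      · exact (coprodIsoExt_inl (homIso c₁) (homIso c₂) _).trans (hc1 x)
      · exact (coprodIsoExt_inr (homIso c₁) (homIso c₂) _).trans (hc2 x)
    · rintro (x | x)
      · exact (coprodIsoExt_inl (homIso c₁) (homIso c₂) _).trans (hc1' x)
      · exact (coprodIsoExt_inr (homIso c₁) (homIso c₂) _).trans (hc2' x)
    · have e1 : whiskerL (inl _ _) d = c₁ :=
        hc1u _ ⟨fun x => hd.1 (Sum.inl x), fun x => hd.2 (Sum.inl x)⟩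
      have e2 : whiskerL (inr _ _) d = c₂ :=
        hc2u _ ⟨fun x => hd.1 (Sum.inr x), fun x => hd.2 (Sum.inr x)⟩
      refine ContFunctor.hom_ext ?_
      rintro (x | x)
      · refine Eq.trans ?_ (coprodIsoExt_inl (homIso c₁) (homIso c₂) _).symm
        rw [← e1]
        rfl
      · refine Eq.trans ?_ (coprodIsoExt_inr (homIso c₁) (homIso c₂) _).symm
        rw [← e2]
        rfl

end Pasting

end ProPDW
end

open CategoryTheory MonoidalCategory

noncomputable section

namespace ProPDW

open ContFunctor

/-! ### The symmetric monoidal category of cospans -/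

section Laws

variable {p : ℕ} {𝔊 ℌ 𝔎 𝔏 : PGrpd p}

/-- Transporting the second pushout along the equivalences of apices, one side at a time with a
reflection in between, turns it into a pushout of the first span. Uniqueness of pushouts then
compares the two composites. -/
lemma Cospan.rel_of_isComposite {C C' : Cospan 𝔊 ℌ} {D D' : Cospan ℌ 𝔎} {E E' : Cospan 𝔊 𝔎}
    (hC : C.Rel C') (hD : D.Rel D') (h : C.IsComposite D E) (h' : C'.IsComposite D' E') :
    E.Rel E' := by
  obtain ⟨e, he, ⟨l⟩, ⟨r⟩⟩ := hC
  obtain ⟨f, hf, ⟨l'⟩, ⟨r'⟩⟩ := hD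
  obtain ⟨i, j, θ, hp, ⟨a⟩, ⟨b⟩⟩ := h
  obtain ⟨i', j', θ', hp', ⟨a'⟩, ⟨b'⟩⟩ := h'
  have h1 := ((hp'.of_iso_left r).of_equiv_left he).symm
  have h2 := ((h1.of_iso_left l').of_equiv_left hf).symm
  obtain ⟨w, hw, ⟨c⟩, ⟨d⟩⟩ := hp.exists_equiv h2
  exact ⟨w, hw,
    ⟨isoWhiskerRight a.symm w ≪≫ isoWhiskerLeft C.left c ≪≫ isoWhiskerRight l i' ≪≫ a'⟩,
    ⟨isoWhiskerRight b.symm w ≪≫ isoWhiskerLeft D.right d ≪≫ isoWhiskerRight r' j' ≪≫ b'⟩⟩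

lemma Cospan.cls_eq {C D : Cospan 𝔊 ℌ} (h : C.Rel D) : C.cls = D.cls := Quotient.sound h

lemma CospanHom.exists_rep (c : CospanHom 𝔊 ℌ) : ∃ C : Cospan 𝔊 ℌ, C.cls = c :=
  Quotient.exists_rep c

lemma Cospan.exists_isComposite [Fact p.Prime] (C : Cospan 𝔊 ℌ) (D : Cospan ℌ 𝔎) :
    ∃ (𝔓 : PGrpd p) (i : C.apex.Fun 𝔓) (j : D.apex.Fun 𝔓) (θ : C.right.comp i ≅ D.left.comp j),
      IsHPushout C.right D.left i j θ ∧ C.IsComposite D ⟨𝔓, C.left.comp i, D.right.comp j⟩ := by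
  obtain ⟨𝔓, i, j, θ, h⟩ := exists_hpushout C.right D.left
  exact ⟨𝔓, i, j, θ, h, i, j, θ, h, ⟨Iso.refl _⟩, ⟨Iso.refl _⟩⟩

namespace CospanHom

lemma ofFun_congr {f g : 𝔊.Fun ℌ} (e : f ≅ g) : ofFun f = ofFun g :=
  Cospan.cls_eq ⟨ContFunctor.id _, isEquiv_id _, ⟨e⟩, ⟨Iso.refl _⟩⟩

/-- Composition of classes is defined by chosen representatives and a composite selected by
`Classical.epsilon`. Once composites exist, invariance under equivalence removes both choices. -/
lemma comp_cls {C : Cospan 𝔊 ℌ} {D : Cospan ℌ 𝔎} {E : Cospan 𝔊 𝔎} (h : C.IsComposite D E)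
    (hex : ∀ (C : Cospan 𝔊 ℌ) (D : Cospan ℌ 𝔎), ∃ E, C.IsComposite D E) :
    comp C.cls D.cls = E.cls := by
  have hs := Classical.epsilon_spec (hex (Quotient.out C.cls) (Quotient.out D.cls))
  exact Cospan.cls_eq (Cospan.rel_of_isComposite (Quotient.mk_out C) (Quotient.mk_out D) hs h)

variable [Fact p.Prime]

lemma comp_cls' {C : Cospan 𝔊 ℌ} {D : Cospan ℌ 𝔎} {E : Cospan 𝔊 𝔎} (h : C.IsComposite D E) :
    comp C.cls D.cls = E.cls :=
  comp_cls h fun C D => let ⟨_, _, _, _, _, h⟩ := C.exists_isComposite D; ⟨_, h⟩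

/-- The outgoing leg of the first cospan is an identity, so the pushout does not change the second
apex. -/
lemma ofFun_comp (f : 𝔊.Fun ℌ) (C : Cospan ℌ 𝔎) :
    comp (ofFun f) C.cls = Cospan.cls ⟨C.apex, f.comp C.left, C.right⟩ :=
  comp_cls' (C := Cospan.ofFun f)
    ⟨C.left, ContFunctor.id _, _, isHPushout_id_left C.left, ⟨Iso.refl _⟩, ⟨Iso.refl _⟩⟩

/-- Up to isomorphism the identity of `ℌ` factors as `e` followed by the equivalence `e'`. Hence the
pushout of `C.right` along `e` has the apex of `C`, and its new leg is `e'.comp C.right`. -/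
lemma comp_ofFun (C : Cospan 𝔊 ℌ) {e : ℌ.Fun 𝔎} {e' : 𝔎.Fun ℌ} (he' : e'.IsEquiv)
    (m : e.comp e' ≅ ContFunctor.id _) :
    comp C.cls (ofFun e) = Cospan.cls ⟨C.apex, C.left, e'.comp C.right⟩ :=
  comp_cls' (D := Cospan.ofFun e) ⟨ContFunctor.id _, e'.comp C.right, _,
    (((isHPushout_id_left C.right).of_iso_left m).of_equiv_left he').symm,
    ⟨Iso.refl _⟩, ⟨Iso.refl _⟩⟩

lemma ofFun_comp_ofFun (f : 𝔊.Fun ℌ) (g : ℌ.Fun 𝔎) :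
    comp (ofFun f) (ofFun g) = ofFun (f.comp g) := ofFun_comp f (Cospan.ofFun g)

end CospanHom

/-- Functors out of the empty groupoid are isomorphic. -/
def fromEmptyIso {𝔎 : TopGrpd} (F G : ContFunctor (PGrpd.empty p).toTopGrpd 𝔎) : F ≅ G :=
  mkIso (NatIso.ofComponents (fun x => (x : PEmpty).elim) (fun {x} _ _ => (x : PEmpty).elim))

/-- The coproduct of identity functors. -/
def coprodMapId (𝔊 ℌ : TopGrpd) :
    coprodMap (ContFunctor.id 𝔊) (ContFunctor.id ℌ) ≅ ContFunctor.id (𝔊.coprod ℌ) :=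
  coprodIsoExt (Iso.refl _) (Iso.refl _)

lemma CospanHom.tensor_ofFun {𝔊' ℌ' : PGrpd p} (f : 𝔊.Fun ℌ) (g : 𝔊'.Fun ℌ') :
    CospanHom.tensor (CospanHom.ofFun f) (CospanHom.ofFun g) =
      CospanHom.ofFun (ℌ := ℌ.coprod ℌ') (coprodMap f g) :=
  Cospan.cls_eq ⟨ContFunctor.id _, isEquiv_id _, ⟨Iso.refl _⟩, ⟨coprodMapId _ _⟩⟩

/-- The associator and its inverse. -/
def assocHomInv (𝔊 ℌ 𝔎 : PGrpd p) :
    (assocFun 𝔊 ℌ 𝔎).comp (assocInvFun 𝔊 ℌ 𝔎) ≅ ContFunctor.id _ :=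
  coprodIsoExt (coprodIsoExt (Iso.refl _) (Iso.refl _)) (Iso.refl _)

/-- The inverse of the associator and the associator. -/
def assocInvHom (𝔊 ℌ 𝔎 : PGrpd p) :
    (assocInvFun 𝔊 ℌ 𝔎).comp (assocFun 𝔊 ℌ 𝔎) ≅ ContFunctor.id _ :=
  coprodIsoExt (Iso.refl _) (coprodIsoExt (Iso.refl _) (Iso.refl _))

/-- The left unitor and its inverse. -/
def leftUnitorHomInv (𝔊 : PGrpd p) :
    (leftUnitorFun 𝔊).comp (leftUnitorInvFun 𝔊) ≅ ContFunctor.id _ :=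
  coprodIsoExt (fromEmptyIso _ _) (Iso.refl _)

/-- The right unitor and its inverse. -/
def rightUnitorHomInv (𝔊 : PGrpd p) :
    (rightUnitorFun 𝔊).comp (rightUnitorInvFun 𝔊) ≅ ContFunctor.id _ :=
  coprodIsoExt (Iso.refl _) (fromEmptyIso _ _)

/-- The square of the symmetry. -/
def swapSwap (𝔊 ℌ : PGrpd p) : (swapFun 𝔊 ℌ).comp (swapFun ℌ 𝔊) ≅ ContFunctor.id _ :=
  coprodIsoExt (Iso.refl _) (Iso.refl _)

open CospanHom in
/-- The laws of the symmetric monoidal category of cospans. -/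
lemma cospanLaws (p : ℕ) [Fact p.Prime] : CospanLaws p where
  exists_composite C D := let ⟨_, _, _, _, _, h⟩ := C.exists_isComposite D; ⟨_, h⟩
  comp_eq C D E h := comp_cls' h
  id_comp f := by
    obtain ⟨C, rfl⟩ := f.exists_rep
    exact ofFun_comp _ C
  comp_id f := by
    obtain ⟨C, rfl⟩ := f.exists_rep
    exact comp_ofFun C (isEquiv_id _) (Iso.refl _)
  assoc f g h := by
    obtain ⟨C, rfl⟩ := f.exists_rep
    obtain ⟨D, rfl⟩ := g.exists_rep
    obtain ⟨E, rfl⟩ := h.exists_rep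
    obtain ⟨𝔓, i, j, θ, h1, h1'⟩ := C.exists_isComposite D
    obtain ⟨𝔕, i₂, j₂, θ₂, h2, h2'⟩ := D.exists_isComposite E
    obtain ⟨𝔔, k, l, θ₃, h3, h3'⟩ := Cospan.exists_isComposite
      ⟨𝔓, C.left.comp i, D.right.comp j⟩ E
    -- The apex of the left-bracketed composite is also a pushout of the first apex with the
    -- composite of the other two.
    obtain ⟨r, θ₄, h4, ⟨m⟩⟩ := h1.paste h2 h3
    rw [comp_cls' h1', comp_cls' h2', comp_cls' h3']
    exact (comp_cls' (C := C) (D := ⟨𝔕, D.left.comp i₂, E.right.comp j₂⟩)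
      (E := ⟨𝔔, (C.left.comp i).comp k, E.right.comp l⟩) ⟨i.comp k, r, θ₄, h4,
      ⟨Iso.refl _⟩, ⟨isoWhiskerLeft E.right m⟩⟩).symm
  tensor_id 𝔊 ℌ := (tensor_ofFun _ _).trans (ofFun_congr (coprodMapId _ _))
  tensor_comp f f' g g' := by
    obtain ⟨C, rfl⟩ := f.exists_rep
    obtain ⟨C', rfl⟩ := f'.exists_rep
    obtain ⟨D, rfl⟩ := g.exists_rep
    obtain ⟨D', rfl⟩ := g'.exists_rep
    obtain ⟨𝔓, i, j, θ, h1, h1'⟩ := C.exists_isComposite D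
    obtain ⟨𝔓', i', j', θ', h2, h2'⟩ := C'.exists_isComposite D'
    rw [comp_cls' h1', comp_cls' h2']
    exact comp_cls' (C := C.coprod C') (D := D.coprod D') (E := Cospan.coprod
      ⟨𝔓, C.left.comp i, D.right.comp j⟩ ⟨𝔓', C'.left.comp i', D'.right.comp j'⟩)
      ⟨coprodMap i i', coprodMap j j',
        coprodIsoExt (isoWhiskerRight θ (inl _ _)) (isoWhiskerRight θ' (inr _ _)),
        h1.coprod h2 _ (fun x => coprodIsoExt_inl _ _ x) (fun x => coprodIsoExt_inr _ _ x),
        ⟨coprodIsoExt (Iso.refl _) (Iso.refl _)⟩, ⟨coprodIsoExt (Iso.refl _) (Iso.refl _)⟩⟩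
  assoc_hom_inv 𝔊 ℌ 𝔎 := (ofFun_comp_ofFun _ _).trans (ofFun_congr (assocHomInv 𝔊 ℌ 𝔎))
  assoc_inv_hom 𝔊 ℌ 𝔎 := (ofFun_comp_ofFun _ _).trans (ofFun_congr (assocInvHom 𝔊 ℌ 𝔎))
  leftUnitor_hom_inv 𝔊 := (ofFun_comp_ofFun _ _).trans (ofFun_congr (leftUnitorHomInv 𝔊))
  leftUnitor_inv_hom 𝔊 := (ofFun_comp_ofFun _ _).trans (ofFun_congr (Iso.refl _))
  rightUnitor_hom_inv 𝔊 := (ofFun_comp_ofFun _ _).trans (ofFun_congr (rightUnitorHomInv 𝔊))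
  rightUnitor_inv_hom 𝔊 := (ofFun_comp_ofFun _ _).trans (ofFun_congr (Iso.refl _))
  assoc_naturality {𝔊 ℌ 𝔎 𝔊' ℌ' 𝔎'} f g h := by
    obtain ⟨C, rfl⟩ := f.exists_rep
    obtain ⟨D, rfl⟩ := g.exists_rep
    obtain ⟨E, rfl⟩ := h.exists_rep
    refine (comp_ofFun ((C.coprod D).coprod E) (e' := assocInvFun 𝔊' ℌ' 𝔎')
      ⟨_, ⟨assocInvHom _ _ _⟩, ⟨assocHomInv _ _ _⟩⟩ (assocHomInv _ _ _)).trans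
      (Eq.trans ?_ (ofFun_comp _ (C.coprod (D.coprod E))).symm)
    -- Both sides have been reduced to cospans whose apices are the two bracketings of the triple
    -- coproduct; the associator of the apices identifies them.
    exact Cospan.cls_eq ⟨assocFun C.apex D.apex E.apex,
      ⟨_, ⟨assocHomInv _ _ _⟩, ⟨assocInvHom _ _ _⟩⟩,
      ⟨coprodIsoExt (coprodIsoExt (Iso.refl _) (Iso.refl _)) (Iso.refl _)⟩,
      ⟨coprodIsoExt (Iso.refl _) (coprodIsoExt (Iso.refl _) (Iso.refl _))⟩⟩
  leftUnitor_naturality {𝔊 ℌ} f := by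
    obtain ⟨C, rfl⟩ := f.exists_rep
    refine (comp_ofFun (Cospan.coprod (Cospan.ofFun (ContFunctor.id _)) C)
      (e' := leftUnitorInvFun ℌ) ⟨_, ⟨Iso.refl _⟩, ⟨leftUnitorHomInv _⟩⟩
      (leftUnitorHomInv _)).trans (Eq.trans ?_ (ofFun_comp _ C).symm)
    exact Cospan.cls_eq ⟨leftUnitorFun C.apex, ⟨_, ⟨leftUnitorHomInv _⟩, ⟨Iso.refl _⟩⟩,
      ⟨coprodIsoExt (fromEmptyIso _ _) (Iso.refl _)⟩, ⟨Iso.refl _⟩⟩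
  rightUnitor_naturality {𝔊 ℌ} f := by
    obtain ⟨C, rfl⟩ := f.exists_rep
    refine (comp_ofFun (Cospan.coprod C (Cospan.ofFun (ContFunctor.id _)))
      (e' := rightUnitorInvFun ℌ) ⟨_, ⟨Iso.refl _⟩, ⟨rightUnitorHomInv _⟩⟩
      (rightUnitorHomInv _)).trans (Eq.trans ?_ (ofFun_comp _ C).symm)
    exact Cospan.cls_eq ⟨rightUnitorFun C.apex, ⟨_, ⟨rightUnitorHomInv _⟩, ⟨Iso.refl _⟩⟩,
      ⟨coprodIsoExt (Iso.refl _) (fromEmptyIso _ _)⟩, ⟨Iso.refl _⟩⟩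
  pentagon 𝔊 ℌ 𝔎 𝔏 := by
    have e1 := tensor_ofFun (assocFun 𝔊 ℌ 𝔎) (ContFunctor.id 𝔏.toTopGrpd)
    have e2 := tensor_ofFun (ContFunctor.id 𝔊.toTopGrpd) (assocFun ℌ 𝔎 𝔏)
    refine (congrArg₂ CospanHom.comp e1 ((congrArg (CospanHom.comp _) e2).trans (ofFun_comp_ofFun _ _))).trans
      ((ofFun_comp_ofFun _ _).trans (Eq.trans (ofFun_congr ?_) (ofFun_comp_ofFun _ _).symm))
    exact coprodIsoExt (coprodIsoExt (coprodIsoExt (Iso.refl _) (Iso.refl _)) (Iso.refl _))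
      (Iso.refl _)
  triangle 𝔊 ℌ := by
    have e1 := tensor_ofFun (ContFunctor.id 𝔊.toTopGrpd) (leftUnitorFun ℌ)
    refine (congrArg (CospanHom.comp _) e1).trans ((ofFun_comp_ofFun _ _).trans
      (Eq.trans (ofFun_congr ?_) (tensor_ofFun (rightUnitorFun 𝔊) (ContFunctor.id _)).symm))
    exact coprodIsoExt (coprodIsoExt (Iso.refl _) (fromEmptyIso _ _)) (Iso.refl _)
  swap_naturality {𝔊 ℌ 𝔊' ℌ'} f g := by
    obtain ⟨C, rfl⟩ := f.exists_rep
    obtain ⟨D, rfl⟩ := g.exists_rep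
    refine (comp_ofFun (C.coprod D) (e' := swapFun ℌ' 𝔊') ⟨_, ⟨swapSwap _ _⟩, ⟨swapSwap _ _⟩⟩
      (swapSwap _ _)).trans (Eq.trans ?_ (ofFun_comp _ (D.coprod C)).symm)
    exact Cospan.cls_eq ⟨swapFun C.apex D.apex, ⟨_, ⟨swapSwap _ _⟩, ⟨swapSwap _ _⟩⟩,
      ⟨coprodIsoExt (Iso.refl _) (Iso.refl _)⟩, ⟨coprodIsoExt (Iso.refl _) (Iso.refl _)⟩⟩
  swap_swap 𝔊 ℌ := (ofFun_comp_ofFun _ _).trans (ofFun_congr (swapSwap 𝔊 ℌ))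
  hexagon_forward 𝔊 ℌ 𝔎 := by
    have e1 := tensor_ofFun (swapFun 𝔊 ℌ) (ContFunctor.id 𝔎.toTopGrpd)
    have e2 := tensor_ofFun (ContFunctor.id ℌ.toTopGrpd) (swapFun 𝔊 𝔎)
    refine ((congrArg (CospanHom.comp _) (ofFun_comp_ofFun _ _)).trans (ofFun_comp_ofFun _ _)).trans
      (Eq.trans (ofFun_congr ?_) (((congrArg₂ CospanHom.comp e1 ((congrArg (CospanHom.comp _) e2).trans
        (ofFun_comp_ofFun _ _))).trans (ofFun_comp_ofFun _ _))).symm)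
    exact coprodIsoExt (coprodIsoExt (Iso.refl _) (Iso.refl _)) (Iso.refl _)
  hexagon_reverse 𝔊 ℌ 𝔎 := by
    have e1 := tensor_ofFun (ContFunctor.id 𝔊.toTopGrpd) (swapFun ℌ 𝔎)
    have e2 := tensor_ofFun (swapFun 𝔊 𝔎) (ContFunctor.id ℌ.toTopGrpd)
    refine ((congrArg (CospanHom.comp _) (ofFun_comp_ofFun _ _)).trans (ofFun_comp_ofFun _ _)).trans
      (Eq.trans (ofFun_congr ?_) (((congrArg₂ CospanHom.comp e1 ((congrArg (CospanHom.comp _) e2).trans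
        (ofFun_comp_ofFun _ _))).trans (ofFun_comp_ofFun _ _))).symm)
    exact coprodIsoExt (Iso.refl _) (coprodIsoExt (Iso.refl _) (Iso.refl _))

end Laws

end ProPDW
end

open CategoryTheory MonoidalCategory

noncomputable section

namespace ProPDW

open ContFunctor

/-! ### Homotopy pushouts and fibre products of groupoids of functors -/

section Glue

variable {p : ℕ} {𝔖 𝔎 𝔏 𝔓 𝔗 : PGrpd p} {f : 𝔖.Fun 𝔎} {g : 𝔖.Fun 𝔏} {i : 𝔎.Fun 𝔓} {j : 𝔏.Fun 𝔓}

/-- The isomorphism `u ∘ f ≅ v ∘ g` induced by isomorphisms `x ∘ i ≅ u` and `x ∘ j ≅ v`. -/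
def glueIso (θ : f.comp i ≅ g.comp j) {u : 𝔎.Fun 𝔗} {v : 𝔏.Fun 𝔗} (x : 𝔓.Fun 𝔗)
    (t : (i.comp x ≅ u) × (j.comp x ≅ v)) : f.comp u ≅ g.comp v :=
  isoWhiskerLeft f t.1.symm ≪≫ isoWhiskerRight θ x ≪≫ isoWhiskerLeft g t.2

variable {θ : f.comp i ≅ g.comp j} {u : 𝔎.Fun 𝔗} {v : 𝔏.Fun 𝔗}

lemma glueIso_eq_iff {x : 𝔓.Fun 𝔗} {t : (i.comp x ≅ u) × (j.comp x ≅ v)} {η : f.comp u ≅ g.comp v} :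
    glueIso θ x t = η ↔ ∀ s : 𝔖.Obj, x.toFunctor.map (NatTrans.app θ.hom s) ≫
      NatTrans.app t.2.hom (g.toFunctor.obj s) =
        NatTrans.app t.1.hom (f.toFunctor.obj s) ≫ NatTrans.app η.hom s := by
  have key : ∀ s : 𝔖.Obj, NatTrans.app (glueIso θ x t).hom s =
      NatTrans.app t.1.inv (f.toFunctor.obj s) ≫ x.toFunctor.map (NatTrans.app θ.hom s) ≫
        NatTrans.app t.2.hom (g.toFunctor.obj s) := fun s => rfl
  constructor
  · rintro rfl s
    rw [key]
    exact (hom_inv_app_assoc t.1 (f.toFunctor.obj s) _).symm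
  · intro h
    refine Iso.ext (ContFunctor.hom_ext fun s => ?_)
    rw [key]
    exact (congrArg (fun m => NatTrans.app t.1.inv (f.toFunctor.obj s) ≫ m) (h s)).trans
      (inv_hom_app_assoc t.1 (f.toFunctor.obj s) _)

lemma IsHPushout.exists_glueIso (h : IsHPushout f g i j θ) (η : f.comp u ≅ g.comp v) :
    ∃ (x : 𝔓.Fun 𝔗) (t : (i.comp x ≅ u) × (j.comp x ≅ v)), glueIso θ x t = η := by
  obtain ⟨x, a, b, hx⟩ := h.exists_desc 𝔗 u v η
  exact ⟨x, (a, b), glueIso_eq_iff.mpr hx⟩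

lemma IsHPushout.hom_ext (h : IsHPushout f g i j θ) {x y : 𝔓.Fun 𝔗} {c d : x ⟶ y}
    (hi : whiskerL i c = whiskerL i d) (hj : whiskerL j c = whiskerL j d) : c = d := by
  refine (h.existsUnique_hom 𝔗 x y (whiskerL i d) (whiskerL j d) fun s => ?_).unique
    ⟨fun k => ?_, fun l => ?_⟩ ⟨fun k => rfl, fun l => rfl⟩
  · exact naturality d (NatTrans.app θ.hom s)
  · exact congrArg (fun e : i.comp x ⟶ i.comp y => NatTrans.app e k) hi
  · exact congrArg (fun e : j.comp x ⟶ j.comp y => NatTrans.app e l) hj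

/-- The transformations `t.1 ≫ t'.1⁻¹` and `t.2 ≫ t'.2⁻¹` are compatible over `𝔖` because both data
induce the same isomorphism, so they glue. -/
lemma IsHPushout.exists_hom_of_glueIso_eq (h : IsHPushout f g i j θ) {x y : 𝔓.Fun 𝔗}
    {t : (i.comp x ≅ u) × (j.comp x ≅ v)} {t' : (i.comp y ≅ u) × (j.comp y ≅ v)}
    (e : glueIso θ x t = glueIso θ y t') :
    ∃ c : x ≅ y, t.1 = isoWhiskerLeft i c ≪≫ t'.1 ∧ t.2 = isoWhiskerLeft j c ≪≫ t'.2 := by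
  have h1 := glueIso_eq_iff.mp e
  have h2 := glueIso_eq_iff.mp (rfl : glueIso θ y t' = _)
  obtain ⟨c, ⟨ha, hb⟩, -⟩ := h.existsUnique_hom 𝔗 x y (t.1.hom ≫ t'.1.inv) (t.2.hom ≫ t'.2.inv)
    fun s => by
      refine sq_vcomp (h1 s) ?_
      exact sq_vinv (h2 s) (inv_hom_app t'.1 _) (hom_inv_app t'.2 _)
  refine ⟨homIso c, Iso.ext (ContFunctor.hom_ext fun k => ?_), Iso.ext (ContFunctor.hom_ext fun k => ?_)⟩
  · have : NatTrans.app (t.1.hom ≫ t'.1.inv ≫ t'.1.hom) k = NatTrans.app c (i.toFunctor.obj k) ≫ NatTrans.app t'.1.hom k := by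
      rw [ha, ← Category.assoc]; rfl
    rw [Iso.inv_hom_id, Category.comp_id] at this
    exact this
  · have : NatTrans.app (t.2.hom ≫ t'.2.inv ≫ t'.2.hom) k = NatTrans.app c (j.toFunctor.obj k) ≫ NatTrans.app t'.2.hom k := by
      rw [hb, ← Category.assoc]; rfl
    rw [Iso.inv_hom_id, Category.comp_id] at this
    exact this

lemma glueIso_whisker {x y : 𝔓.Fun 𝔗} (c : x ≅ y) (t : (i.comp y ≅ u) × (j.comp y ≅ v)) :
    glueIso θ x (isoWhiskerLeft i c ≪≫ t.1, isoWhiskerLeft j c ≪≫ t.2) = glueIso θ y t := by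
  refine glueIso_eq_iff.mpr fun s => ?_
  exact sq_vcomp (naturality c.hom (NatTrans.app θ.hom s)) (glueIso_eq_iff.mp rfl s)

/-- The pairs of isomorphisms from the restrictions of a representative of a class of functors. -/
abbrev GlueData (i : 𝔎.Fun 𝔓) (j : 𝔏.Fun 𝔓) (u : 𝔎.Fun 𝔗) (v : 𝔏.Fun 𝔗) : Type :=
  Σ q : Pi0 (𝔓.Fun 𝔗), (i.comp q.out ≅ u) × (j.comp q.out ≅ v)

lemma IsHPushout.exists_glueData (h : IsHPushout f g i j θ) (η : f.comp u ≅ g.comp v) :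
    ∃ s : GlueData i j u v, glueIso θ s.1.out s.2 = η := by
  obtain ⟨x, t, rfl⟩ := h.exists_glueIso η
  obtain ⟨c⟩ : Nonempty ((Quotient.mk (isIsomorphicSetoid _) x).out ≅ x) :=
    Quotient.mk_out (s := isIsomorphicSetoid _) x
  exact ⟨⟨_, _⟩, glueIso_whisker c t⟩

/-- All presentations of `η` live over one class, since equal gluings give isomorphic functors. Over
that class the automorphisms act on them transitively by the gluing of isomorphisms, and freely
because a transformation on the pushout is determined by its restrictions. -/
lemma IsHPushout.card_fibre (h : IsHPushout f g i j θ) (η : f.comp u ≅ g.comp v) :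
    ∃ q : Pi0 (𝔓.Fun 𝔗), (∀ s : GlueData i j u v, glueIso θ s.1.out s.2 = η → s.1 = q) ∧
      Nat.card {s : GlueData i j u v // glueIso θ s.1.out s.2 = η} = Nat.card (Aut q.out) := by
  obtain ⟨⟨q, t⟩, hs⟩ := h.exists_glueData η
  have key : ∀ s : GlueData i j u v, glueIso θ s.1.out s.2 = η → s.1 = q := by
    intro s hs'
    obtain ⟨c, -, -⟩ := h.exists_hom_of_glueIso_eq (hs'.trans hs.symm)
    rw [← Quotient.out_eq s.1, ← Quotient.out_eq q]
    exact Quotient.sound ⟨c⟩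
  refine ⟨q, key, ?_⟩
  let m : Aut q.out → {s : GlueData i j u v // glueIso θ s.1.out s.2 = η} := fun c =>
    ⟨⟨q, (isoWhiskerLeft i c ≪≫ t.1, isoWhiskerLeft j c ≪≫ t.2)⟩,
      (glueIso_whisker (θ := θ) (x := q.out) (y := q.out) c t).trans hs⟩
  refine (Nat.card_congr (Equiv.ofBijective m ⟨?_, ?_⟩)).symm
  · intro c d hcd
    have hcd' := eq_of_heq (Sigma.mk.inj (congrArg Subtype.val hcd)).2
    have h1 := congrArg Prod.fst hcd'
    have h2 := congrArg Prod.snd hcd'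
    refine Iso.ext (h.hom_ext ?_ ?_)
    · exact (Iso.cancel_iso_hom_right _ _ t.1).mp (congrArg Iso.hom h1)
    · exact (Iso.cancel_iso_hom_right _ _ t.2).mp (congrArg Iso.hom h2)
  · rintro ⟨⟨q', t'⟩, hs'⟩
    obtain rfl : q' = q := key _ hs'
    obtain ⟨c, h1, h2⟩ := h.exists_hom_of_glueIso_eq (hs'.trans hs.symm)
    exact ⟨c, Subtype.ext (Sigma.ext rfl (heq_of_eq (Prod.ext h1.symm h2.symm)))⟩

end Glue

end ProPDW
end

open CategoryTheory MonoidalCategory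

noncomputable section

namespace ProPDW

open ContFunctor

/-! ### Functoriality of the Dijkgraaf–Witten theory -/

section Functoriality

variable {p : ℕ} {Γ : Type} [Group Γ] [TopologicalSpace Γ] [DiscreteTopology Γ]

lemma autCard_cls {𝔊 : TopGrpd} (P : Bun Γ 𝔊) : autCard (Bun.cls P) = Nat.card (Aut P) := rfl

lemma Bun.cls_out {𝔊 : TopGrpd} (q : Pi0 (Bun Γ 𝔊)) : Bun.cls q.out = q := Quotient.out_eq q

lemma Bun.cls_eq_iff {𝔊 : TopGrpd} {P Q : Bun Γ 𝔊} : Bun.cls P = Bun.cls Q ↔ Nonempty (P ≅ Q) :=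
  Quotient.eq (r := isIsomorphicSetoid _)

lemma res_cls {𝔊 ℌ : TopGrpd} (f : ContFunctor 𝔊 ℌ) (P : Bun Γ ℌ) :
    res f (Bun.cls P) = Bun.cls (f.comp P) := rfl

open Classical in
-- The set of isomorphisms is empty or a torsor under an automorphism group.
lemma card_iso {𝔊 : TopGrpd} (P Q : Bun Γ 𝔊) :
    Nat.card (P ≅ Q) = if Bun.cls P = Bun.cls Q then autCard (Bun.cls Q) else 0 := by
  split_ifs with h
  · obtain ⟨e⟩ := Bun.cls_eq_iff.mp h
    exact Nat.card_congr ⟨fun a => e.symm ≪≫ a, fun a => e ≪≫ a, fun a => by simp,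
      fun a => Iso.ext (Iso.inv_hom_id_assoc e a.hom)⟩
  · have : IsEmpty (P ≅ Q) := ⟨fun e => h (Bun.cls_eq_iff.mpr ⟨e⟩)⟩
    exact Nat.card_of_isEmpty

variable [Finite Γ]

/-- A transformation is determined by its values in `Γ` at the finitely many representatives of the
components. -/
instance finite_bun_hom (𝔊 : PGrpd p) (P Q : Bun Γ 𝔊.toTopGrpd) : Finite (P ⟶ Q) := by
  have := 𝔊.finite_pi0
  let m : (P ⟶ Q) → Pi0 𝔊.Obj → Γ := fun a c => NatTrans.app a c.out
  exact Finite.of_injective m fun a b h => hom_ext_out fun c => congrFun h c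

instance finite_bun_iso (𝔊 : PGrpd p) (P Q : Bun Γ 𝔊.toTopGrpd) : Finite (P ≅ Q) :=
  Finite.of_injective Iso.hom fun _ _ h => Iso.ext h

instance finite_bun_aut (𝔊 : PGrpd p) (P : Bun Γ 𝔊.toTopGrpd) : Finite (Aut P) :=
  finite_bun_iso 𝔊 P P

lemma autCard_ne_zero {𝔊 : PGrpd p} (q : Pi0 (Bun Γ 𝔊.toTopGrpd)) : (autCard q : ℂ) ≠ 0 := by
  rw [← Bun.cls_out q, autCard_cls]
  have : Nonempty (Aut q.out) := ⟨1⟩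
  exact_mod_cast Nat.card_pos.ne'

open Classical in
lemma pullPush_apply {𝔊 ℌ : PGrpd p} (C : Cospan 𝔊 ℌ) [Fintype (Pi0 (Bun Γ C.apex.toTopGrpd))]
    (F : Fld Γ 𝔊) (P : Pi0 (Bun Γ ℌ.toTopGrpd)) :
    pullPush C F P = ∑ Q, if res C.right Q = P then
      (autCard P : ℂ) / (autCard Q : ℂ) * F (res C.left Q) else 0 := by
  rw [← Finset.sum_filter]
  change Finset.sum _ _ = _
  congr!

open Classical in
lemma pullPush_mk_apply {𝔊 ℌ 𝔎 : PGrpd p} (l : 𝔊.Fun 𝔎) (r : ℌ.Fun 𝔎)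
    [Fintype (Pi0 (Bun Γ 𝔎.toTopGrpd))] (F : Fld Γ 𝔊) (P : Pi0 (Bun Γ ℌ.toTopGrpd)) :
    pullPush ⟨𝔎, l, r⟩ F P = ∑ Q, if res r Q = P then
      (autCard P : ℂ) / (autCard Q : ℂ) * F (res l Q) else 0 :=
  letI : Fintype (Pi0 (Bun Γ (Cospan.mk 𝔎 l r).apex.toTopGrpd)) := ‹_›
  pullPush_apply ⟨𝔎, l, r⟩ F P

open Classical in
-- Give each triple of a class `q` and two isomorphisms the weight `1 / |Aut q|`. The fibre over
-- each `η` consists of `|Aut q|` triples over a single `q`, so its total weight is one. `BΓ` serves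
-- as the test object of the universal property.
lemma card_iso_eq_sum [Fact p.Prime] (hΓ : IsPGroup p Γ) {𝔖 𝔎 𝔏 𝔓 : PGrpd p} {f : 𝔖.Fun 𝔎} {g : 𝔖.Fun 𝔏}
    {i : 𝔎.Fun 𝔓} {j : 𝔏.Fun 𝔓} {θ : f.comp i ≅ g.comp j} (h : IsHPushout f g i j θ)
    [Fintype (Pi0 (Bun Γ 𝔓.toTopGrpd))] (a : Bun Γ 𝔎.toTopGrpd) (b : Bun Γ 𝔏.toTopGrpd) :
    (Nat.card (f.comp a ≅ g.comp b) : ℂ) = ∑ q : Pi0 (Bun Γ 𝔓.toTopGrpd),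
      (Nat.card ((i.comp q.out ≅ a) × (j.comp q.out ≅ b)) : ℂ) / (autCard q : ℂ) := by
  let 𝔗 : PGrpd p := PGrpd.B Γ (isFinPres_of_finite hΓ)
  let T : Pi0 (Bun Γ 𝔓.toTopGrpd) → Type := fun q => (i.comp q.out ≅ a) × (j.comp q.out ≅ b)
  have : ∀ q, Fintype (T q) := fun q => Fintype.ofFinite _
  have := Fintype.ofFinite (f.comp a ≅ g.comp b)
  let m : (Σ q, T q) → (f.comp a ≅ g.comp b) := fun s => glueIso (𝔗 := 𝔗) θ s.1.out s.2
  have h1 : ∑ s : (Σ q, T q), (1 : ℂ) / autCard s.1 = ∑ q, (Nat.card (T q) : ℂ) / (autCard q : ℂ) := by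
    rw [Fintype.sum_sigma]
    refine Finset.sum_congr rfl fun q _ => ?_
    simp [div_eq_mul_inv, Nat.card_eq_fintype_card]
  refine Eq.trans ?_ h1
  rw [← Finset.sum_fiberwise (s := Finset.univ) (g := m)]
  rw [Nat.card_eq_fintype_card, ← Finset.card_univ, Finset.card_eq_sum_ones, Nat.cast_sum]
  refine Finset.sum_congr rfl fun η _ => ?_
  obtain ⟨q, hq, hc⟩ := h.card_fibre (𝔗 := 𝔗) η
  have h2 : ∀ s ∈ Finset.univ.filter (fun s => m s = η), (1 : ℂ) / autCard s.1 = 1 / autCard q := by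
    intro s hs
    rw [hq s (Finset.mem_filter.mp hs).2]
  rw [Finset.sum_congr rfl h2, Finset.sum_const, nsmul_eq_mul]
  have h3 : (Finset.univ.filter (fun s => m s = η)).card = autCard q := by
    rw [← Fintype.card_subtype, ← Nat.card_eq_fintype_card]
    exact hc.trans (congrArg autCard (Bun.cls_out (Γ := Γ) (𝔊 := 𝔓.toTopGrpd) q))
  rw [h3]
  simp [autCard_ne_zero q]

open Classical in
-- The mass of the classes on the pushout with prescribed restrictions. It follows from the previous
-- count by evaluating each set of isomorphisms as an automorphism group or as empty.
lemma sum_inv_autCard [Fact p.Prime] (hΓ : IsPGroup p Γ) {𝔖 𝔎 𝔏 𝔓 : PGrpd p} {f : 𝔖.Fun 𝔎} {g : 𝔖.Fun 𝔏}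
    {i : 𝔎.Fun 𝔓} {j : 𝔏.Fun 𝔓} {θ : f.comp i ≅ g.comp j} (h : IsHPushout f g i j θ)
    [Fintype (Pi0 (Bun Γ 𝔓.toTopGrpd))] (a : Pi0 (Bun Γ 𝔎.toTopGrpd))
    (b : Pi0 (Bun Γ 𝔏.toTopGrpd)) :
    (∑ q : Pi0 (Bun Γ 𝔓.toTopGrpd), if res i q = a ∧ res j q = b then (1 : ℂ) / autCard q else 0) =
      if res f a = res g b then (autCard (res g b) : ℂ) / (autCard a * autCard b) else 0 := by
  have ha := autCard_ne_zero a
  have hb := autCard_ne_zero b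
  have key := card_iso_eq_sum hΓ h a.out b.out
  rw [card_iso, ← res_cls, ← res_cls, Bun.cls_out, Bun.cls_out] at key
  have h1 : ∀ q : Pi0 (Bun Γ 𝔓.toTopGrpd),
      (Nat.card ((i.comp q.out ≅ a.out) × (j.comp q.out ≅ b.out)) : ℂ) / (autCard q : ℂ) =
        (autCard a * autCard b) * if res i q = a ∧ res j q = b then (1 : ℂ) / autCard q else 0 := by
    intro q
    rw [Nat.card_prod, card_iso, card_iso, ← res_cls, ← res_cls, Bun.cls_out, Bun.cls_out,
      Bun.cls_out]
    by_cases h1 : res i q = a <;> by_cases h2 : res j q = b <;> simp [h1, h2, div_eq_mul_inv]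
  rw [Finset.sum_congr rfl fun q _ => h1 q, ← Finset.mul_sum] at key
  rw [← mul_right_inj' (mul_ne_zero ha hb), ← key]
  split_ifs with h2
  · field_simp
  · simp

/-- In the composite the factor `|Aut|` of the intermediate bundle cancels against the mass formula
`sum_inv_autCard`; what remains is a triple sum in which `a` and `b` are determined by `q`. -/
lemma pullPush_of_isComposite [Fact p.Prime] (hΓ : IsPGroup p Γ) {𝔊 ℌ 𝔎 : PGrpd p} {C : Cospan 𝔊 ℌ}
    {D : Cospan ℌ 𝔎} {E : Cospan 𝔊 𝔎} (h : C.IsComposite D E) :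
    pullPush (Γ := Γ) E = pullPush D ∘ₗ pullPush C := by
  classical
  obtain ⟨i, j, θ, hp, ⟨l⟩, ⟨r⟩⟩ := h
  have := Fintype.ofFinite (Pi0 (Bun Γ C.apex.toTopGrpd))
  have := Fintype.ofFinite (Pi0 (Bun Γ D.apex.toTopGrpd))
  have := Fintype.ofFinite (Pi0 (Bun Γ E.apex.toTopGrpd))
  refine LinearMap.ext fun F => funext fun P => ?_
  rw [LinearMap.comp_apply, pullPush_apply, pullPush_apply]
  simp only [pullPush_apply]
  have h1 : ∀ b, (if res D.right b = P then (autCard P : ℂ) / autCard b *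
      (∑ a, if res C.right a = res D.left b then
        (autCard (res D.left b) : ℂ) / autCard a * F (res C.left a) else 0) else 0) =
      ∑ a, if res D.right b = P then autCard P * F (res C.left a) *
        (∑ q : Pi0 (Bun Γ E.apex.toTopGrpd),
          if res i q = a ∧ res j q = b then (1 : ℂ) / autCard q else 0) else 0 := by
    intro b
    split_ifs with hb
    · rw [Finset.mul_sum]
      refine Finset.sum_congr rfl fun a _ => ?_
      rw [sum_inv_autCard hΓ hp]
      have ha := autCard_ne_zero a
      have hb := autCard_ne_zero b
      split_ifs
      · field_simp
      · simp
    · simp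
  rw [Finset.sum_congr rfl fun b _ => h1 b]
  simp only [Finset.mul_sum]
  have h2 : ∀ a b, (if res D.right b = P then ∑ q : Pi0 (Bun Γ E.apex.toTopGrpd),
      autCard P * F (res C.left a) *
        (if res i q = a ∧ res j q = b then (1 : ℂ) / autCard q else 0) else 0) =
      ∑ q : Pi0 (Bun Γ E.apex.toTopGrpd), if res i q = a then (if res j q = b then
        (if res D.right b = P then (autCard P : ℂ) / autCard q * F (res C.left a) else 0) else 0)
        else 0 := by
    intro a b
    split_ifs with hb
    · refine Finset.sum_congr rfl fun q _ => ?_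
      by_cases h1 : res i q = a <;> by_cases h2 : res j q = b <;> simp [h1, h2, div_eq_mul_inv]
      ring
    · simp
  simp only [h2]
  have h3 : ∀ b, (∑ a, ∑ q : Pi0 (Bun Γ E.apex.toTopGrpd), if res i q = a then (if res j q = b then
        (if res D.right b = P then (autCard P : ℂ) / autCard q * F (res C.left a) else 0) else 0)
        else 0) = ∑ q : Pi0 (Bun Γ E.apex.toTopGrpd), if res j q = b then
        (if res D.right b = P then (autCard P : ℂ) / autCard q * F (res C.left (res i q)) else 0)
        else 0 := by
    intro b
    rw [Finset.sum_comm]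
    simp
  simp only [h3]
  rw [Finset.sum_comm]
  refine Finset.sum_congr rfl fun q _ => ?_
  rw [Finset.sum_ite_eq, if_pos (Finset.mem_univ _), ← res_comp, ← res_comp, res_congr l, res_congr r]

lemma dwMap_cls {𝔊 ℌ : PGrpd p} (C : Cospan 𝔊 ℌ) : dwMap Γ C.cls = pullPush C := rfl

/-- The outgoing leg is the identity, so only `Q = P` contributes, with weight one: `f_#` is
pullback of functions along restriction of bundles. -/
lemma sharp_apply {𝔊 ℌ : PGrpd p} (f : 𝔊.Fun ℌ) (F : Fld Γ 𝔊) (P : Pi0 (Bun Γ ℌ.toTopGrpd)) :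
    sharp Γ f F P = F (res f P) := by
  classical
  have := Fintype.ofFinite (Pi0 (Bun Γ ℌ.toTopGrpd))
  refine (pullPush_mk_apply f (ContFunctor.id _) F P).trans ?_
  simp only [res_id]
  rw [Finset.sum_ite_eq' , if_pos (Finset.mem_univ _), div_self (autCard_ne_zero P), one_mul]

lemma dwLaws [Fact p.Prime] (hΓ : IsPGroup p Γ) : DWLaws p Γ where
  map_id 𝔊 := LinearMap.ext fun F => funext fun P =>
    (sharp_apply (ContFunctor.id _) F P).trans (congrArg F (res_id P))
  map_comp c d := by
    obtain ⟨C, rfl⟩ := c.exists_rep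
    obtain ⟨D, rfl⟩ := d.exists_rep
    obtain ⟨E, hE⟩ := (cospanLaws p).exists_composite C D
    rw [(cospanLaws p).comp_eq C D E hE]
    exact pullPush_of_isComposite hΓ hE

/-! ### The axioms of a TQFT -/

lemma sharp_comp {𝔊 ℌ 𝔎 : PGrpd p} (f : 𝔊.Fun ℌ) (g : ℌ.Fun 𝔎) :
    sharp Γ (f.comp g) = sharp Γ g ∘ₗ sharp Γ f := by
  refine LinearMap.ext fun F => funext fun P => ?_
  rw [LinearMap.comp_apply, sharp_apply, sharp_apply, sharp_apply, res_comp]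

lemma sharp_bijective {𝔊 ℌ : PGrpd p} (f : 𝔊.Fun ℌ) (hf : f.IsEquiv) :
    Function.Bijective (sharp Γ f) := by
  obtain ⟨f', ⟨a⟩, ⟨b⟩⟩ := hf
  refine Function.bijective_iff_has_inverse.mpr ⟨sharp Γ f', fun F => funext fun P => ?_,
    fun F => funext fun P => ?_⟩
  · rw [sharp_apply, sharp_apply, ← res_comp, res_congr a, res_id]
  · rw [sharp_apply, sharp_apply, ← res_comp, res_congr b, res_id]

variable [Fact p.Prime]

/-- By functoriality both sides are values at composite cospans, and the composites are equivalent
through `e` after the inverse of `g` has been moved to the outgoing leg. -/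
lemma sharp_naturality (hΓ : IsPGroup p Γ) {𝔊 ℌ 𝔊' ℌ' : PGrpd p} (C : Cospan 𝔊 ℌ)
    (C' : Cospan 𝔊' ℌ') (e : C.apex.Fun C'.apex) (f : 𝔊.Fun 𝔊') (g : ℌ.Fun ℌ') (he : e.IsEquiv)
    (hg : g.IsEquiv) (l : C.left.comp e ≅ f.comp C'.left) (r : C.right.comp e ≅ g.comp C'.right) :
    sharp Γ g ∘ₗ dwMap Γ C.cls = dwMap Γ C'.cls ∘ₗ sharp Γ f := by
  obtain ⟨g', ⟨a⟩, ⟨b⟩⟩ := hg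
  rw [sharp, sharp, ← (dwLaws hΓ).map_comp, ← (dwLaws hΓ).map_comp, CospanHom.ofFun_comp,
    CospanHom.comp_ofFun C ⟨g, ⟨b⟩, ⟨a⟩⟩ a]
  refine congrArg (dwMap Γ) (Cospan.cls_eq ⟨e, he, ⟨l⟩, ⟨?_⟩⟩)
  exact isoWhiskerLeft g' r ≪≫ isoWhiskerRight b C'.right

lemma dwMap_gluing (hΓ : IsPGroup p Γ) {𝔊 ℌ ℌ' 𝔎 : PGrpd p} (C : Cospan 𝔊 ℌ) (D : Cospan ℌ' 𝔎)
    (f : ℌ.Fun ℌ') (E : Cospan 𝔊 𝔎) (h : C.IsComposite ⟨D.apex, f.comp D.left, D.right⟩ E) :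
    dwMap Γ E.cls = dwMap Γ D.cls ∘ₗ sharp Γ f ∘ₗ dwMap Γ C.cls := by
  rw [← CospanHom.comp_cls' h, (dwLaws hΓ).map_comp, ← CospanHom.ofFun_comp,
    (dwLaws hΓ).map_comp]
  rfl

end Functoriality

end ProPDW
end

open CategoryTheory MonoidalCategory

noncomputable section

namespace ProPDW

open ContFunctor

/-! ### Bundles on coproducts -/

section Coprod

variable {p : ℕ} {Γ : Type} [Group Γ] [TopologicalSpace Γ] [DiscreteTopology Γ]

lemma res_copair_inl {𝔊 ℌ 𝔎 : TopGrpd} (f : ContFunctor 𝔊 𝔎) (g : ContFunctor ℌ 𝔎)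
    (Q : Pi0 (Bun Γ 𝔎)) : res (inl 𝔊 ℌ) (res (copair f g) Q) = res f Q := by
  rw [← res_comp]
  exact res_congr (Iso.refl _ : (inl 𝔊 ℌ).comp (copair f g) ≅ f) Q

lemma res_copair_inr {𝔊 ℌ 𝔎 : TopGrpd} (f : ContFunctor 𝔊 𝔎) (g : ContFunctor ℌ 𝔎)
    (Q : Pi0 (Bun Γ 𝔎)) : res (inr 𝔊 ℌ) (res (copair f g) Q) = res g Q := by
  rw [← res_comp]
  exact res_congr (Iso.refl _ : (inr 𝔊 ℌ).comp (copair f g) ≅ g) Q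

lemma res_inl_cls_copair {𝔊 ℌ : TopGrpd} (P : Bun Γ 𝔊) (Q : Bun Γ ℌ) :
    res (inl 𝔊 ℌ) (Bun.cls (copair P Q)) = Bun.cls P :=
  Quotient.sound ⟨(Iso.refl _ : (inl 𝔊 ℌ).comp (copair P Q) ≅ P)⟩

lemma res_inr_cls_copair {𝔊 ℌ : TopGrpd} (P : Bun Γ 𝔊) (Q : Bun Γ ℌ) :
    res (inr 𝔊 ℌ) (Bun.cls (copair P Q)) = Bun.cls Q :=
  Quotient.sound ⟨(Iso.refl _ : (inr 𝔊 ℌ).comp (copair P Q) ≅ Q)⟩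

lemma pi0_coprod_ext {𝔊 ℌ : TopGrpd} {P Q : Pi0 (Bun Γ (𝔊.coprod ℌ))}
    (hl : res (inl 𝔊 ℌ) P = res (inl 𝔊 ℌ) Q) (hr : res (inr 𝔊 ℌ) P = res (inr 𝔊 ℌ) Q) : P = Q := by
  rw [← Bun.cls_out P, ← Bun.cls_out Q, res_cls, res_cls, Bun.cls_eq_iff] at hl hr
  obtain ⟨a⟩ := hl
  obtain ⟨b⟩ := hr
  rw [← Bun.cls_out P, ← Bun.cls_out Q]
  exact Bun.cls_eq_iff.mpr ⟨coprodIsoExt a b⟩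

/-- A class of bundles on a coproduct is a pair of classes. -/
def pi0CoprodEquiv (𝔊 ℌ : TopGrpd) :
    Pi0 (Bun Γ (𝔊.coprod ℌ)) ≃ Pi0 (Bun Γ 𝔊) × Pi0 (Bun Γ ℌ) where
  toFun P := (res (inl 𝔊 ℌ) P, res (inr 𝔊 ℌ) P)
  invFun P := Bun.cls (copair P.1.out P.2.out)
  left_inv P := pi0_coprod_ext (by rw [res_inl_cls_copair, Bun.cls_out])
    (by rw [res_inr_cls_copair, Bun.cls_out])
  right_inv P := Prod.ext ((res_inl_cls_copair _ _).trans (Bun.cls_out _))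
    ((res_inr_cls_copair _ _).trans (Bun.cls_out _))

lemma autCard_coprod {𝔊 ℌ : TopGrpd} (P : Pi0 (Bun Γ (𝔊.coprod ℌ))) :
    autCard P = autCard (res (inl 𝔊 ℌ) P) * autCard (res (inr 𝔊 ℌ) P) := by
  rw [← Bun.cls_out P, res_cls, res_cls, autCard_cls, autCard_cls, autCard_cls, ← Nat.card_prod]
  refine Nat.card_congr ⟨fun a => (isoWhiskerLeft (inl 𝔊 ℌ) a, isoWhiskerLeft (inr 𝔊 ℌ) a),
    fun a => coprodIsoExt a.1 a.2, fun a => Iso.ext (ContFunctor.hom_ext fun x => ?_), fun a => Prod.ext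
      (Iso.ext (ContFunctor.hom_ext fun x => ?_)) (Iso.ext (ContFunctor.hom_ext fun x => ?_))⟩
  · obtain x | x := x
    · exact coprodIsoExt_inl _ _ x
    · exact coprodIsoExt_inr _ _ x
  · exact coprodIsoExt_inl a.1 a.2 x
  · exact coprodIsoExt_inr a.1 a.2 x

lemma autCard_empty (P : Pi0 (Bun Γ (PGrpd.empty p).toTopGrpd)) : autCard P = 1 := by
  rw [← Bun.cls_out P, autCard_cls]
  have : Unique (Aut P.out) :=
    ⟨⟨1⟩, fun a => Iso.ext (ContFunctor.hom_ext fun x => (x : PEmpty).elim)⟩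
  exact Nat.card_unique

variable [Finite Γ]

/-- The indicator function of a class on the coproduct is the product of two indicator functions,
which gives surjectivity; the dimensions agree. -/
lemma boxMap_bijective (𝔊 ℌ : PGrpd p) : Function.Bijective (boxMap Γ 𝔊 ℌ) := by
  classical
  have := Fintype.ofFinite (Pi0 (Bun Γ 𝔊.toTopGrpd))
  have := Fintype.ofFinite (Pi0 (Bun Γ ℌ.toTopGrpd))
  have : Fintype (Pi0 (Bun Γ (𝔊.coprod ℌ).toTopGrpd)) := Fintype.ofFinite _
  let _ : Fintype (Pi0 (Bun Γ (𝔊.toTopGrpd.coprod ℌ.toTopGrpd))) := this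
  have hd : Module.finrank ℂ (TensorProduct ℂ (Fld Γ 𝔊) (Fld Γ ℌ)) =
      Module.finrank ℂ (Fld Γ (𝔊.coprod ℌ)) := by
    rw [Module.finrank_tensorProduct, Module.finrank_pi, Module.finrank_pi, Module.finrank_pi,
      ← Fintype.card_prod]
    exact (Fintype.card_congr (pi0CoprodEquiv 𝔊.toTopGrpd ℌ.toTopGrpd)).symm
  have hs : Function.Surjective (boxMap Γ 𝔊 ℌ) := by
    rw [← LinearMap.range_eq_top, eq_top_iff, ← (Pi.basisFun ℂ _).span_eq, Submodule.span_le]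
    rintro _ ⟨P, rfl⟩
    refine ⟨Pi.single (res (inl _ _) P) 1 ⊗ₜ Pi.single (res (inr _ _) P) 1, funext fun Q => ?_⟩
    rw [Pi.basisFun_apply]
    change Pi.single (M := fun _ => ℂ) (res (inl _ _) P) 1 (res (inl 𝔊.toTopGrpd ℌ.toTopGrpd) Q) *
      Pi.single (M := fun _ => ℂ) (res (inr _ _) P) 1 (res (inr 𝔊.toTopGrpd ℌ.toTopGrpd) Q) = _
    simp only [Pi.single_apply, ← ite_and, mul_ite, mul_one, mul_zero]
    refine if_congr ⟨fun h => pi0_coprod_ext h.2 h.1, fun h => ?_⟩ rfl rfl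
    rw [h]
    exact ⟨rfl, rfl⟩
  exact ⟨(LinearMap.injective_iff_surjective_of_finrank_eq_finrank hd).mpr hs, hs⟩

lemma ite_and_mul (A B : Prop) [Decidable A] [Decidable B] (a b c d x y : ℂ) :
    (if A ∧ B then a * b / (c * d) * (x * y) else 0) =
      (if A then a / c * x else 0) * if B then b / d * y else 0 := by
  by_cases hA : A <;> by_cases hB : B <;> simp [hA, hB, mul_div_mul_comm]
  ring

/-- The classes on the coproduct of the apices are pairs, and both the boundary conditions and the
automorphism weights are products, so the sum factors. -/
lemma pullPush_coprod {𝔊 ℌ 𝔊' ℌ' : PGrpd p} (C : Cospan 𝔊 𝔊') (D : Cospan ℌ ℌ') (F : Fld Γ 𝔊)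
    (F' : Fld Γ ℌ) : pullPush (C.coprod D) (box F F') = box (pullPush C F) (pullPush D F') := by
  classical
  have := Fintype.ofFinite (Pi0 (Bun Γ C.apex.toTopGrpd))
  have := Fintype.ofFinite (Pi0 (Bun Γ D.apex.toTopGrpd))
  have : Fintype (Pi0 (Bun Γ (C.apex.coprod D.apex).toTopGrpd)) := Fintype.ofFinite _
  let _ : Fintype (Pi0 (Bun Γ (C.apex.toTopGrpd.coprod D.apex.toTopGrpd))) := this
  refine funext fun P => (pullPush_mk_apply (𝔎 := C.apex.coprod D.apex) _ _ _ _).trans ?_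
  rw [box, pullPush_apply, pullPush_apply, Finset.sum_mul_sum, ← Fintype.sum_prod_type']
  refine Fintype.sum_equiv (pi0CoprodEquiv _ _) _ _ fun Q => ?_
  have hr : res (coprodMap C.right D.right) Q = P ↔
      res C.right (res (inl _ _) Q) = res (inl _ _) P ∧
        res D.right (res (inr _ _) Q) = res (inr _ _) P := by
    rw [← res_comp, ← res_comp, ← res_copair_inl (C.right.comp (inl _ _)) (D.right.comp (inr _ _)),
      ← res_copair_inr (C.right.comp (inl _ _)) (D.right.comp (inr _ _))]
    exact ⟨fun h => h ▸ ⟨rfl, rfl⟩, fun h => pi0_coprod_ext h.1 h.2⟩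
  have hl : box F F' (res (coprodMap C.left D.left) Q) =
      F (res C.left (res (inl _ _) Q)) * F' (res D.left (res (inr _ _) Q)) := by
    rw [← res_comp, ← res_comp]
    exact congrArg₂ (fun x y => F x * F' y)
      (res_copair_inl (C.left.comp (inl _ _)) (D.left.comp (inr _ _)) Q)
      (res_copair_inr (C.left.comp (inl _ _)) (D.left.comp (inr _ _)) Q)
  have hP : (autCard P : ℂ) = autCard (res (inl _ _) P) * autCard (res (inr _ _) P) := by
    exact_mod_cast autCard_coprod P
  have hQ : (autCard Q : ℂ) = autCard (res (inl _ _) Q) * autCard (res (inr _ _) Q) := by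
    exact_mod_cast autCard_coprod Q
  refine Eq.trans ?_ (ite_and_mul _ _ _ _ _ _ _ _)
  exact @if_congr _ _ _ _ _ _ _ _ _ hr (congrArg₂ (· * ·) (congrArg₂ (· / ·) hP hQ) hl) rfl

lemma dwMap_tensor {𝔊 ℌ 𝔊' ℌ' : PGrpd p} (c : CospanHom 𝔊 𝔊') (d : CospanHom ℌ ℌ') (F : Fld Γ 𝔊)
    (F' : Fld Γ ℌ) : dwMap Γ (CospanHom.tensor c d) (box F F') = box (dwMap Γ c F) (dwMap Γ d F') := by
  obtain ⟨C, rfl⟩ := c.exists_rep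
  obtain ⟨D, rfl⟩ := d.exists_rep
  exact pullPush_coprod C D F F'

lemma sharp_assocFun {𝔊 ℌ 𝔎 : PGrpd p} (F : Fld Γ 𝔊) (F' : Fld Γ ℌ) (F'' : Fld Γ 𝔎) :
    sharp Γ (assocFun 𝔊 ℌ 𝔎) (box (box F F') F'') = box F (box F' F'') := by
  refine funext fun P => (sharp_apply _ _ _).trans ?_
  induction P using Quotient.inductionOn
  exact mul_assoc _ _ _

lemma sharp_leftUnitorFun {𝔊 : PGrpd p} (c : ℂ) (F : Fld Γ 𝔊) :
    sharp Γ (leftUnitorFun 𝔊) (box (c • fun _ => 1) F) = c • F := by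
  refine funext fun P => (sharp_apply _ _ _).trans ?_
  induction P using Quotient.inductionOn
  exact congrArg (· * _) (mul_one c)

lemma sharp_rightUnitorFun {𝔊 : PGrpd p} (c : ℂ) (F : Fld Γ 𝔊) :
    sharp Γ (rightUnitorFun 𝔊) (box F (c • fun _ => 1)) = c • F := by
  refine funext fun P => (sharp_apply _ _ _).trans ?_
  induction P using Quotient.inductionOn
  exact (congrArg (_ * ·) (mul_one c)).trans (mul_comm _ _)

lemma sharp_swapFun {𝔊 ℌ : PGrpd p} (F : Fld Γ 𝔊) (F' : Fld Γ ℌ) :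
    sharp Γ (swapFun 𝔊 ℌ) (box F F') = box F' F := by
  refine funext fun P => (sharp_apply _ _ _).trans ?_
  induction P using Quotient.inductionOn
  exact mul_comm _ _

end Coprod

/-! ### The symmetric monoidal structure -/

section Braided

variable {p : ℕ} {Γ : Type} [Group Γ] [TopologicalSpace Γ] [DiscreteTopology Γ] [Finite Γ]

instance : Unique (Pi0 (Bun Γ (PGrpd.empty p).toTopGrpd)) where
  default := Bun.cls (fromEmpty p _)
  uniq P := by
    rw [← Bun.cls_out P]
    exact Bun.cls_eq_iff.mpr ⟨fromEmptyIso _ _⟩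

/-- The isomorphism `epsHom`. -/
def epsIso (Γ : Type) [Group Γ] [TopologicalSpace Γ] [DiscreteTopology Γ] [Finite Γ] (p : ℕ) :
    𝟙_ (FGModuleCat.{0} ℂ) ≅ dwObj Γ (PGrpd.empty p) :=
  LinearEquiv.toFGModuleCatIso (V := ℂ) (W := Fld Γ (PGrpd.empty p))
    (LinearEquiv.ofBijective (LinearMap.toSpanSingleton ℂ _ fun _ => 1)
      ⟨fun a b h => by simpa using congrFun h default, fun F => ⟨F default, funext fun P => by
        rw [Unique.eq_default P]; simp⟩⟩)

/-- The isomorphism `muHom`. -/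
def muIso (Γ : Type) [Group Γ] [TopologicalSpace Γ] [DiscreteTopology Γ] [Finite Γ] {p : ℕ}
    (𝔊 ℌ : PGrpd p) : dwObj Γ 𝔊 ⊗ dwObj Γ ℌ ≅ dwObj Γ (𝔊.coprod ℌ) :=
  let e := LinearEquiv.ofBijective (boxMap Γ 𝔊 ℌ) (boxMap_bijective 𝔊 ℌ)
  { hom := muHom Γ 𝔊 ℌ
    inv := ⟨ModuleCat.ofHom e.symm.toLinearMap⟩
    hom_inv_id := FGModuleCat.hom_ext e.symm_comp
    inv_hom_id := FGModuleCat.hom_ext e.comp_symm }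

/-- The monoidal structure of the Dijkgraaf–Witten functor. -/
def dwCoreMonoidal (h : CospanLaws p) (hZ : DWLaws p Γ) : (dwFunctor h hZ).CoreMonoidal where
  εIso := epsIso Γ p
  μIso 𝔊 ℌ := muIso (p := p) Γ 𝔊 ℌ
  μIso_hom_natural_left {𝔊 𝔊'} c ℌ := by
    -- Whiskering is the tensor product with an identity cospan, so on pure tensors naturality is
    -- `dwMap_tensor`. The unit, associativity and symmetry axioms likewise become identities
    -- between products of values of functions.
    refine FGModuleCat.hom_ext (TensorProduct.ext' fun F F' => ?_)
    refine Eq.trans ?_ (dwMap_tensor (p := p) (𝔊 := 𝔊) (𝔊' := 𝔊') c (CospanHom.idn ℌ) F F').symm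
    exact congrArg (box (dwMap Γ c F)) (congrArg (fun l => l F') (hZ.map_id ℌ)).symm
  μIso_hom_natural_right {𝔊 𝔊'} ℌ c := by
    refine FGModuleCat.hom_ext (TensorProduct.ext' fun F F' => ?_)
    refine Eq.trans ?_ (dwMap_tensor (p := p) (ℌ := 𝔊) (ℌ' := 𝔊') (CospanHom.idn ℌ) c F F').symm
    exact congrArg (fun G => box G (dwMap Γ c F')) (congrArg (fun l => l F) (hZ.map_id ℌ)).symm
  associativity 𝔊 ℌ 𝔎 := by
    refine FGModuleCat.hom_ext (TensorProduct.ext_threefold fun F F' F'' => ?_)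
    exact sharp_assocFun (p := p) (𝔊 := 𝔊) (ℌ := ℌ) (𝔎 := 𝔎) F F' F''
  left_unitality 𝔊 := by
    refine FGModuleCat.hom_ext (TensorProduct.ext' fun c F => ?_)
    exact (sharp_leftUnitorFun (p := p) (𝔊 := 𝔊) c F).symm
  right_unitality 𝔊 := by
    refine FGModuleCat.hom_ext (TensorProduct.ext' fun F c => ?_)
    exact (sharp_rightUnitorFun (p := p) (𝔊 := 𝔊) c F).symm

/-- The Dijkgraaf–Witten functor is symmetric monoidal. -/
@[reducible]
def dwBraided (h : CospanLaws p) (hZ : DWLaws p Γ) : (dwFunctor h hZ).Braided where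
  toMonoidal := (dwCoreMonoidal h hZ).toMonoidal
  braided 𝔊 ℌ := by
    refine FGModuleCat.hom_ext (TensorProduct.ext' fun F F' => ?_)
    exact sharp_swapFun (p := p) (𝔊 := 𝔊) (ℌ := ℌ) F F'

lemma dwBraided_eps (h : CospanLaws p) (hZ : DWLaws p Γ) :
    (dwBraided h hZ).toMonoidal.toLaxMonoidal.ε = epsHom Γ p := rfl

lemma dwBraided_mu (h : CospanLaws p) (hZ : DWLaws p Γ) (𝔊 ℌ : PGrpd p) :
    (dwBraided h hZ).toMonoidal.toLaxMonoidal.μ (𝔊 : CospanCat h) (ℌ : CospanCat h) =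
      muHom Γ 𝔊 ℌ := rfl

end Braided

end ProPDW
end

open CategoryTheory MonoidalCategory

noncomputable section

namespace ProPDW

open ContFunctor

/-! ### Bundles on `∐ BNᵢ` and on `BG` -/

section Fam

variable {p : ℕ} {Γ : Type} [Group Γ] [TopologicalSpace Γ] [DiscreteTopology Γ]

/-- The value at an object of a natural transformation between bundles, as an element of `Γ`. -/
def Bun.homVal {𝔊 : TopGrpd} {P Q : Bun Γ 𝔊} (a : P ⟶ Q) (x : 𝔊.Obj) : Γ := NatTrans.app a x

lemma Bun.homVal_mul {𝔊 : TopGrpd} {P Q : Bun Γ 𝔊} (a : P ⟶ Q) {x y : 𝔊.Obj} (f : x ⟶ y) :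
    Bun.homVal a y * P.val f = Q.val f * Bun.homVal a x := naturality a f

section

variable {I : Type} {N : I → Type} [∀ i, Group (N i)] [∀ i, TopologicalSpace (N i)]
  [∀ i, IsTopologicalGroup (N i)]

lemma exists_bunHom_fam (P Q : Bun Γ (TopGrpd.fam N)) (γ : I → Γ)
    (h : ∀ i a, γ i * P.val (famLoop i a) = Q.val (famLoop i a) * γ i) :
    ∃ e : P ≅ Q, ∀ i, Bun.homVal e.hom (famPt N i) = γ i := by
  obtain ⟨α, hα⟩ := exists_hom_fam P Q (fun i => (γ i : Γ)) h
  exact ⟨homIso α, hα⟩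

lemma val_famMap (σ : ∀ i, N i →ₜ* Γ) (i : I) (a : N i) :
    Bun.val (famMap σ) (famLoop i a) = σ i a := rfl

/-- The holonomy of `P` at each loop gives `σ`, and the constant family `1` is the isomorphism. -/
lemma exists_cls_famMap (P : Bun Γ (TopGrpd.fam N)) :
    ∃ σ : ∀ i, N i →ₜ* Γ, Bun.cls (famMap σ) = Bun.cls P := by
  let σ : ∀ i, N i →ₜ* Γ := fun i =>
    { toFun := fun a => P.val (famLoop i a)
      map_one' := P.val_id _
      map_mul' := fun a b => P.val_comp (famLoop i b) (famLoop i a)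
      continuous_toFun := (P.continuous_map (famPt N i) (famPt N i)).comp
        (Continuous.subtype_mk continuous_id _) }
  obtain ⟨e, -⟩ := exists_bunHom_fam (famMap σ) P 1 fun i a => by
    rw [val_famMap, Pi.one_apply, one_mul, mul_one]
    rfl
  exact ⟨σ, Bun.cls_eq_iff.mpr ⟨e⟩⟩

lemma cls_famMap_eq_iff (σ σ' : ∀ i, N i →ₜ* Γ) :
    Bun.cls (famMap σ) = Bun.cls (famMap σ') ↔ ∀ i, HomConj (σ i) (σ' i) := by
  rw [Bun.cls_eq_iff]
  constructor
  · rintro ⟨e⟩ i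
    refine ⟨Bun.homVal e.hom (famPt N i), fun a => ?_⟩
    rw [eq_mul_inv_iff_mul_eq]
    exact (Bun.homVal_mul e.hom (famLoop i a)).symm
  · intro h
    choose γ hγ using h
    obtain ⟨e, -⟩ := exists_bunHom_fam (famMap σ) (famMap σ') γ fun i a => by
      rw [val_famMap, val_famMap, hγ, inv_mul_cancel_right]
    exact ⟨e⟩

/-- The components of an automorphism can be chosen independently, each subject only to commuting
with the holonomy at its object. -/
lemma autCard_famMap [Fintype I] (σ : ∀ i, N i →ₜ* Γ) :
    autCard (Bun.cls (famMap σ)) = ∏ i, centCard (σ i) := by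
  rw [autCard_cls]
  simp only [centCard]
  rw [← Nat.card_pi]
  let m : Aut (famMap σ) → ∀ i, Subgroup.centralizer (Set.range (σ i)) := fun e i =>
    ⟨Bun.homVal e.hom (famPt N i), by
      rw [Subgroup.mem_centralizer_iff]
      rintro _ ⟨a, rfl⟩
      exact (Bun.homVal_mul e.hom (famLoop i a)).symm⟩
  refine Nat.card_congr (Equiv.ofBijective m ⟨fun e e' h => Iso.ext (ContFunctor.hom_ext ?_),
    fun γ => ?_⟩)
  · rintro ⟨i⟩
    exact congrArg Subtype.val (congrFun h i)
  · obtain ⟨e, he⟩ := exists_bunHom_fam (famMap σ) (famMap σ) (fun i => γ i) fun i a =>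
      ((Subgroup.mem_centralizer_iff.mp (γ i).2) _ ⟨a, rfl⟩).symm
    exact ⟨e, funext fun i => Subtype.ext (he i)⟩

end

section B

variable {G : Type} [Group G] [TopologicalSpace G] [IsTopologicalGroup G]

variable (G) in
/-- The object of `BG`. -/
def bPt : (TopGrpd.B G).Obj := SingleObj.star G

/-- An element of `G`, as an automorphism in `BG`. -/
def bLoop (a : G) : bPt G ⟶ bPt G := a

lemma val_bMap (ρ : G →ₜ* Γ) (a : G) : Bun.val (bMap ρ) (bLoop a) = ρ a := rfl

lemma exists_bunHom_b (P Q : Bun Γ (TopGrpd.B G)) (γ : Γ)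
    (h : ∀ a, γ * P.val (bLoop a) = Q.val (bLoop a) * γ) :
    ∃ e : P ≅ Q, Bun.homVal e.hom (bPt G) = γ :=
  ⟨homIso ({ app := fun _ => (γ : Γ), naturality := fun _ _ a => h a } :
    P.toFunctor ⟶ Q.toFunctor), rfl⟩

lemma exists_cls_bMap (P : Bun Γ (TopGrpd.B G)) : ∃ ρ : G →ₜ* Γ, Bun.cls (bMap ρ) = Bun.cls P := by
  let ρ : G →ₜ* Γ :=
    { toFun := fun a => P.val (bLoop a)
      map_one' := P.val_id _
      map_mul' := fun a b => P.val_comp (bLoop b) (bLoop a)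
      continuous_toFun := P.continuous_map (bPt G) (bPt G) }
  obtain ⟨e, -⟩ := exists_bunHom_b (bMap ρ) P 1 fun a => by
    rw [val_bMap, one_mul, mul_one]
    rfl
  exact ⟨ρ, Bun.cls_eq_iff.mpr ⟨e⟩⟩

lemma cls_bMap_eq_iff (ρ ρ' : G →ₜ* Γ) :
    Bun.cls (bMap ρ) = Bun.cls (bMap ρ') ↔ HomConj ρ ρ' := by
  rw [Bun.cls_eq_iff]
  constructor
  · rintro ⟨e⟩
    refine ⟨Bun.homVal e.hom (bPt G), fun a => ?_⟩
    rw [eq_mul_inv_iff_mul_eq]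
    exact (Bun.homVal_mul e.hom (bLoop a)).symm
  · rintro ⟨γ, hγ⟩
    obtain ⟨e, -⟩ := exists_bunHom_b (bMap ρ) (bMap ρ') γ fun a => by
      rw [val_bMap, val_bMap, hγ, inv_mul_cancel_right]
    exact ⟨e⟩

lemma autCard_bMap (ρ : G →ₜ* Γ) : autCard (Bun.cls (bMap ρ)) = centCard ρ := by
  rw [autCard_cls]
  let m : Aut (bMap ρ) → Subgroup.centralizer (Set.range ρ) := fun e =>
    ⟨Bun.homVal e.hom (bPt G), by
      rw [Subgroup.mem_centralizer_iff]
      rintro _ ⟨a, rfl⟩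
      exact (Bun.homVal_mul e.hom (bLoop a)).symm⟩
  refine Nat.card_congr (Equiv.ofBijective m ⟨fun e e' h => Iso.ext (ContFunctor.hom_ext ?_),
    fun γ => ?_⟩)
  · intro _
    exact congrArg Subtype.val h
  · obtain ⟨e, he⟩ := exists_bunHom_b (bMap ρ) (bMap ρ) γ.1 fun a =>
      ((Subgroup.mem_centralizer_iff.mp γ.2) _ ⟨a, rfl⟩).symm
    exact ⟨e, Subtype.ext he⟩

variable (G Γ) in
/-- Classes of bundles on `BG` are conjugacy classes of homomorphisms. -/
def homClsEquiv : HomCls G Γ ≃ Pi0 (Bun Γ (TopGrpd.B G)) :=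
  Equiv.ofBijective (Quotient.lift (fun ρ => Bun.cls (bMap ρ)) fun ρ ρ' h =>
    (cls_bMap_eq_iff ρ ρ').mpr h) ⟨by
      rintro ⟨ρ⟩ ⟨ρ'⟩ h
      exact Quotient.sound ((cls_bMap_eq_iff ρ ρ').mp h), by
      intro P
      obtain ⟨ρ, hρ⟩ := exists_cls_bMap P.out
      exact ⟨Quotient.mk _ ρ, hρ.trans (Bun.cls_out P)⟩⟩

lemma homClsEquiv_apply (c : HomCls G Γ) : homClsEquiv Γ G c = Bun.cls (bMap c.out) := by
  conv_lhs => rw [← Quotient.out_eq c]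
  rfl

lemma IsFinPres.finite_hom {G : Type} [Group G] [TopologicalSpace G] [Finite Γ] (hG : IsFinPres p G) : Finite (G →ₜ* Γ) := by
  obtain ⟨-, n, π, R, hs, -⟩ := hG
  refine Finite.of_injective (fun (ρ : G →ₜ* Γ) (k : Fin n) => ρ (π (FreeProP.gen p k)))
    fun ρ ρ' h => ?_
  have h' : ρ.comp π = ρ'.comp π := FreeProP.hom_ext fun k => congrFun h k
  ext x
  obtain ⟨y, rfl⟩ := hs x
  exact DFunLike.congr_fun h' y

lemma IsFinPres.finite_homCls {G : Type} [Group G] [TopologicalSpace G] [Finite Γ] (hG : IsFinPres p G) : Finite (HomCls G Γ) :=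
  have := hG.finite_hom (Γ := Γ)
  Quotient.finite _

/-- The classes of bundles on the apex are reindexed by `homClsEquiv`, and automorphism groups
become centralizers. -/
lemma dwMap_fam [Finite Γ] {I J : Type} [Finite I] [Fintype J] (N : I → Type) (U : J → Type)
    [∀ i, Group (N i)] [∀ i, TopologicalSpace (N i)] [∀ i, IsTopologicalGroup (N i)]
    [∀ j, Group (U j)] [∀ j, TopologicalSpace (U j)] [∀ j, IsTopologicalGroup (U j)]
    (hN : ∀ i, IsFinPres p (N i)) (hU : ∀ j, IsFinPres p (U j)) (hG : IsFinPres p G)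
    (φ : ∀ i, N i →ₜ* G) (τ : ∀ j, U j →ₜ* G) (F : Fld Γ (PGrpd.fam N hN)) (σ : ∀ j, U j →ₜ* Γ) :
    dwMap Γ (Cospan.cls (𝔊 := PGrpd.fam N hN) (ℌ := PGrpd.fam U hU)
        ⟨PGrpd.B G hG, famMap φ, famMap τ⟩) F (Bun.cls (famMap σ)) =
      ∑ᶠ (ρ : HomCls G Γ) (_ : ∀ j, HomConj (ρ.out.comp (τ j)) (σ j)),
        (∏ j, (centCard (σ j) : ℂ)) / (centCard ρ.out : ℂ) *
          F (Bun.cls (famMap fun i => ρ.out.comp (φ i))) := by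
  classical
  have := hG.finite_homCls (Γ := Γ)
  have := Fintype.ofFinite (HomCls G Γ)
  have : Fintype (Pi0 (Bun Γ (PGrpd.B G hG).toTopGrpd)) := Fintype.ofFinite _
  let _ : Fintype (Pi0 (Bun Γ (TopGrpd.B G))) := this
  rw [dwMap_cls]
  refine (pullPush_mk_apply _ _ _ _).trans ?_
  rw [finsum_eq_sum_of_fintype]
  symm
  refine Fintype.sum_equiv (homClsEquiv Γ G) _ _ fun ρ => ?_
  rw [finsum_eq_if, homClsEquiv_apply]
  have h1 : (autCard (Bun.cls (famMap σ)) : ℂ) = ∏ j, (centCard (σ j) : ℂ) := by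
    rw [autCard_famMap, Nat.cast_prod]
  have h2 : (autCard (Bun.cls (bMap ρ.out)) : ℂ) = centCard ρ.out := by rw [autCard_bMap]
  exact @if_congr _ _ _ _ _ _ _ _ _ ((cls_famMap_eq_iff (fun j => ρ.out.comp (τ j)) σ).symm)
    (congrArg₂ (· * ·) (congrArg₂ (· / ·) h1.symm h2.symm) rfl) rfl

/-! ### Sums over homomorphisms -/

/-- Orbit-stabilizer for conjugation on homomorphisms: the orbit is the isomorphism class of bundles
and the stabilizer is the centralizer of the image. -/
lemma card_homConj_mul [Finite Γ] [Fintype (G →ₜ* Γ)] [DecidableEq (Pi0 (Bun Γ (TopGrpd.B G)))]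
    (Q : Pi0 (Bun Γ (TopGrpd.B G))) :
    (Finset.univ.filter fun ρ : G →ₜ* Γ => Bun.cls (bMap ρ) = Q).card * autCard Q =
      Nat.card Γ := by
  obtain ⟨ρ, hρ⟩ := exists_cls_bMap Q.out
  rw [Bun.cls_out] at hρ
  subst hρ
  rw [autCard_bMap, ← Fintype.card_subtype, ← Nat.card_eq_fintype_card,
    ← Subgroup.index_mul_card (Subgroup.centralizer (Set.range ρ))]
  refine congrArg (· * _) ?_
  let conj : Γ → {ρ' : G →ₜ* Γ // Bun.cls (bMap ρ') = Bun.cls (bMap ρ)} := fun γ =>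
    ⟨{ toFun := fun a => γ * ρ a * γ⁻¹
       map_one' := by simp
       map_mul' := fun a b => by simp
       continuous_toFun := (continuous_of_discreteTopology (f := fun g : Γ => γ * g * γ⁻¹)).comp
        ρ.continuous_toFun }, ((cls_bMap_eq_iff _ _).mpr ⟨γ, fun a => rfl⟩).symm⟩
  have hc : ∀ γ δ, conj γ = conj δ ↔ γ⁻¹ * δ ∈ Subgroup.centralizer (Set.range ρ) := by
    intro γ δ
    rw [Subtype.ext_iff, DFunLike.ext_iff, Subgroup.mem_centralizer_iff, Set.forall_mem_range]
    refine forall_congr' fun a => ?_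
    change γ * ρ a * γ⁻¹ = δ * ρ a * δ⁻¹ ↔ ρ a * (γ⁻¹ * δ) = γ⁻¹ * δ * ρ a
    constructor
    · intro h
      calc ρ a * (γ⁻¹ * δ) = γ⁻¹ * (γ * ρ a * γ⁻¹) * δ := by group
        _ = γ⁻¹ * δ * ρ a := by rw [h]; group
    · intro h
      calc γ * ρ a * γ⁻¹ = γ * (ρ a * (γ⁻¹ * δ)) * δ⁻¹ := by group
        _ = δ * ρ a * δ⁻¹ := by rw [h]; group
  refine (Nat.card_congr (Equiv.ofBijective (Quotient.lift conj ?_) ⟨?_, ?_⟩)).symm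
  · intro γ δ h
    exact (hc γ δ).mpr (QuotientGroup.leftRel_apply.mp h)
  · rintro ⟨γ⟩ ⟨δ⟩ h
    exact Quotient.sound (QuotientGroup.leftRel_apply.mpr ((hc γ δ).mp h))
  · rintro ⟨ρ', h⟩
    obtain ⟨γ, hγ⟩ := (cls_bMap_eq_iff _ _).mp h.symm
    exact ⟨QuotientGroup.mk γ, Subtype.ext (DFunLike.ext _ _ fun a => (hγ a).symm)⟩

open Classical in
/-- The linear map of a cospan with apex `BG`, as a sum over homomorphisms. -/
lemma dwMap_b_apply [Finite Γ] {𝔊 ℌ : PGrpd p} (hG : IsFinPres p G) [Fintype (G →ₜ* Γ)]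
    (l : 𝔊.Fun (PGrpd.B G hG)) (r : ℌ.Fun (PGrpd.B G hG)) (F : Fld Γ 𝔊)
    (P : Pi0 (Bun Γ ℌ.toTopGrpd)) :
    dwMap Γ (Cospan.cls ⟨PGrpd.B G hG, l, r⟩) F P = (autCard P : ℂ) / (Nat.card Γ : ℂ) *
      ∑ ρ : G →ₜ* Γ, if res r (Bun.cls (bMap ρ)) = P then F (res l (Bun.cls (bMap ρ))) else 0 := by
  have : Fintype (Pi0 (Bun Γ (PGrpd.B G hG).toTopGrpd)) := Fintype.ofFinite _
  rw [dwMap_cls]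
  refine (pullPush_mk_apply l r F P).trans ?_
  -- The homomorphisms are grouped by the class `Q` of the bundle; each class has `|Γ| / |Aut Q|`
  -- members, which accounts for the weight.
  rw [← Finset.sum_fiberwise (s := Finset.univ)
    (g := fun ρ : G →ₜ* Γ => (Bun.cls (bMap ρ) : Pi0 (Bun Γ (PGrpd.B G hG).toTopGrpd))),
    Finset.mul_sum]
  refine Finset.sum_congr rfl fun Q _ => ?_
  have h1 : ∀ ρ ∈ Finset.univ.filter (fun ρ : G →ₜ* Γ =>
      (Bun.cls (bMap ρ) : Pi0 (Bun Γ (PGrpd.B G hG).toTopGrpd)) = Q),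
      (if res r (Bun.cls (bMap ρ)) = P then F (res l (Bun.cls (bMap ρ))) else 0) =
        if res r Q = P then F (res l Q) else 0 := by
    intro ρ hρ
    rw [(Finset.mem_filter.mp hρ).2]
  have h2 := card_homConj_mul (G := G) (Γ := Γ) Q
  have h3 : (autCard Q : ℂ) ≠ 0 := autCard_ne_zero (𝔊 := PGrpd.B G hG) Q
  have h4 : (Nat.card Γ : ℂ) ≠ 0 := by exact_mod_cast Nat.card_pos.ne'
  rw [Finset.sum_congr rfl h1, Finset.sum_const, nsmul_eq_mul]
  split_ifs
  · have h5 : ((Finset.univ.filter (fun ρ : G →ₜ* Γ =>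
      (Bun.cls (bMap ρ) : Pi0 (Bun Γ (PGrpd.B G hG).toTopGrpd)) = Q)).card : ℂ) * autCard Q =
        Nat.card Γ := by
      exact_mod_cast h2
    rw [div_mul_eq_mul_div, div_mul_eq_mul_div, div_eq_div_iff h3 h4, ← h5]
    ring
  · simp

end B

end Fam

end ProPDW
end

open CategoryTheory MonoidalCategory

noncomputable section

namespace ProPDW

/-! ### Characters of finite groups -/

section Characters

variable {Γ : Type} [Group Γ]

/-- Schur's lemma. -/
lemma exists_eq_smul_one (V : FDRep ℂ Γ) [Simple V] (T : V →ₗ[ℂ] V)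
    (hT : ∀ v, T ∘ₗ V.ρ v = V.ρ v ∘ₗ T) : ∃ c : ℂ, T = c • LinearMap.id := by
  let f : V ⟶ V := ⟨InducedCategory.homMk (ModuleCat.ofHom T), fun v => by
    refine FGModuleCat.hom_ext ?_
    exact hT v⟩
  obtain ⟨c, hc⟩ := endomorphism_simple_eq_smul_id ℂ f
  exact ⟨c, (congrArg (fun g : V ⟶ V => g.hom.hom.hom) hc).symm⟩

lemma finrank_ne_zero_of_simple (V : FDRep ℂ Γ) [Simple V] : (Module.finrank ℂ V : ℂ) ≠ 0 := by
  intro h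
  have h0 : Module.finrank ℂ V = 0 := by exact_mod_cast h
  have : Subsingleton V := Module.finrank_zero_iff.mp h0
  refine id_nonzero V ?_
  refine Action.Hom.ext (FGModuleCat.hom_ext (LinearMap.ext fun x => ?_))
  exact Subsingleton.elim (α := V) _ _

variable [Fintype Γ]

/-- A class function acts centrally, hence by a scalar by Schur's lemma, and the trace determines
the scalar. -/
lemma sum_mul_character (V : FDRep ℂ Γ) [Simple V] (f : Γ → ℂ)
    (hf : ∀ u a, f (u * a * u⁻¹) = f a) :
    ∑ h, f h • V.ρ h = ((∑ h, f h * V.character h) / Module.finrank ℂ V) • LinearMap.id := by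
  obtain ⟨c, hc⟩ := exists_eq_smul_one V (∑ h, f h • V.ρ h) fun v => by
    have key : (∑ h, f h • V.ρ h) * V.ρ v = V.ρ v * ∑ h, f h • V.ρ h := by
      rw [Finset.sum_mul, Finset.mul_sum]
      refine Fintype.sum_equiv (MulAut.conj v⁻¹).toEquiv _ _ fun h => ?_
      have hc : (MulAut.conj v⁻¹).toEquiv h = v⁻¹ * h * v := by simp
      rw [hc, smul_mul_assoc, mul_smul_comm, ← map_mul, ← map_mul]
      have := hf v⁻¹ h
      rw [inv_inv] at this
      rw [this]
      congr 2
      group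
    exact key
  rw [hc]
  have ht := congrArg (LinearMap.trace ℂ V) hc
  rw [map_sum, map_smul, LinearMap.trace_id] at ht
  simp only [map_smul, smul_eq_mul] at ht
  rw [show ∑ h, f h * V.character h = c * Module.finrank ℂ V from ht,
    mul_div_cancel_right₀ _ (finrank_ne_zero_of_simple V)]

lemma sum_mul_character_mul (V : FDRep ℂ Γ) [Simple V] (f : Γ → ℂ)
    (hf : ∀ u a, f (u * a * u⁻¹) = f a) (k : Γ) :
    ∑ h, f h * V.character (h * k) =
      (∑ h, f h * V.character h) / Module.finrank ℂ V * V.character k := by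
  have h1 := congrArg (fun T : V →ₗ[ℂ] V => LinearMap.trace ℂ V (T * V.ρ k))
    (sum_mul_character V f hf)
  simp only [Finset.sum_mul, smul_mul_assoc, ← map_mul, map_sum, map_smul, smul_eq_mul] at h1
  exact h1

/-- Apply the scalar formula to the class function that counts the `u` with `u a u⁻¹ = h`. This
separation of the two arguments is the main tool for the surface words. -/
lemma sum_character_conj_mul (V : FDRep ℂ Γ) [Simple V] (a k : Γ) :
    ∑ u, V.character (u * a * u⁻¹ * k) =
      (Fintype.card Γ : ℂ) / Module.finrank ℂ V * (V.character a * V.character k) := by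
  classical
  have h1 := sum_mul_character_mul V (fun h => ∑ u, if u * a * u⁻¹ = h then (1 : ℂ) else 0)
    (fun v h => Fintype.sum_equiv (Equiv.mulLeft v⁻¹) _ _ fun u => by
      refine if_congr ?_ rfl rfl
      simp only [Equiv.coe_mulLeft]
      constructor
      · intro h'
        calc v⁻¹ * u * a * (v⁻¹ * u)⁻¹ = v⁻¹ * (u * a * u⁻¹) * v := by group
          _ = h := by rw [h']; group
      · intro h'
        rw [← h']
        group) k
  simp only [Finset.sum_mul, ite_mul, one_mul, zero_mul] at h1
  rw [Finset.sum_comm] at h1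
  simp only [Finset.sum_ite_eq, Finset.mem_univ, if_true] at h1
  rw [h1, Finset.sum_comm]
  simp only [Finset.sum_ite_eq, Finset.mem_univ, if_true, FDRep.char_conj, Finset.sum_const,
    Finset.card_univ, nsmul_eq_mul]
  ring

lemma sum_character_mul_character_inv (V : FDRep ℂ Γ) [Simple V] :
    ∑ g, V.character g⁻¹ * V.character g = Fintype.card Γ := by
  have := (FDRep.simple_iff_char_is_norm_one V).mp inferInstance
  rw [Nat.card_eq_fintype_card] at this
  rw [← this]
  exact Finset.sum_congr rfl fun g _ => mul_comm _ _

lemma sum_character_inv_mul (V : FDRep ℂ Γ) [Simple V] (k : Γ) :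
    ∑ x, V.character x⁻¹ * V.character (x * k) =
      (Fintype.card Γ : ℂ) / Module.finrank ℂ V * V.character k := by
  rw [sum_mul_character_mul V (fun x => V.character x⁻¹) (fun u a => by
    rw [← FDRep.char_conj V a⁻¹ u]; congr 1; group) k, sum_character_mul_character_inv]

/-- A simple module over the group algebra is an irreducible representation, on which the element
acts by a multiple of `∑ f χ = 0`. -/
lemma sum_single_smul_eq_zero (f : Γ → ℂ) (hf : ∀ u a, f (u * a * u⁻¹) = f a)
    (h0 : ∀ V : FDRep ℂ Γ, Simple V → ∑ h, f h * V.character h = 0) (M : Type) [AddCommGroup M]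
    [Module ℂ M] [Module (MonoidAlgebra ℂ Γ) M] [IsScalarTower ℂ (MonoidAlgebra ℂ Γ) M]
    [hM : IsSimpleModule (MonoidAlgebra ℂ Γ) M] (m : M) :
    (∑ h, MonoidAlgebra.single h (f h) : MonoidAlgebra ℂ Γ) • m = 0 := by
  let ρ := Representation.ofModule' (k := ℂ) (G := Γ) M
  have hρ : ∀ (z : MonoidAlgebra ℂ Γ) (m : M), ρ.asAlgebraHom z m = z • m := fun z m => by
    have : ρ.asAlgebraHom = Algebra.lsmul ℂ ℂ M := (MonoidAlgebra.lift ℂ _ Γ).apply_symm_apply _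
    rw [this]
    rfl
  have hirr : ρ.IsIrreducible := by
    rw [Representation.irreducible_iff_isSimpleModule_asModule]
    let e : ρ.asModule ≃ₗ[MonoidAlgebra ℂ Γ] M :=
      { ρ.asModuleEquiv with
        map_smul' := fun z m => (ρ.asModuleEquiv_map_smul z m).trans (hρ z _) }
    exact IsSimpleModule.congr e
  have hfin : Module.Finite ℂ M := by
    have : Module.Finite ℂ (MonoidAlgebra ℂ Γ) :=
      Module.Finite.equiv (MonoidAlgebra.coeffLinearEquiv ℂ).symm
    exact Module.Finite.trans (MonoidAlgebra ℂ Γ) _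
  have := invertibleOfNonzero (NeZero.ne (Nat.card Γ : ℂ))
  -- Irreducibility is carried to `FDRep` through the criterion that the character has norm one.
  have hsimple : Simple (FDRep.of ρ) := by
    rw [FDRep.simple_iff_char_is_norm_one]
    have h1 := Representation.char_orthonormal ρ ρ
    rw [if_pos ⟨Representation.Equiv.refl ρ⟩, inv_mul_eq_one₀ (NeZero.ne _)] at h1
    exact h1.symm
  have h1 := sum_mul_character (FDRep.of ρ) f hf
  rw [h0 _ hsimple, zero_div, zero_smul] at h1
  have h2 : ρ.asAlgebraHom (∑ h, MonoidAlgebra.single h (f h)) = 0 := by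
    refine Eq.trans ?_ h1
    simp only [map_sum, Representation.asAlgebraHom_single]
    rfl
  rw [← hρ, h2]
  rfl

/-- A class function which is orthogonal to all irreducible characters vanishes. -/
lemma eq_zero_of_sum_mul_character (f : Γ → ℂ) (hf : ∀ u a, f (u * a * u⁻¹) = f a)
    (h0 : ∀ V : FDRep ℂ Γ, Simple V → ∑ h, f h * V.character h = 0) : f = 0 := by
  classical
  let z : MonoidAlgebra ℂ Γ := ∑ h, MonoidAlgebra.single h (f h)
  have hz : ∀ h, z.coeff h = f h := fun h => by simp [z, Finsupp.single_apply]
  have hcent : ∀ g : Γ, z * MonoidAlgebra.single g 1 = MonoidAlgebra.single g 1 * z := by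
    intro g
    simp only [z, Finset.sum_mul, Finset.mul_sum, MonoidAlgebra.single_mul_single, mul_one, one_mul]
    refine Fintype.sum_equiv (MulAut.conj g⁻¹).toEquiv _ _ fun h => ?_
    have hc : (MulAut.conj g⁻¹).toEquiv h = g⁻¹ * h * g := by simp
    have := hf g⁻¹ h
    rw [inv_inv] at this
    rw [hc, this]
    congr 1
    group
  have hcent' : ∀ a : MonoidAlgebra ℂ Γ, z * a = a * z := by
    intro a
    induction a using MonoidAlgebra.induction_on with
    | of g => exact hcent g
    | add a b ha hb => rw [mul_add, add_mul, ha, hb]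
    | smul r a ha => rw [mul_smul_comm, smul_mul_assoc, ha]
  -- The annihilator of the central element `z` is a submodule. It contains every simple submodule,
  -- hence everything by semisimplicity, and then `z = z * 1 = 0`.
  let K : Submodule (MonoidAlgebra ℂ Γ) (MonoidAlgebra ℂ Γ) :=
    { carrier := {m | z * m = 0}
      add_mem' := fun {a b} (ha : z * a = 0) (hb : z * b = 0) => by
        change z * (a + b) = 0
        rw [mul_add, ha, hb, add_zero]
      zero_mem' := mul_zero z
      smul_mem' := fun a m (hm : z * m = 0) => by
        change z * (a * m) = 0
        rw [← mul_assoc, hcent', mul_assoc, hm, mul_zero] }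
  have hK : K = ⊤ := by
    rw [eq_top_iff, ← IsSemisimpleModule.sSup_simples_eq_top (MonoidAlgebra ℂ Γ)
      (MonoidAlgebra ℂ Γ)]
    refine sSup_le fun S (hS : IsSimpleModule _ S) m hm => ?_
    exact congrArg Subtype.val (sum_single_smul_eq_zero f hf h0 S ⟨m, hm⟩)
  have h1 : z * 1 = 0 := by
    have : (1 : MonoidAlgebra ℂ Γ) ∈ K := by rw [hK]; trivial
    exact this
  funext h
  rw [← hz, ← mul_one z, h1]
  rfl

/-- The second orthogonality relation. -/
lemma sum_character_mul_character_inv_eq [DecidableEq Γ] {ι : Type} [Fintype ι]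
    (V : ι → FDRep ℂ Γ) (hV : ∀ i, Simple (V i)) (hinj : ∀ i j, Nonempty (V i ≅ V j) → i = j)
    (hsurj : ∀ W : FDRep ℂ Γ, Simple W → ∃ i, Nonempty (W ≅ V i)) (g h : Γ) :
    ∑ i, (V i).character g * (V i).character h⁻¹ = ∑ u, if u * g * u⁻¹ = h then (1 : ℂ) else 0 := by
  classical
  -- As a function of `h` the difference is a class function. By first orthogonality it is
  -- orthogonal to every irreducible character, so completeness makes it vanish.
  let f : Γ → ℂ := fun h => ∑ i, (V i).character g * (V i).character h⁻¹ -
    ∑ u, if u * g * u⁻¹ = h then (1 : ℂ) else 0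
  suffices hf : f = 0 from sub_eq_zero.mp (congrFun hf h)
  have := invertibleOfNonzero (NeZero.ne (Nat.card Γ : ℂ))
  refine eq_zero_of_sum_mul_character f (fun v a => ?_) fun W hW => ?_
  · refine congrArg₂ (· - ·) (Finset.sum_congr rfl fun i _ => ?_)
      (Fintype.sum_equiv (Equiv.mulLeft v⁻¹) _ _ fun u => ?_)
    · rw [← FDRep.char_conj (V i) a⁻¹ v]
      congr 2
      group
    · refine if_congr ?_ rfl rfl
      simp only [Equiv.coe_mulLeft]
      constructor
      · intro h'
        calc v⁻¹ * u * g * (v⁻¹ * u)⁻¹ = v⁻¹ * (u * g * u⁻¹) * v := by group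
          _ = a := by rw [h']; group
      · intro h'
        rw [← h']
        group
  · obtain ⟨j, ⟨e⟩⟩ := hsurj W hW
    rw [FDRep.char_iso e]
    simp only [f, sub_mul, Finset.sum_sub_distrib, Finset.sum_mul, ite_mul, one_mul, zero_mul]
    rw [Finset.sum_comm, Finset.sum_comm (γ := Γ) (f := fun x u => ite _ _ _)]
    simp only [Finset.sum_ite_eq, Finset.mem_univ, if_true, FDRep.char_conj, Finset.sum_const,
      Finset.card_univ, nsmul_eq_mul]
    have h1 : ∀ i, ∑ x, (V i).character g * (V i).character x⁻¹ * (V j).character x =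
        if i = j then (Fintype.card Γ : ℂ) * (V j).character g else 0 := by
      intro i
      have := hV i
      have := hV j
      have h2 := FDRep.char_orthonormal (V j) (V i)
      rw [inv_mul_eq_iff_eq_mul₀ (NeZero.ne _), Nat.card_eq_fintype_card] at h2
      have h3 : ∑ x, (V i).character g * (V i).character x⁻¹ * (V j).character x =
          (V i).character g * ∑ x, (V j).character x * (V i).character x⁻¹ := by
        rw [Finset.mul_sum]
        exact Finset.sum_congr rfl fun x _ => by ring
      rw [h3, h2]
      by_cases hij : i = j
      · subst hij
        rw [if_pos ⟨Iso.refl _⟩, if_pos rfl]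
        ring
      · rw [if_neg fun ⟨e⟩ => hij (hinj i j ⟨e.symm⟩), if_neg hij]
        ring
    rw [Finset.sum_congr rfl fun i _ => h1 i]
    simp

/-- The averages of `χ(x ^ n) χ(x⁻¹ g)` and of `χ(x⁻¹) χ(x ^ n g)` agree. -/
lemma sum_character_zpow_mul (V : FDRep ℂ Γ) [Simple V] (n : ℤ) (g : Γ) :
    ∑ x, V.character x⁻¹ * V.character (x ^ n * g) =
      ∑ h, V.character ((g * h⁻¹) ^ n) * V.character h := by
  have hcard : (Fintype.card Γ : ℂ) ≠ 0 := by exact_mod_cast Fintype.card_ne_zero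
  -- Replacing `x` by its conjugates leaves the sum unchanged. Averaging over them splits off `χ(g)`
  -- and leaves a scalar that is symmetric in `w` and `w'`; this symmetry gives the exchange.
  have key : ∀ w w' : Γ → Γ, (∀ u x, w (u * x * u⁻¹) = u * w x * u⁻¹) →
      (∀ u x, w' (u * x * u⁻¹) = u * w' x * u⁻¹) →
      ∑ x, V.character (w x) * V.character (w' x * g) =
        (∑ x, V.character (w x) * V.character (w' x)) / Module.finrank ℂ V * V.character g := by
    intro w w' hw hw'
    have h1 : ∀ u : Γ, ∑ x, V.character (w x) * V.character (w' x * g) =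
        ∑ x, V.character (w x) * V.character (u * w' x * u⁻¹ * g) := fun u =>
      (Fintype.sum_equiv (MulAut.conj u).toEquiv _ _ fun x => by
        have hc : (MulAut.conj u).toEquiv x = u * x * u⁻¹ := by simp [MulAut.conj_apply]
        rw [hc, hw, hw', FDRep.char_conj]).symm
    have h2 : (Fintype.card Γ : ℂ) * ∑ x, V.character (w x) * V.character (w' x * g) =
        ∑ u : Γ, ∑ x, V.character (w x) * V.character (u * w' x * u⁻¹ * g) := by
      rw [← Finset.sum_congr rfl fun u _ => h1 u, Finset.sum_const, Finset.card_univ, nsmul_eq_mul]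
    rw [Finset.sum_comm] at h2
    simp only [← Finset.mul_sum, sum_character_conj_mul] at h2
    rw [← mul_right_inj' hcard, h2, Finset.sum_div, Finset.sum_mul, Finset.mul_sum]
    exact Finset.sum_congr rfl fun x _ => by ring
  have h3 : ∑ h, V.character ((g * h⁻¹) ^ n) * V.character h =
      ∑ x, V.character (x ^ n) * V.character (x⁻¹ * g) :=
    Fintype.sum_equiv ((Equiv.inv Γ).trans (Equiv.mulLeft g)) _ _ fun h => by
      simp
  rw [h3, key (fun x => x⁻¹) (fun x => x ^ n) (fun u x => by group) (fun u x => conj_zpow),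
    key (fun x => x ^ n) (fun x => x⁻¹) (fun u x => conj_zpow) (fun u x => by group)]
  congr 2
  exact Finset.sum_congr rfl fun x _ => mul_comm _ _

/-- Solving for `s` gives `s = g y⁻¹ x⁻¹ y x ^ (1 - q)`. The sum over `y` is then a conjugation
average of `x⁻¹`, which `sum_character_conj_mul` separates. -/
lemma sum_surface_word (V : FDRep ℂ Γ) [Simple V] [DecidableEq Γ] (q : ℕ) (g : Γ) :
    (∑ s, ∑ x, ∑ y, if s * x ^ q * comm x y = g then V.character s else 0) =
      (Fintype.card Γ : ℂ) / Module.finrank ℂ V *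
        ∑ x, V.character x⁻¹ * V.character (x ^ (1 - (q : ℤ)) * g) := by
  rw [Finset.sum_comm, Finset.mul_sum]
  refine Finset.sum_congr rfl fun x _ => ?_
  rw [Finset.sum_comm, ← sum_character_conj_mul V]
  refine Fintype.sum_equiv (Equiv.inv Γ) _ _ fun y => ?_
  rw [Finset.sum_eq_single (g * (comm x y)⁻¹ * (x ^ q)⁻¹)]
  · rw [if_pos (by group)]
    simp only [Equiv.inv_apply]
    have h : (g * (comm x y)⁻¹ * (x ^ q)⁻¹) =
        g * (y⁻¹ * x⁻¹ * y⁻¹⁻¹ * x ^ (1 - (q : ℤ))) := by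
      rw [zpow_sub, zpow_one, zpow_natCast, comm]
      group
    rw [h, FDRep.char_mul_comm]
    congr 1
    group
  · intro s _ hs
    refine if_neg fun h => hs ?_
    rw [← h]
    group
  · simp

lemma sum_sum_conj (f : Γ → ℂ) (hf : ∀ u a, f (u * a * u⁻¹) = f a) (g k : Γ) :
    ∑ u, ∑ v, f (u * g * u⁻¹ * (v * k * v⁻¹)) = (Fintype.card Γ : ℂ) * ∑ u, f (u * g * u⁻¹ * k) := by
  rw [Finset.sum_comm]
  have h : ∀ v, ∑ u, f (u * g * u⁻¹ * (v * k * v⁻¹)) = ∑ u, f (u * g * u⁻¹ * k) := fun v => by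
    refine Fintype.sum_equiv (Equiv.mulLeft v⁻¹) _ _ fun u => ?_
    rw [← hf v⁻¹]
    congr 1
    simp only [Equiv.coe_mulLeft]
    group
  rw [Finset.sum_congr rfl fun v _ => h v, Finset.sum_const, Finset.card_univ, nsmul_eq_mul]

end Characters

end ProPDW
end

open CategoryTheory MonoidalCategory

noncomputable section

namespace ProPDW

open ContFunctor

/-! ### Bundles on the circle -/

section Circle

variable {p : ℕ} [Fact p.Prime] {Γ : Type} [Group Γ] [TopologicalSpace Γ]

/-- The homomorphism `ℤ_p → Γ`, `l ↦ g ^ l`, to a discrete `p`-group. -/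
def zpPow (hΓ : IsPGroup p Γ) (g : Γ) : Zp p →ₜ* Γ where
  toMonoidHom := powHom (hΓ g).choose g (hΓ g).choose_spec
  continuous_toFun := continuous_powHom _ _ _

lemma zpPow_natCast (hΓ : IsPGroup p Γ) (g : Γ) (n : ℕ) :
    zpPow hΓ g (Multiplicative.ofAdd (n : ℤ_[p])) = g ^ n :=
  powHom_natCast _ g (hΓ g).choose_spec n

lemma zpPow_one (hΓ : IsPGroup p Γ) (g : Γ) : zpPow hΓ g (Multiplicative.ofAdd 1) = g := by
  have := zpPow_natCast hΓ g 1
  rwa [Nat.cast_one, pow_one] at this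

variable [DiscreteTopology Γ]

lemma zpHom_ext {ρ σ : Zp p →ₜ* Γ}
    (h : ρ (Multiplicative.ofAdd 1) = σ (Multiplicative.ofAdd 1)) : ρ = σ := by
  have key : (fun l : ℤ_[p] => ρ (Multiplicative.ofAdd l)) = fun l => σ (Multiplicative.ofAdd l) := by
    refine (PadicInt.denseRange_natCast (p := p)).equalizer ρ.continuous_toFun σ.continuous_toFun ?_
    ext n
    have hn : Multiplicative.ofAdd (n : ℤ_[p]) = Multiplicative.ofAdd 1 ^ n := by
      rw [← ofAdd_nsmul, nsmul_one]
    simp only [Function.comp, hn, map_pow, h]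
  ext l
  exact congrFun key l.toAdd

lemma zpPow_apply_one (hΓ : IsPGroup p Γ) (ρ : Zp p →ₜ* Γ) :
    zpPow hΓ (ρ (Multiplicative.ofAdd 1)) = ρ := zpHom_ext (zpPow_one hΓ _)

lemma bijective_apply_one (hΓ : IsPGroup p Γ) :
    Function.Bijective fun ρ : Zp p →ₜ* Γ => ρ (Multiplicative.ofAdd 1) :=
  ⟨fun _ _ h => zpHom_ext h, fun g => ⟨zpPow hΓ g, zpPow_one hΓ g⟩⟩

/-- The truncations `l.appr n` converge to `l`, and `zpPow` is continuous with value the ordinary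
power at natural numbers, so the limit defining `padicPow` exists and is this value. -/
lemma padicPow_eq (hΓ : IsPGroup p Γ) (g : Γ) (l : ℤ_[p]) :
    padicPow g l = zpPow hΓ g (Multiplicative.ofAdd l) := by
  have happr : Filter.Tendsto (fun n : ℕ => ((l.appr n : ℕ) : ℤ_[p])) Filter.atTop (nhds l) := by
    rw [tendsto_iff_norm_sub_tendsto_zero]
    refine squeeze_zero (fun _ => norm_nonneg _) (fun n => ?_)
      (tendsto_pow_atTop_nhds_zero_of_lt_one (r := (p : ℝ)⁻¹) (by positivity)
        (inv_lt_one_of_one_lt₀ (by exact_mod_cast (Fact.out : p.Prime).one_lt)))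
    rw [norm_sub_rev, inv_pow, ← zpow_natCast, ← zpow_neg]
    exact (PadicInt.norm_le_pow_iff_mem_span_pow _ _).mpr (PadicInt.appr_spec n l)
  have := ((zpPow hΓ g).continuous_toFun.tendsto (Multiplicative.ofAdd l)).comp happr
  refine Filter.Tendsto.limUnder_eq (this.congr fun n => ?_)
  exact zpPow_natCast hΓ g _

/-- The class of the bundle on `Bℤ_p` with holonomy `g`. -/
def hol (hΓ : IsPGroup p Γ) (g : Γ) : Pi0 (Bun Γ (BZp p).toTopGrpd) := Bun.cls (bMap (zpPow hΓ g))

lemma cls_bMap_eq_hol (hΓ : IsPGroup p Γ) (ρ : Zp p →ₜ* Γ) :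
    Bun.cls (bMap ρ) = hol hΓ (ρ (Multiplicative.ofAdd 1)) := by
  rw [hol, zpPow_apply_one]
  rfl

lemma exists_hol_eq (hΓ : IsPGroup p Γ) (P : Pi0 (Bun Γ (BZp p).toTopGrpd)) :
    ∃ g, hol hΓ g = P := by
  obtain ⟨ρ, hρ⟩ := exists_cls_bMap (G := Zp p) P.out
  exact ⟨_, (cls_bMap_eq_hol hΓ ρ).symm.trans (hρ.trans (Bun.cls_out P))⟩

/-- Conjugation by `u`, as a bijection of `Hom(G, Γ)`. -/
def conjHom {G : Type} [Group G] [TopologicalSpace G] (u : Γ) : (G →ₜ* Γ) ≃ (G →ₜ* Γ) where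
  toFun ρ :=
    { toMonoidHom := (MulAut.conj u).toMonoidHom.comp ρ.toMonoidHom
      continuous_toFun :=
        (continuous_of_discreteTopology (f := MulAut.conj u)).comp ρ.continuous_toFun }
  invFun ρ :=
    { toMonoidHom := (MulAut.conj u⁻¹).toMonoidHom.comp ρ.toMonoidHom
      continuous_toFun :=
        (continuous_of_discreteTopology (f := MulAut.conj u⁻¹)).comp ρ.continuous_toFun }
  left_inv ρ := by
    ext x
    change u⁻¹ * (u * ρ x * u⁻¹) * u⁻¹⁻¹ = ρ x
    group
  right_inv ρ := by
    ext x
    change u * (u⁻¹ * ρ x * u⁻¹⁻¹) * u⁻¹ = ρ x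
    group

lemma hol_eq_iff (hΓ : IsPGroup p Γ) (g h : Γ) : hol hΓ g = hol hΓ h ↔ ∃ u, h = u * g * u⁻¹ := by
  refine (cls_bMap_eq_iff (zpPow hΓ g) (zpPow hΓ h)).trans ⟨?_, ?_⟩
  · rintro ⟨u, hu⟩
    have := hu (Multiplicative.ofAdd 1)
    rw [zpPow_one, zpPow_one] at this
    exact ⟨u, this⟩
  · rintro ⟨u, rfl⟩
    have hρ : zpPow hΓ (u * g * u⁻¹) = conjHom u (zpPow hΓ g) := zpHom_ext <| by
      rw [zpPow_one]
      change _ = u * zpPow hΓ g (Multiplicative.ofAdd 1) * u⁻¹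
      rw [zpPow_one]
    exact ⟨u, fun x => by rw [hρ]; rfl⟩

lemma hol_conj (hΓ : IsPGroup p Γ) (u g : Γ) : hol hΓ (u * g * u⁻¹) = hol hΓ g :=
  ((hol_eq_iff hΓ _ _).mpr ⟨u, rfl⟩).symm

lemma hol_mul_comm (hΓ : IsPGroup p Γ) (g h : Γ) : hol hΓ (g * h) = hol hΓ (h * g) :=
  (hol_eq_iff hΓ _ _).mpr ⟨h, by group⟩

lemma autCard_hol (hΓ : IsPGroup p Γ) (g : Γ) :
    autCard (hol hΓ g) = Nat.card {u : Γ // u * g * u⁻¹ = g} := by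
  refine (autCard_bMap (zpPow hΓ g)).trans (Nat.card_congr (Equiv.subtypeEquivRight fun u => ?_))
  rw [Subgroup.mem_centralizer_iff]
  constructor
  · intro h
    rw [mul_inv_eq_iff_eq_mul]
    exact (h g ⟨_, zpPow_one hΓ g⟩).symm
  · rintro h _ ⟨l, rfl⟩
    have h' : u * g = g * u := mul_inv_eq_iff_eq_mul.mp h
    exact (Commute.pow_right (show Commute u g from h') _).eq.symm

open Classical in
-- Each conjugate of `g` is `u g u⁻¹` for exactly `|C(g)|` elements `u`.
lemma autCard_hol_mul_sum [Fintype Γ] (hΓ : IsPGroup p Γ) (g : Γ) (f : Γ → ℂ) :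
    (autCard (hol hΓ g) : ℂ) * ∑ a, (if hol hΓ a = hol hΓ g then f a else 0) =
      ∑ u, f (u * g * u⁻¹) := by
  rw [← Finset.sum_fiberwise Finset.univ (fun u : Γ => u * g * u⁻¹) fun u => f (u * g * u⁻¹),
    Finset.mul_sum]
  refine Finset.sum_congr rfl fun a _ => ?_
  have h1 : ∀ u ∈ Finset.univ.filter (fun u : Γ => u * g * u⁻¹ = a), f (u * g * u⁻¹) = f a := by
    intro u hu
    rw [(Finset.mem_filter.mp hu).2]
  rw [Finset.sum_congr rfl h1, Finset.sum_const, nsmul_eq_mul]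
  by_cases ha : hol hΓ a = hol hΓ g
  · rw [if_pos ha]
    obtain ⟨v, rfl⟩ := (hol_eq_iff hΓ g a).mp ha.symm
    rw [autCard_hol, ← Fintype.card_subtype, ← Nat.card_eq_fintype_card]
    congr 2
    refine Nat.card_congr ((Equiv.mulLeft v).subtypeEquiv fun u => ?_)
    simp only [Equiv.coe_mulLeft, mul_inv_rev]
    rw [show v * u * g * (u⁻¹ * v⁻¹) = v * (u * g * u⁻¹) * v⁻¹ by group]
    simp
  · rw [if_neg ha, mul_zero, Finset.card_eq_zero.mpr, Nat.cast_zero, zero_mul]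
    refine Finset.filter_eq_empty_iff.mpr fun u _ hu => ha ?_
    rw [← hu, hol_conj]

variable {G : Type} [Group G] [TopologicalSpace G] [IsTopologicalGroup G]

lemma cls_bMap_conjHom (u : Γ) (ρ : G →ₜ* Γ) : Bun.cls (bMap (conjHom u ρ)) = Bun.cls (bMap ρ) :=
  ((cls_bMap_eq_iff _ _).mpr ⟨u, fun _ => rfl⟩).symm

lemma res_bMap_eq_hol (hΓ : IsPGroup p Γ) (τ : Zp p →ₜ* G) (ρ : G →ₜ* Γ) :
    res (bMap τ) (Bun.cls (bMap ρ)) = hol hΓ (ρ (τ (Multiplicative.ofAdd 1))) :=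
  cls_bMap_eq_hol hΓ (ρ.comp τ)

open Classical in
-- The sum of `f` over `e x = a` is a class function of `a`. A condition up to conjugacy can
-- therefore be replaced by an exact equation, at the cost of a factor `|Γ|`.
lemma autCard_hol_mul_sum_of_equivariant [Fintype Γ] (hΓ : IsPGroup p Γ) {X : Type} [Fintype X]
    (c : Γ → X ≃ X) (e : X → Γ) (f : X → ℂ) (he : ∀ u x, e (c u x) = u * e x * u⁻¹)
    (hf : ∀ u x, f (c u x) = f x) (g : Γ) :
    (autCard (hol hΓ g) : ℂ) * ∑ x, (if hol hΓ (e x) = hol hΓ g then f x else 0) =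
      (Nat.card Γ : ℂ) * ∑ x, if e x = g then f x else 0 := by
  let S : Γ → ℂ := fun a => ∑ x, if e x = a then f x else 0
  have hS : ∀ u a, S (u * a * u⁻¹) = S a := by
    intro u a
    refine (Fintype.sum_equiv (c u) _ _ fun x => ?_).symm
    simp only [he, hf, mul_left_inj, mul_right_inj]
  have key : ∑ x, (if hol hΓ (e x) = hol hΓ g then f x else 0) =
      ∑ a, if hol hΓ a = hol hΓ g then S a else 0 := by
    rw [← Finset.sum_fiberwise Finset.univ e]
    refine Finset.sum_congr rfl fun a _ => ?_
    rw [Finset.sum_filter]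
    by_cases ha : hol hΓ a = hol hΓ g
    · rw [if_pos ha]
      refine Finset.sum_congr rfl fun x _ => ?_
      by_cases hx : e x = a
      · rw [if_pos hx, if_pos hx, hx, if_pos ha]
      · rw [if_neg hx, if_neg hx]
    · rw [if_neg ha]
      refine Finset.sum_eq_zero fun x _ => ?_
      by_cases hx : e x = a
      · rw [if_pos hx, hx, if_neg ha]
      · rw [if_neg hx]
  rw [key, autCard_hol_mul_sum, Finset.sum_congr rfl fun u _ => hS u g, Finset.sum_const,
    Finset.card_univ, nsmul_eq_mul, ← Nat.card_eq_fintype_card]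

open Classical in
-- The weight `|Aut| / |Γ|` of the sum over homomorphisms is exactly absorbed when the conjugacy
-- condition on the outgoing holonomy is replaced by an equality.
lemma dwMap_circle_apply [Fintype Γ] {𝔊 : PGrpd p} (hΓ : IsPGroup p Γ) (hG : IsFinPres p G)
    [Fintype (G →ₜ* Γ)] (l : 𝔊.Fun (PGrpd.B G hG)) (τ : Zp p →ₜ* G) (F : Fld Γ 𝔊) (g : Γ) :
    dwMap Γ (Cospan.cls (ℌ := BZp p) ⟨PGrpd.B G hG, l, bMap τ⟩) F (hol hΓ g) =
      ∑ ρ : G →ₜ* Γ, if ρ (τ (Multiplicative.ofAdd 1)) = g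
        then F (res l (Bun.cls (bMap ρ))) else 0 := by
  have hΓ0 : (Nat.card Γ : ℂ) ≠ 0 := by
    exact_mod_cast Nat.card_pos.ne'
  let f : (G →ₜ* Γ) → ℂ := fun ρ => F (res l (Bun.cls (bMap ρ)))
  have hf : ∀ u ρ, f (conjHom u ρ) = f ρ := fun u ρ => by
    have h : Bun.cls (𝔊 := (PGrpd.B G hG).toTopGrpd) (bMap (conjHom u ρ)) = Bun.cls (bMap ρ) :=
      cls_bMap_conjHom u ρ
    exact congrArg (fun Q => F (res l Q)) h
  have key := autCard_hol_mul_sum_of_equivariant hΓ (fun u => conjHom (G := G) u)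
    (fun ρ => ρ (τ (Multiplicative.ofAdd 1))) f (fun u ρ => rfl) hf g
  have h := dwMap_b_apply (ℌ := BZp p) hG l (bMap τ) F (hol hΓ g)
  have h2 : ∀ ρ : G →ₜ* Γ, res (Γ := Γ) (𝔊 := (BZp p).toTopGrpd) (bMap τ) (Bun.cls (bMap ρ)) =
    hol hΓ (ρ (τ (Multiplicative.ofAdd 1))) := fun ρ => res_bMap_eq_hol hΓ τ ρ
  refine h.trans ?_
  rw [div_mul_eq_mul_div, div_eq_iff hΓ0, mul_comm _ (Nat.card Γ : ℂ)]
  refine Eq.trans (congrArg _ (Finset.sum_congr rfl fun ρ _ => ?_)) key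
  refine @if_congr _ _ _ _ _ _ _ _ _ ?_ rfl rfl
  exact Eq.to_iff (congrArg (fun Q => Q = hol hΓ g) (h2 ρ))

end Circle

end ProPDW
end

open CategoryTheory MonoidalCategory

noncomputable section

namespace ProPDW

open ContFunctor

/-! ### The values on the generating cobordisms -/

section Values

variable {p : ℕ} [Fact p.Prime] {Γ : Type} [Group Γ] [TopologicalSpace Γ] [DiscreteTopology Γ]

lemma zpHom_one {X : Type} (g : FreeProP p X) :
    FreeProP.zpHom g (Multiplicative.ofAdd 1) = g := by
  have := FreeProP.zpHom_natCast g 1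
  rwa [Nat.cast_one, pow_one] at this

lemma res_loop (hΓ : IsPGroup p Γ) {n : ℕ} (w : FreeProP p (Fin n))
    (ρ : FreeProP p (Fin n) →ₜ* Γ) : res (loop w) (Bun.cls (bMap ρ)) = hol hΓ (ρ w) :=
  (res_bMap_eq_hol hΓ (FreeProP.zpHom w) ρ).trans (by rw [zpHom_one])

/-- The homomorphism `ℤ_p → ℤ_p`, `1 ↦ α`. -/
def zpMul (α : ℤ_[p]) : Zp p →ₜ* Zp p where
  toMonoidHom := AddMonoidHom.toMultiplicative (AddMonoidHom.mulLeft α)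
  continuous_toFun := (continuous_const.mul continuous_id : Continuous fun l : ℤ_[p] => α * l)

lemma zpMul_one (α : ℤ_[p]) : zpMul α (Multiplicative.ofAdd 1) = Multiplicative.ofAdd α :=
  congrArg Multiplicative.ofAdd (mul_one α)

lemma zpPow_zpPow (hΓ : IsPGroup p Γ) (g : Γ) (α β : ℤ_[p]) :
    zpPow hΓ (zpPow hΓ g (Multiplicative.ofAdd α)) (Multiplicative.ofAdd β) =
      zpPow hΓ g (Multiplicative.ofAdd (α * β)) := by
  have h : zpPow hΓ (zpPow hΓ g (Multiplicative.ofAdd α)) = (zpPow hΓ g).comp (zpMul α) :=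
    zpHom_ext <| by
      rw [zpPow_one]
      change _ = zpPow hΓ g (zpMul α (Multiplicative.ofAdd 1))
      rw [zpMul_one]
  rw [h]
  rfl

variable [Fintype Γ]

/-- Homomorphisms from a free pro-`p` group to a finite `p`-group are determined by the images of
the generators, which are arbitrary. -/
def freeHomEquiv (hΓ : IsPGroup p Γ) (n : ℕ) : (FreeProP p (Fin n) →ₜ* Γ) ≃ (Fin n → Γ) :=
  Equiv.ofBijective (fun ρ i => ρ (FreeProP.gen p i))
    ⟨fun _ _ h => FreeProP.hom_ext fun i => congrFun h i, fun v =>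
      (FreeProP.exists_lift (isFinPres_of_finite hΓ).1 v).imp fun _ h => funext h⟩

instance fintypeHomFree (n : ℕ) : Fintype (FreeProP p (Fin n) →ₜ* Γ) :=
  have := (FreeProP.isFinPres p n).finite_hom (Γ := Γ)
  Fintype.ofFinite _

lemma sum_freeHom_two (hΓ : IsPGroup p Γ) (f : Γ → Γ → ℂ) :
    ∑ ρ : FreeProP p (Fin 2) →ₜ* Γ, f (ρ (FreeProP.gen p 0)) (ρ (FreeProP.gen p 1)) =
      ∑ a, ∑ b, f a b := by
  rw [← Fintype.sum_prod_type' f]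
  exact Fintype.sum_equiv ((freeHomEquiv hΓ 2).trans (finTwoArrowEquiv Γ)) _ _ fun ρ => rfl

lemma sum_freeHom_three (hΓ : IsPGroup p Γ) (f : Γ → Γ → Γ → ℂ) :
    ∑ ρ : FreeProP p (Fin 3) →ₜ* Γ,
        f (ρ (FreeProP.gen p 0)) (ρ (FreeProP.gen p 1)) (ρ (FreeProP.gen p 2)) =
      ∑ a, ∑ b, ∑ c, f a b c := by
  simp_rw [← Fintype.sum_prod_type' (f _)]
  rw [← Fintype.sum_prod_type' fun a (q : Γ × Γ) => f a q.1 q.2]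
  exact Fintype.sum_equiv ((freeHomEquiv hΓ 3).trans
    ((Fin.consEquiv fun _ : Fin 3 => Γ).symm.trans
      ((Equiv.refl Γ).prodCongr (finTwoArrowEquiv Γ)))) _ _ fun ρ => rfl

open Classical in
lemma dwMap_loop_apply (hΓ : IsPGroup p Γ) {𝔊 : PGrpd p} {n : ℕ} (l : 𝔊.Fun (BFree p n))
    (w : FreeProP p (Fin n)) (F : Fld Γ 𝔊) (g : Γ) :
    dwMap Γ (Cospan.cls ⟨BFree p n, l, loop w⟩) F (hol hΓ g) =
      ∑ ρ : FreeProP p (Fin n) →ₜ* Γ, if ρ w = g then F (res l (Bun.cls (bMap ρ))) else 0 := by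
  refine (dwMap_circle_apply hΓ (FreeProP.isFinPres p n) l (FreeProP.zpHom w) F g).trans ?_
  rw [zpHom_one]

lemma dwMap_genMul_apply (hΓ : IsPGroup p Γ) (F F' : Fld Γ (BZp p)) (g : Γ) :
    dwMap Γ (genMul p).cls (box F F') (hol hΓ g) =
      ∑ h, F (hol hΓ h) * F' (hol hΓ (h⁻¹ * g)) := by
  classical
  have h : ∀ ρ : FreeProP p (Fin 2) →ₜ* Γ,
      box F F' (res (copair (loop (FreeProP.gen p 0)) (loop (FreeProP.gen p 1)))
        (Bun.cls (bMap ρ))) =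
      F (hol hΓ (ρ (FreeProP.gen p 0))) * F' (hol hΓ (ρ (FreeProP.gen p 1))) := fun ρ =>
    congrArg₂ (fun P Q => F P * F' Q)
      ((res_copair_inl _ _ _).trans (res_loop hΓ _ ρ))
      ((res_copair_inr _ _ _).trans (res_loop hΓ _ ρ))
  refine (dwMap_loop_apply hΓ _ _ (box F F') g).trans ?_
  refine (Finset.sum_congr rfl fun ρ _ =>
    @if_congr _ _ _ _ _ _ _ _ _ (Eq.to_iff (congrArg (· = g) (map_mul ρ _ _))) (h ρ) rfl).trans ?_
  rw [sum_freeHom_two hΓ fun a b => if a * b = g then F (hol hΓ a) * F' (hol hΓ b) else 0]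
  refine Finset.sum_congr rfl fun a _ => ?_
  rw [Finset.sum_eq_single (a⁻¹ * g)]
  · simp
  · intro b _ hb
    refine if_neg fun h => hb ?_
    rw [← h]
    group
  · simp

/-- This is the surface word with `q = 0`: one factor `|Γ| / dim` comes from the sum over `y`, the
other from the convolution sum over `x`. -/
lemma dwMap_genTorus_apply (hΓ : IsPGroup p Γ) (V : FDRep ℂ Γ) [Simple V] (b : Fld Γ (BZp p))
    (hb : ∀ g, b (hol hΓ g) = V.character g) (g : Γ) :
    dwMap Γ (genTorus p).cls b (hol hΓ g) =
      ((Fintype.card Γ : ℂ) / Module.finrank ℂ V) ^ 2 * V.character g := by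
  classical
  refine (dwMap_loop_apply hΓ _ _ b g).trans ?_
  refine (Finset.sum_congr rfl fun ρ _ =>
    @if_congr _ _ _ _ _ _ _ _ _ (Eq.to_iff (congrArg (· = g) ?_))
      ((congrArg b (res_loop hΓ _ ρ)).trans (hb _)) rfl).trans
    ((sum_freeHom_three hΓ fun s x y => if s * x ^ 0 * comm x y = g then V.character s else 0).trans
      ?_)
  · simp only [comm, map_mul, map_inv, pow_zero, mul_one]
  · rw [sum_surface_word]
    simp only [Nat.cast_zero, sub_zero, zpow_one, sum_character_inv_mul]
    ring

lemma dwMap_genTorusLevel_apply (hΓ : IsPGroup p Γ) (V : FDRep ℂ Γ) [Simple V]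
    (b : Fld Γ (BZp p)) (hb : ∀ g, b (hol hΓ g) = V.character g) (r : ℕ) (g : Γ) :
    dwMap Γ (genTorusLevel p r).cls b (hol hΓ g) =
      (Fintype.card Γ : ℂ) / Module.finrank ℂ V *
        ∑ h : Γ, V.character ((g * h⁻¹) ^ (1 - (p : ℤ) ^ r)) * V.character h := by
  classical
  refine (dwMap_loop_apply hΓ _ _ b g).trans ?_
  refine (Finset.sum_congr rfl fun ρ _ =>
    @if_congr _ _ _ _ _ _ _ _ _ (Eq.to_iff (congrArg (· = g) ?_))
      ((congrArg b (res_loop hΓ _ ρ)).trans (hb _)) rfl).trans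
    ((sum_freeHom_three hΓ fun s x y =>
      if s * x ^ p ^ r * comm x y = g then V.character s else 0).trans ?_)
  · simp only [comm, map_mul, map_inv, map_pow]
  · rw [sum_surface_word, sum_character_zpow_mul]
    push_cast
    rfl

/-- Two outgoing circles give two independent conjugation averages. Simultaneous conjugation absorbs
one of them and cancels the remaining `1 / |Γ|`. -/
lemma dwMap_genComul_apply (hΓ : IsPGroup p Γ) (F : Fld Γ (BZp p))
    (P : Pi0 (Bun Γ ((BZp p).coprod (BZp p)).toTopGrpd)) (g k : Γ)
    (hg : res (inl _ _) P = hol hΓ g) (hk : res (inr _ _) P = hol hΓ k) :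
    dwMap Γ (genComul p).cls F P = ∑ u, F (hol hΓ (u * g * u⁻¹ * k)) := by
  classical
  have hΓ0 : (Nat.card Γ : ℂ) ≠ 0 := by
    exact_mod_cast Nat.card_pos.ne'
  have hP : (autCard P : ℂ) = autCard (hol hΓ g) * autCard (hol hΓ k) := by
    rw [← hg, ← hk, ← Nat.cast_mul]
    exact congrArg _ (autCard_coprod (𝔊 := (BZp p).toTopGrpd) (ℌ := (BZp p).toTopGrpd) P)
  have hr : ∀ ρ : FreeProP p (Fin 2) →ₜ* Γ,
      res (copair (loop (FreeProP.gen p 0)) (loop (FreeProP.gen p 1))) (Bun.cls (bMap ρ)) = P ↔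
      hol hΓ (ρ (FreeProP.gen p 0)) = hol hΓ g ∧ hol hΓ (ρ (FreeProP.gen p 1)) = hol hΓ k := by
    intro ρ
    have h0 := (res_copair_inl (loop (FreeProP.gen p 0)) (loop (FreeProP.gen p 1))
      (Bun.cls (bMap ρ))).trans (res_loop hΓ _ ρ)
    have h1 := (res_copair_inr (loop (FreeProP.gen p 0)) (loop (FreeProP.gen p 1))
      (Bun.cls (bMap ρ))).trans (res_loop hΓ _ ρ)
    constructor
    · intro h
      rw [← h0, ← h1, ← hg, ← hk]
      exact ⟨congrArg (res (inl _ _)) h, congrArg (res (inr _ _)) h⟩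
    · rintro ⟨ha, hb⟩
      exact pi0_coprod_ext (h0.trans (ha.trans hg.symm)) (h1.trans (hb.trans hk.symm))
  refine (dwMap_b_apply (FreeProP.isFinPres p 2) _ _ F P).trans ?_
  rw [hP, div_mul_eq_mul_div, div_eq_iff hΓ0]
  refine (congrArg (fun t : ℂ => (autCard (hol hΓ g) : ℂ) * autCard (hol hΓ k) * t)
    (Eq.trans (Finset.sum_congr rfl fun ρ _ => ?_)
      (sum_freeHom_two hΓ fun a b => if hol hΓ a = hol hΓ g ∧ hol hΓ b = hol hΓ k
        then F (hol hΓ (a * b)) else 0))).trans ?_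
  · exact @if_congr _ _ _ _ _ _ _ _ _ (hr ρ)
      (congrArg F ((res_loop hΓ _ ρ).trans (congrArg _ (map_mul ρ _ _)))) rfl
  simp only [ite_and]
  have h2 : ∀ a, (autCard (hol hΓ k) : ℂ) *
      ∑ b, (if hol hΓ a = hol hΓ g then if hol hΓ b = hol hΓ k then F (hol hΓ (a * b)) else 0
        else 0) =
      if hol hΓ a = hol hΓ g then ∑ v, F (hol hΓ (a * (v * k * v⁻¹))) else 0 := fun a => by
    by_cases ha : hol hΓ a = hol hΓ g
    · simp only [if_pos ha]
      exact autCard_hol_mul_sum hΓ k fun b => F (hol hΓ (a * b))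
    · simp [if_neg ha]
  rw [mul_assoc, Finset.mul_sum, Finset.sum_congr rfl fun a _ => h2 a,
    autCard_hol_mul_sum hΓ g fun a => ∑ v, F (hol hΓ (a * (v * k * v⁻¹))),
    sum_sum_conj (fun a => F (hol hΓ a)) (fun u a => by rw [hol_conj]), Nat.card_eq_fintype_card,
    mul_comm]

lemma dwMap_genComul_character (hΓ : IsPGroup p Γ) (V : FDRep ℂ Γ) [Simple V]
    (b : Fld Γ (BZp p)) (hb : ∀ g, b (hol hΓ g) = V.character g) :
    dwMap Γ (genComul p).cls b =
      ((Fintype.card Γ : ℂ) / (Module.finrank ℂ V : ℂ)) • box b b := by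
  funext P
  obtain ⟨g, hg⟩ := exists_hol_eq hΓ (res (inl (BZp p).toTopGrpd (BZp p).toTopGrpd) P)
  obtain ⟨k, hk⟩ := exists_hol_eq hΓ (res (inr (BZp p).toTopGrpd (BZp p).toTopGrpd) P)
  refine (dwMap_genComul_apply hΓ b P g k hg.symm hk.symm).trans ?_
  simp only [hb]
  rw [sum_character_conj_mul, Pi.smul_apply, smul_eq_mul, box, ← hg, ← hk, hb, hb]

lemma dwMap_genComul_eq_sum (hΓ : IsPGroup p Γ) {ι : Type} [Fintype ι] (V : ι → FDRep ℂ Γ)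
    (hV : ∀ i, Simple (V i)) (hinj : ∀ i j, Nonempty (V i ≅ V j) → i = j)
    (hsurj : ∀ W : FDRep ℂ Γ, Simple W → ∃ i, Nonempty (W ≅ V i)) (F : Fld Γ (BZp p))
    (ρ σ : Zp p →ₜ* Γ) :
    dwMap Γ (genComul p).cls F (Bun.cls (copair (bMap ρ) (bMap σ))) =
      ∑ i, ∑ h : Γ, (V i).character (ρ (Multiplicative.ofAdd 1)) * (V i).character h⁻¹ *
        F (hol hΓ (σ (Multiplicative.ofAdd 1) * h)) := by
  classical
  refine (dwMap_genComul_apply hΓ F _ (ρ (Multiplicative.ofAdd 1)) (σ (Multiplicative.ofAdd 1))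
    ((res_inl_cls_copair (𝔊 := (BZp p).toTopGrpd) (ℌ := (BZp p).toTopGrpd) (bMap ρ) (bMap σ)).trans
      (cls_bMap_eq_hol hΓ ρ))
    ((res_inr_cls_copair (𝔊 := (BZp p).toTopGrpd) (ℌ := (BZp p).toTopGrpd) (bMap ρ) (bMap σ)).trans
      (cls_bMap_eq_hol hΓ σ))).trans ?_
  rw [Finset.sum_comm]
  -- The sum over the irreducibles is the indicator of `h` being a conjugate of the first holonomy,
  -- counted with multiplicity; this recovers the average of `dwMap_genComul_apply`.
  simp only [← Finset.sum_mul, sum_character_mul_character_inv_eq V hV hinj hsurj]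
  simp only [Finset.sum_mul, ite_mul, one_mul, zero_mul]
  rw [Finset.sum_comm]
  refine Finset.sum_congr rfl fun u _ => ?_
  rw [Finset.sum_ite_eq, if_pos (Finset.mem_univ _), hol_mul_comm]

instance uniqueHomUnit : Unique (Unit →ₜ* Γ) where
  default := 1
  uniq ρ := by
    ext x
    exact map_one ρ

/-- There is only the trivial homomorphism and the outgoing bundle has trivial automorphism group,
so the factor `1 / |Γ|` survives. -/
lemma dwMap_genCounit_apply (hΓ : IsPGroup p Γ) (F : Fld Γ (BZp p))
    (P : Pi0 (Bun Γ (PGrpd.empty p).toTopGrpd)) :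
    dwMap Γ (genCounit p).cls F P = F (hol hΓ 1) / (Fintype.card Γ : ℂ) := by
  refine (dwMap_b_apply (isFinPres_unit p) (collapse p) (fromEmpty p _) F P).trans ?_
  rw [autCard_empty, Fintype.sum_unique, if_pos (Subsingleton.elim _ _)]
  rw [show res (collapse p) (Bun.cls (bMap (default : Unit →ₜ* Γ))) = hol hΓ 1 from
    res_bMap_eq_hol hΓ 1 (1 : Unit →ₜ* Γ)]
  rw [Nat.card_eq_fintype_card, Nat.cast_one, div_mul_eq_mul_div, one_mul]

open Classical in
lemma dwMap_genUnit_apply (hΓ : IsPGroup p Γ) (c : ℂ) (g : Γ) :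
    dwMap Γ (genUnit p).cls (fun _ => c) (hol hΓ g) = if 1 = g then c else 0 := by
  refine (dwMap_circle_apply hΓ (isFinPres_unit p) (fromEmpty p _) (1 : Zp p →ₜ* Unit)
    (fun _ => c) g).trans ?_
  exact Fintype.sum_unique _

lemma dwMap_genTwist_apply (hΓ : IsPGroup p Γ) (α : ℤ_[p]ˣ) (F : Fld Γ (BZp p)) (g : Γ) :
    dwMap Γ (genTwist α).cls F (hol hΓ g) = F (hol hΓ (padicPow g (α : ℤ_[p]))) := by
  refine (congrFun (congrFun (congrArg DFunLike.coe rfl) F) _ : _ = sharp Γ (twistFun α) F _).trans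
    ((sharp_apply (twistFun α) F (hol hΓ g)).trans (congrArg F ?_))
  refine (res_bMap_eq_hol hΓ (zpMul (α : ℤ_[p])) (zpPow hΓ g)).trans ?_
  rw [zpMul_one, padicPow_eq hΓ]

lemma dwMap_genTwistOut_apply (hΓ : IsPGroup p Γ) (α : ℤ_[p]ˣ) (F : Fld Γ (BZp p)) (g : Γ) :
    dwMap Γ (genTwistOut α).cls F (hol hΓ g) =
      F (hol hΓ (padicPow g ((α⁻¹ : ℤ_[p]ˣ) : ℤ_[p]))) := by
  classical
  have := (isFinPres_zp p).finite_hom (Γ := Γ)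
  have : Fintype (Zp p →ₜ* Γ) := Fintype.ofFinite _
  refine (dwMap_circle_apply hΓ (isFinPres_zp p) (ContFunctor.id _) (zpMul (α : ℤ_[p])) F g).trans ?_
  -- As `α` is invertible, `ρ(α) = g` has the single solution `ρ(1) = g ^ (α⁻¹)`; hence the inverse
  -- exponent.
  have h : ∀ ρ : Zp p →ₜ* Γ, ρ (zpMul (α : ℤ_[p]) (Multiplicative.ofAdd 1)) = g ↔
      ρ = zpPow hΓ (padicPow g ((α⁻¹ : ℤ_[p]ˣ) : ℤ_[p])) := by
    intro ρ
    obtain ⟨a, rfl⟩ : ∃ a, zpPow hΓ a = ρ := ⟨_, zpPow_apply_one hΓ ρ⟩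
    rw [zpMul_one, padicPow_eq hΓ]
    constructor
    · rintro rfl
      rw [zpPow_zpPow, Units.mul_inv, zpPow_one]
    · intro h
      rw [h, zpPow_zpPow, Units.inv_mul, zpPow_one]
  simp only [h]
  rw [Finset.sum_ite_eq', if_pos (Finset.mem_univ _)]
  exact congrArg F (res_id _)

end Values

end ProPDW
end

open CategoryTheory MonoidalCategory

noncomputable section

namespace ProPDW

open ContFunctor

/-! ### The centre of the group algebra -/

section Center

variable {p : ℕ} [Fact p.Prime] {Γ : Type} [Group Γ]

lemma mem_center_of_coeff_conj (z : MonoidAlgebra ℂ Γ)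
    (hz : ∀ u g, z.coeff (u * g * u⁻¹) = z.coeff g) :
    z ∈ Subalgebra.center ℂ (MonoidAlgebra ℂ Γ) := by
  rw [Subalgebra.mem_center_iff]
  intro b
  induction b using MonoidAlgebra.induction_on with
  | of g =>
    ext h
    simp only [MonoidAlgebra.of_apply, MonoidAlgebra.coeff_single_mul_apply,
      MonoidAlgebra.coeff_mul_single_apply]
    rw [one_mul, mul_one, ← hz g]
    congr 1
    group
  | add a b ha hb => rw [add_mul, mul_add, ha, hb]
  | smul c a ha => rw [smul_mul_assoc, mul_smul_comm, ha]

lemma coeff_conj_of_mem_center {z : MonoidAlgebra ℂ Γ}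
    (hz : z ∈ Subalgebra.center ℂ (MonoidAlgebra ℂ Γ)) (u g : Γ) :
    z.coeff (u * g * u⁻¹) = z.coeff g := by
  rw [Subalgebra.mem_center_iff] at hz
  have h := congrArg (fun y : MonoidAlgebra ℂ Γ => y.coeff (u * g)) (hz (MonoidAlgebra.single u 1))
  simp only [MonoidAlgebra.coeff_single_mul_apply,
      MonoidAlgebra.coeff_mul_single_apply] at h
  rw [one_mul, mul_one, inv_mul_cancel_left] at h
  exact h.symm

variable [Fintype Γ] [TopologicalSpace Γ] [DiscreteTopology Γ]

/-- `F ↦ ∑ F(g) g`, as a linear map to the centre of the group algebra. -/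
def toCenter (hΓ : IsPGroup p Γ) :
    Fld Γ (BZp p) →ₗ[ℂ] Subalgebra.center ℂ (MonoidAlgebra ℂ Γ) where
  toFun F := ⟨MonoidAlgebra.ofCoeff (Finsupp.equivFunOnFinite.symm fun g => F (hol hΓ g)),
    mem_center_of_coeff_conj _ fun u g => congrArg F (hol_conj hΓ u g)⟩
  map_add' _ _ := Subtype.ext (MonoidAlgebra.ext (Finsupp.ext fun _ => rfl))
  map_smul' _ _ := Subtype.ext (MonoidAlgebra.ext (Finsupp.ext fun _ => rfl))

lemma coeff_toCenter (hΓ : IsPGroup p Γ) (F : Fld Γ (BZp p)) (g : Γ) :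
    (toCenter hΓ F).1.coeff g = F (hol hΓ g) := rfl

lemma toCenter_bijective (hΓ : IsPGroup p Γ) : Function.Bijective (toCenter hΓ) := by
  constructor
  · intro F F' h
    funext P
    obtain ⟨g, rfl⟩ := exists_hol_eq hΓ P
    exact congrArg (fun z : Subalgebra.center ℂ (MonoidAlgebra ℂ Γ) => z.1.coeff g) h
  · intro z
    -- `s` selects a holonomy for every class. A central element has coefficients constant on
    -- conjugacy classes, so the choice does not matter.
    choose s hs using exists_hol_eq (Γ := Γ) hΓ
    refine ⟨fun P => z.1.coeff (s P), Subtype.ext (MonoidAlgebra.ext (Finsupp.ext fun g => ?_))⟩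
    obtain ⟨u, hu⟩ := (hol_eq_iff hΓ _ _).mp (hs (hol hΓ g))
    rw [coeff_toCenter]
    exact (coeff_conj_of_mem_center z.2 u _).symm.trans (congrArg z.1.coeff hu.symm)

/-- The isomorphism of `Z(Bℤ_p)` with the centre of the group algebra. -/
def centerEquiv (hΓ : IsPGroup p Γ) :
    Fld Γ (BZp p) ≃ₗ[ℂ] Subalgebra.center ℂ (MonoidAlgebra ℂ Γ) :=
  LinearEquiv.ofBijective (toCenter hΓ) (toCenter_bijective hΓ)

lemma coeff_centerEquiv (hΓ : IsPGroup p Γ) (F : Fld Γ (BZp p)) (g : Γ) :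
    (centerEquiv hΓ F).1.coeff g = F (hol hΓ g) := rfl

lemma centerEquiv_genUnit (hΓ : IsPGroup p Γ) (c : ℂ) :
    centerEquiv hΓ (dwMap Γ (genUnit p).cls fun _ => c) = c • 1 := by
  classical
  refine Subtype.ext (MonoidAlgebra.ext (Finsupp.ext fun g => ?_))
  rw [coeff_centerEquiv, dwMap_genUnit_apply]
  change _ = c * (MonoidAlgebra.single (1 : Γ) (1 : ℂ)).coeff g
  rw [MonoidAlgebra.coeff_single, Finsupp.single_apply, mul_ite, mul_one, mul_zero]

lemma centerEquiv_genMul (hΓ : IsPGroup p Γ) (F F' : Fld Γ (BZp p)) :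
    centerEquiv hΓ (dwMap Γ (genMul p).cls (box F F')) = centerEquiv hΓ F * centerEquiv hΓ F' := by
  classical
  refine Subtype.ext (MonoidAlgebra.ext (Finsupp.ext fun g => ?_))
  rw [coeff_centerEquiv, dwMap_genMul_apply]
  change _ = ((centerEquiv hΓ F).1 * (centerEquiv hΓ F').1).coeff g
  rw [MonoidAlgebra.coeff_mul_apply_left, Finsupp.sum_fintype _ _ fun _ => zero_mul _]
  rfl

/-- The class function of a character. -/
lemma exists_fld_character (hΓ : IsPGroup p Γ) (V : FDRep ℂ Γ) :
    ∃ b : Fld Γ (BZp p), ∀ g, b (hol hΓ g) = V.character g := by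
  obtain ⟨b, hb⟩ := (toCenter_bijective hΓ).2
    ⟨MonoidAlgebra.ofCoeff (Finsupp.equivFunOnFinite.symm V.character),
      mem_center_of_coeff_conj _ fun u g => FDRep.char_conj V g u⟩
  exact ⟨b, fun g =>
    congrArg (fun z : Subalgebra.center ℂ (MonoidAlgebra ℂ Γ) => z.1.coeff g) hb⟩

end Center

end ProPDW
end

open ProPDW CategoryTheory MonoidalCategory in
/-- Pro-`p` Dijkgraaf–Witten theory is a TQFT, with its values on the generators. -/
theorem mainTheorem11 (p : ℕ) [Fact p.Prime] (Γ : Type) [Group Γ] [Fintype Γ] [TopologicalSpace Γ]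
    [DiscreteTopology Γ] (hΓ : IsPGroup p Γ) :
    -- `Cospan(pGrpd)` is a symmetric monoidal category and `Z` is a symmetric monoidal functor
    (∃ (h : CospanLaws p) (hZ : DWLaws p Γ) (_ : (dwFunctor h hZ).Braided),
      Functor.LaxMonoidal.ε (dwFunctor h hZ) = epsHom Γ p ∧
      ∀ 𝔊 ℌ : PGrpd p,
        Functor.LaxMonoidal.μ (dwFunctor h hZ) (𝔊 : CospanCat h) (ℌ : CospanCat h) =
          muHom Γ 𝔊 ℌ) ∧
    -- the automorphism groups which enter the pushforward are finite
    (∀ (𝔊 : PGrpd p) (P : Bun Γ 𝔊.toTopGrpd), Finite (Aut P)) ∧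
    -- the remaining axioms of a TQFT: the maps `f_#`, naturality, gluing along equivalences
    (∀ {𝔊 ℌ : PGrpd p} (f : 𝔊.Fun ℌ), f.IsEquiv → Function.Bijective (sharp Γ f)) ∧
    (∀ {𝔊 ℌ 𝔎 : PGrpd p} (f : 𝔊.Fun ℌ) (g : ℌ.Fun 𝔎),
      sharp Γ (f.comp g) = sharp Γ g ∘ₗ sharp Γ f) ∧
    (∀ {𝔊 ℌ 𝔊' ℌ' : PGrpd p} (C : Cospan 𝔊 ℌ) (C' : Cospan 𝔊' ℌ') (e : C.apex.Fun C'.apex)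
      (f : 𝔊.Fun 𝔊') (g : ℌ.Fun ℌ'), e.IsEquiv → f.IsEquiv → g.IsEquiv →
      Nonempty (C.left.comp e ≅ f.comp C'.left) → Nonempty (C.right.comp e ≅ g.comp C'.right) →
      sharp Γ g ∘ₗ dwMap Γ C.cls = dwMap Γ C'.cls ∘ₗ sharp Γ f) ∧
    (∀ {𝔊 ℌ ℌ' 𝔎 : PGrpd p} (C : Cospan 𝔊 ℌ) (D : Cospan ℌ' 𝔎) (f : ℌ.Fun ℌ') (E : Cospan 𝔊 𝔎),
      f.IsEquiv → C.IsComposite ⟨D.apex, f.comp D.left, D.right⟩ E →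
      dwMap Γ E.cls = dwMap Γ D.cls ∘ₗ sharp Γ f ∘ₗ dwMap Γ C.cls) ∧
    -- `π₀ Fun(∐ BNᵢ, BΓ)` is the product of the sets `Hom(Nᵢ, Γ)/∼`
    (∀ {I : Type} [Finite I] (N : I → Type) [∀ i, Group (N i)] [∀ i, TopologicalSpace (N i)]
      [∀ i, IsTopologicalGroup (N i)], (∀ i, IsFinPres p (N i)) →
      (∀ P : Bun Γ (TopGrpd.fam N), ∃ σ : ∀ i, N i →ₜ* Γ, Bun.cls (famMap σ) = Bun.cls P) ∧
      ∀ σ σ' : ∀ i, N i →ₜ* Γ,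
        Bun.cls (famMap σ) = Bun.cls (famMap σ') ↔ ∀ i, HomConj (σ i) (σ' i)) ∧
    -- the values on the cobordisms `(G; {Nᵢ}, {Uⱼ})`
    (∀ {I J : Type} [Finite I] [Fintype J] (N : I → Type) (U : J → Type) (G : Type)
      [∀ i, Group (N i)] [∀ i, TopologicalSpace (N i)] [∀ i, IsTopologicalGroup (N i)]
      [∀ j, Group (U j)] [∀ j, TopologicalSpace (U j)] [∀ j, IsTopologicalGroup (U j)]
      [Group G] [TopologicalSpace G] [IsTopologicalGroup G] (hN : ∀ i, IsFinPres p (N i))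
      (hU : ∀ j, IsFinPres p (U j)) (hG : IsFinPres p G) (φ : ∀ i, N i →ₜ* G)
      (τ : ∀ j, U j →ₜ* G), Finite (HomCls G Γ) ∧
      ∀ (F : Fld Γ (PGrpd.fam N hN)) (σ : ∀ j, U j →ₜ* Γ),
        dwMap Γ (Cospan.cls (𝔊 := PGrpd.fam N hN) (ℌ := PGrpd.fam U hU)
            ⟨PGrpd.B G hG, famMap φ, famMap τ⟩) F (Bun.cls (famMap σ)) =
          ∑ᶠ (ρ : HomCls G Γ) (_ : ∀ j, HomConj (ρ.out.comp (τ j)) (σ j)),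
            (∏ j, (centCard (σ j) : ℂ)) / (centCard ρ.out : ℂ) *
              F (Bun.cls (famMap fun i => ρ.out.comp (φ i)))) ∧
    -- the identification of `Z(Bℤ_p)` with the centre of the group algebra
    Function.Bijective (fun ρ : Zp p →ₜ* Γ => ρ (Multiplicative.ofAdd 1)) ∧
    ∃ Φ : Fld Γ (BZp p) ≃ₗ[ℂ] Subalgebra.center ℂ (MonoidAlgebra ℂ Γ),
      (∀ (F : Fld Γ (BZp p)) (ρ : Zp p →ₜ* Γ),
        (Φ F).1.coeff (ρ (Multiplicative.ofAdd 1)) = F (Bun.cls (bMap ρ))) ∧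
      -- the counit
      (∀ (F : Fld Γ (BZp p)) (P : Pi0 (Bun Γ (PGrpd.empty p).toTopGrpd)),
        dwMap Γ (genCounit p).cls F P = (Φ F).1.coeff 1 / (Fintype.card Γ : ℂ)) ∧
      -- the unit
      (∀ c : ℂ, Φ (dwMap Γ (genUnit p).cls fun _ => c) = c • 1) ∧
      -- the multiplication
      (∀ F F' : Fld Γ (BZp p),
        Φ (dwMap Γ (genMul p).cls (box F F')) = Φ F * Φ F' ∧
        ∀ g : Γ, (Φ (dwMap Γ (genMul p).cls (box F F'))).1.coeff g =
          ∑ h : Γ, (Φ F).1.coeff h * (Φ F').1.coeff (h⁻¹ * g)) ∧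
      -- the comultiplication
      (∀ {ι : Type} [Fintype ι] (V : ι → FDRep ℂ Γ), (∀ i, Simple (V i)) →
        (∀ i j, Nonempty (V i ≅ V j) → i = j) →
        (∀ W : FDRep ℂ Γ, Simple W → ∃ i, Nonempty (W ≅ V i)) →
        ∀ (F : Fld Γ (BZp p)) (ρ σ : Zp p →ₜ* Γ),
          dwMap Γ (genComul p).cls F (Bun.cls (copair (bMap ρ) (bMap σ))) =
            ∑ i, ∑ h : Γ, (V i).character (ρ (Multiplicative.ofAdd 1)) * (V i).character h⁻¹ *
              (Φ F).1.coeff (σ (Multiplicative.ofAdd 1) * h)) ∧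
      -- the values at the elements `b_V = ∑ χ_V(g) g`
      (∀ V : FDRep ℂ Γ, Simple V → ∃ b : Fld Γ (BZp p),
        (∀ g : Γ, (Φ b).1.coeff g = V.character g) ∧
        dwMap Γ (genComul p).cls b =
          ((Fintype.card Γ : ℂ) / (Module.finrank ℂ V : ℂ)) • box b b ∧
        dwMap Γ (genTorus p).cls b =
          ((Fintype.card Γ : ℂ) / (Module.finrank ℂ V : ℂ)) ^ 2 • b ∧
        ∀ (r : ℕ) (g : Γ), (Φ (dwMap Γ (genTorusLevel p r).cls b)).1.coeff g =
          (Fintype.card Γ : ℂ) / (Module.finrank ℂ V : ℂ) *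
            ∑ h : Γ, V.character ((g * h⁻¹) ^ (1 - (p : ℤ) ^ r)) * V.character h) ∧
      -- the twists
      ∀ (α : ℤ_[p]ˣ) (F : Fld Γ (BZp p)) (g : Γ),
        (Φ (dwMap Γ (genTwist α).cls F)).1.coeff g = (Φ F).1.coeff (padicPow g (α : ℤ_[p])) ∧
        (Φ (dwMap Γ (genTwistOut α).cls F)).1.coeff g =
          (Φ F).1.coeff (padicPow g ((α⁻¹ : ℤ_[p]ˣ) : ℤ_[p])) := by
  refine ⟨⟨cospanLaws p, dwLaws hΓ, dwBraided _ _, dwBraided_eps _ _, dwBraided_mu _ _⟩,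
    finite_bun_aut, fun f hf => sharp_bijective f hf, sharp_comp,
    fun C C' e f g he _ hg ⟨l⟩ ⟨r⟩ => sharp_naturality hΓ C C' e f g he hg l r,
    fun C D f E _ h => dwMap_gluing hΓ C D f E h,
    fun N _ _ _ _ => ⟨exists_cls_famMap, cls_famMap_eq_iff⟩,
    fun N U G _ _ _ _ _ _ _ _ _ hN hU hG φ τ =>
      ⟨hG.finite_homCls, fun F σ => dwMap_fam N U hN hU hG φ τ F σ⟩,
    bijective_apply_one hΓ, centerEquiv hΓ,
    fun F ρ => congrArg F (cls_bMap_eq_hol hΓ ρ).symm,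
    dwMap_genCounit_apply hΓ, centerEquiv_genUnit hΓ,
    fun F F' => ⟨centerEquiv_genMul hΓ F F', dwMap_genMul_apply hΓ F F'⟩,
    fun V hV hinj hsurj F ρ σ => dwMap_genComul_eq_sum hΓ V hV hinj hsurj F ρ σ,
    fun V hV => ?_,
    fun α F g => ⟨dwMap_genTwist_apply hΓ α F g, dwMap_genTwistOut_apply hΓ α F g⟩⟩
  obtain ⟨b, hb⟩ := exists_fld_character hΓ V
  refine ⟨b, hb, dwMap_genComul_character hΓ V b hb, funext fun P => ?_,
    dwMap_genTorusLevel_apply hΓ V b hb⟩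
  obtain ⟨g, rfl⟩ := exists_hol_eq hΓ P
  rw [dwMap_genTorus_apply hΓ V b hb, Pi.smul_apply, smul_eq_mul, hb]
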